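/- Let $\Bbbk$ be an algebraically closed field of characteristic $3$, let $G$ be the simple algebraic group of type $E_8$ over $\Bbbk$ and $\mathfrak g=\mathrm{Lie}(G)$, with simple root vectors $e_{\alpha_1},\dots,e_{\alpha_8}$ (Bourbaki numbering). Let $e\in\mathfrak g$ lie in the nilpotent orbit $\mathcal O({A_2}^2+{A_1}^2)$, that is, the $G$-orbit (under the adjoint action) of $e_{\alpha_1}+e_{\alpha_2}+e_{\alpha_3}+e_{\alpha_5}+e_{\alpha_6}+e_{\alpha_8}$. Put $\mathfrak g_e=\{x\in\mathfrak g:[x,e]=0\}$, $\mathfrak n_e=\{x\in\mathfrak g:[x,e]\in\Bbbk e\}$ and $L=\mathfrak g_e/\Bbbk e$. Let $\mathcal O(4;\underline 1)=\Bbbk[x_1,x_2,x_3,x_4]/(x_1^3,x_2^3,x_3^3,x_4^3)$, let $\partial_i$ be its partial derivatives, and let $W(4;\underline 1)=\mathrm{Der}\,\mathcal O(4;\underline 1)$, which consists of the derivations $\sum_{i=1}^4 f_i\partial_i$ with $f_i\in\mathcal O(4;\underline 1)$. Put $j'=j+2$ and $\sigma(j)=1$ for $j=1,2$, and $j'=j-2$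 and $\sigma(j)=-1$ for $j=3,4$. The Hamiltonian Lie algebra is $$H(4;\underline 1)=\Big\{\sum_{i=1}^4 f_i\partial_i\in W(4;\underline 1)\;:\;\sigma(j')\,\partial_i(f_{j'})=\sigma(i')\,\partial_j(f_{i'})\ \text{ for all } 1\le i,j\le 4\Big\}.$$ Write $M^{(1)}=[M,M]$ and $M^{(2)}=[M^{(1)},M^{(1)}]$ for a Lie algebra $M$. Then: (a) $L^{(2)}\cong H(4;\underline 1)^{(1)}$ as Lie algebras. (b) $\mathfrak n_e/\Bbbk e$ is isomorphic to a Lie subalgebra of $\mathrm{Der}\,H(4;\underline 1)^{(1)}$. (c) $H(4;\underline 1)^{(1)}\subseteq \mathfrak g_e/\Bbbk e\subseteq H(4;\underline 1)$ as Lie algebras, that is, $\mathfrak g_e/\Bbbk e$ is isomorphic to a Lie subalgebra of $H(4;\underline 1)$ that contains $H(4;\underline 1)^{(1)}$. (d) $\mathfrak n_e$ is a maximal Lie subalgebra of $\mathfrak g$. -/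

import Mathlib

noncomputable section

/-! ### The exceptional Lie algebra of type `E₈`

The root lattice is `Fin 8 → ℤ` (coordinates with respect to the simple roots in Bourbaki's
numbering), with the form given by the Cartan matrix.  The Lie algebra is the Chevalley form:
it has the basis `h i` (simple coroots) and `e a` (`a` a root). -/

namespace ExceptionalE8

/-- The invariant bilinear form on the root lattice. -/
def form (a b : Fin 8 → ℤ) : ℤ := ∑ i, ∑ j, a i * CartanMatrix.E₈ i j * b j

/-- The "upper triangular half" of `form`: one has `form a b = half a b + half b a`. -/
def half (a b : Fin 8 → ℤ) : ℤ :=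
  ∑ i, ∑ j, if i = j then a i * b j else if i < j then a i * CartanMatrix.E₈ i j * b j else 0

/-- The roots are the lattice vectors of norm two. -/
def Root : Type := {a : Fin 8 → ℤ // form a a = 2}

/-- The bimultiplicative sign which gives the structure constants. -/
def sign (a b : Fin 8 → ℤ) : ℤ := ((half a b).negOnePow : ℤˣ)

/-- The underlying module of the Lie algebra of type `E₈` over `k`: the free module on the eight
simple coroots and the roots. -/
def Alg (k : Type*) [CommRing k] : Type _ := (Fin 8 ⊕ Root) →₀ k

section Construction

variable (k : Type*) [CommRing k]

instance : AddCommGroup (Alg k) := inferInstanceAs (AddCommGroup ((Fin 8 ⊕ Root) →₀ k))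

instance : Module k (Alg k) := inferInstanceAs (Module k ((Fin 8 ⊕ Root) →₀ k))

/-- The standard basis vectors. -/
def basisVec (s : Fin 8 ⊕ Root) : Alg k := Finsupp.single s (1 : k)

/-- The element `∑ i, v i • h i` of the Cartan subalgebra; for a root `v` this is its coroot. -/
def cartan (v : Fin 8 → ℤ) : Alg k := ∑ i, v i • basisVec k (Sum.inl i)

/-- The root vector `e v` if `v` is a root, and zero otherwise. -/
def rootVec (v : Fin 8 → ℤ) : Alg k :=
  if hv : form v v = 2 then basisVec k (Sum.inr ⟨v, hv⟩) else 0

/-- The bracket on basis vectors: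
`[h i, h j] = 0`, `[h i, e c] = ⟨α i, c⟩ e c`, `[e a, e c] = sign a c • e (a + c)` if `a + c` is a
root, `[e a, e (-a)] = sign a (-a) • h a = -h a`, and `[e a, e c] = 0` in the remaining cases.
Replacing `e a` by `-e a` for the negative roots `a` gives a Chevalley basis in the usual
normalisation `[e a, e (-a)] = h a`. -/
def basisBracket : Fin 8 ⊕ Root → Fin 8 ⊕ Root → Alg k
  | Sum.inl _, Sum.inl _ => 0
  | Sum.inl i, Sum.inr c => form (Pi.single i 1) c.1 • basisVec k (Sum.inr c)
  | Sum.inr a, Sum.inl i => -(form (Pi.single i 1) a.1 • basisVec k (Sum.inr a))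
  | Sum.inr a, Sum.inr c =>
      sign a.1 c.1 • (rootVec k (a.1 + c.1) + if a.1 + c.1 = 0 then cartan k a.1 else 0)

/-- The bilinear extension of `basisBracket`. -/
def bracketMap : Alg k →ₗ[k] Alg k →ₗ[k] Alg k :=
  Finsupp.linearCombination k
    (fun s => (Finsupp.linearCombination k (basisBracket k s) : ((Fin 8 ⊕ Root) →₀ k) →ₗ[k] Alg k))

end Construction

/-! Arithmetic of the form. -/

lemma form_expand (a c : Fin 8 → ℤ) : form a c =
    2 * (a 0 * c 0 + a 1 * c 1 + a 2 * c 2 + a 3 * c 3 + a 4 * c 4 + a 5 * c 5 + a 6 * c 6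
      + a 7 * c 7) - a 0 * c 2 - a 2 * c 0 - a 1 * c 3 - a 3 * c 1 - a 2 * c 3 - a 3 * c 2
      - a 3 * c 4 - a 4 * c 3 - a 4 * c 5 - a 5 * c 4 - a 5 * c 6 - a 6 * c 5
      - a 6 * c 7 - a 7 * c 6 := by
  simp [form, Fin.sum_univ_eight, CartanMatrix.E₈]
  ring

lemma half_expand (a c : Fin 8 → ℤ) : half a c =
    a 0 * c 0 + a 1 * c 1 + a 2 * c 2 + a 3 * c 3 + a 4 * c 4 + a 5 * c 5 + a 6 * c 6
      + a 7 * c 7 - a 0 * c 2 - a 1 * c 3 - a 2 * c 3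
      - a 3 * c 4 - a 4 * c 5 - a 5 * c 6 - a 6 * c 7 := by
  simp [half, Fin.sum_univ_eight, CartanMatrix.E₈]
  ring

lemma half_add_half (a c : Fin 8 → ℤ) : half a c + half c a = form a c := by
  rw [half_expand, half_expand, form_expand]; ring

lemma form_comm (a c : Fin 8 → ℤ) : form a c = form c a := by
  rw [← half_add_half, ← half_add_half, add_comm]

lemma form_add_left (a c d : Fin 8 → ℤ) : form (a + c) d = form a d + form c d := by
  simp only [form_expand, Pi.add_apply]; ring

lemma form_add_right (a c d : Fin 8 → ℤ) : form a (c + d) = form a c + form a d := by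
  simp only [form_expand, Pi.add_apply]; ring

lemma form_neg_left (a c : Fin 8 → ℤ) : form (-a) c = -form a c := by
  simp only [form_expand, Pi.neg_apply]; ring

lemma form_neg_right (a c : Fin 8 → ℤ) : form a (-c) = -form a c := by
  simp only [form_expand, Pi.neg_apply]; ring

lemma form_zero_left (a : Fin 8 → ℤ) : form 0 a = 0 := by
  simp [form_expand]

lemma half_add_left (a c d : Fin 8 → ℤ) : half (a + c) d = half a d + half c d := by
  simp only [half_expand, Pi.add_apply]; ring

lemma half_add_right (a c d : Fin 8 → ℤ) : half a (c + d) = half a c + half a d := by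
  simp only [half_expand, Pi.add_apply]; ring

lemma half_neg_left (a c : Fin 8 → ℤ) : half (-a) c = -half a c := by
  simp only [half_expand, Pi.neg_apply]; ring

lemma half_neg_right (a c : Fin 8 → ℤ) : half a (-c) = -half a c := by
  simp only [half_expand, Pi.neg_apply]; ring

/-- A sum of squares for the form (after clearing denominators). -/
lemma form_squares (a : Fin 8 → ℤ) : 60 * form a a =
    30 * (2 * a 0 - a 2) ^ 2 + 30 * (2 * a 1 - a 3) ^ 2 + 10 * (3 * a 2 - 2 * a 3) ^ 2
      + 2 * (5 * a 3 - 6 * a 4) ^ 2 + 3 * (4 * a 4 - 5 * a 5) ^ 2 + 5 * (3 * a 5 - 4 * a 6) ^ 2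
      + 10 * (2 * a 6 - 3 * a 7) ^ 2 + 30 * a 7 ^ 2 := by
  rw [form_expand]; ring

lemma form_self_nonneg (a : Fin 8 → ℤ) : 0 ≤ form a a := by
  have := form_squares a
  have h2 : 0 ≤ 60 * form a a := by rw [this]; positivity
  omega

lemma eq_zero_of_form_self (a : Fin 8 → ℤ) (ha : form a a = 0) : a = 0 := by
  have h1 := form_squares a
  rw [ha] at h1
  have h7 : a 7 = 0 := by
    by_contra hne
    have : 0 < a 7 ^ 2 := by positivity
    nlinarith [sq_nonneg (2 * a 0 - a 2), sq_nonneg (2 * a 1 - a 3), sq_nonneg (3 * a 2 - 2 * a 3),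
      sq_nonneg (5 * a 3 - 6 * a 4), sq_nonneg (4 * a 4 - 5 * a 5), sq_nonneg (3 * a 5 - 4 * a 6),
      sq_nonneg (2 * a 6 - 3 * a 7)]
  have key : ∀ u : ℤ, u ^ 2 ≤ 0 → u = 0 := fun u hu => by
    have : u ^ 2 = 0 := le_antisymm hu (sq_nonneg u)
    exact pow_eq_zero_iff (two_ne_zero) |>.mp this
  have h6 : 2 * a 6 - 3 * a 7 = 0 := key _ (by
    nlinarith [sq_nonneg (2 * a 0 - a 2), sq_nonneg (2 * a 1 - a 3), sq_nonneg (3 * a 2 - 2 * a 3),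
      sq_nonneg (5 * a 3 - 6 * a 4), sq_nonneg (4 * a 4 - 5 * a 5), sq_nonneg (3 * a 5 - 4 * a 6),
      sq_nonneg (a 7)])
  have h5 : 3 * a 5 - 4 * a 6 = 0 := key _ (by
    nlinarith [sq_nonneg (2 * a 0 - a 2), sq_nonneg (2 * a 1 - a 3), sq_nonneg (3 * a 2 - 2 * a 3),
      sq_nonneg (5 * a 3 - 6 * a 4), sq_nonneg (4 * a 4 - 5 * a 5), sq_nonneg (2 * a 6 - 3 * a 7),
      sq_nonneg (a 7)])
  have h4 : 4 * a 4 - 5 * a 5 = 0 := key _ (by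
    nlinarith [sq_nonneg (2 * a 0 - a 2), sq_nonneg (2 * a 1 - a 3), sq_nonneg (3 * a 2 - 2 * a 3),
      sq_nonneg (5 * a 3 - 6 * a 4), sq_nonneg (3 * a 5 - 4 * a 6), sq_nonneg (2 * a 6 - 3 * a 7),
      sq_nonneg (a 7)])
  have h3 : 5 * a 3 - 6 * a 4 = 0 := key _ (by
    nlinarith [sq_nonneg (2 * a 0 - a 2), sq_nonneg (2 * a 1 - a 3), sq_nonneg (3 * a 2 - 2 * a 3),
      sq_nonneg (4 * a 4 - 5 * a 5), sq_nonneg (3 * a 5 - 4 * a 6), sq_nonneg (2 * a 6 - 3 * a 7),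
      sq_nonneg (a 7)])
  have h2 : 3 * a 2 - 2 * a 3 = 0 := key _ (by
    nlinarith [sq_nonneg (2 * a 0 - a 2), sq_nonneg (2 * a 1 - a 3), sq_nonneg (5 * a 3 - 6 * a 4),
      sq_nonneg (4 * a 4 - 5 * a 5), sq_nonneg (3 * a 5 - 4 * a 6), sq_nonneg (2 * a 6 - 3 * a 7),
      sq_nonneg (a 7)])
  have h1' : 2 * a 1 - a 3 = 0 := key _ (by
    nlinarith [sq_nonneg (2 * a 0 - a 2), sq_nonneg (3 * a 2 - 2 * a 3), sq_nonneg (5 * a 3 - 6 * a 4),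
      sq_nonneg (4 * a 4 - 5 * a 5), sq_nonneg (3 * a 5 - 4 * a 6), sq_nonneg (2 * a 6 - 3 * a 7),
      sq_nonneg (a 7)])
  have h0 : 2 * a 0 - a 2 = 0 := key _ (by
    nlinarith [sq_nonneg (2 * a 1 - a 3), sq_nonneg (3 * a 2 - 2 * a 3), sq_nonneg (5 * a 3 - 6 * a 4),
      sq_nonneg (4 * a 4 - 5 * a 5), sq_nonneg (3 * a 5 - 4 * a 6), sq_nonneg (2 * a 6 - 3 * a 7),
      sq_nonneg (a 7)])
  funext i
  fin_cases i <;> simp <;> omega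

lemma form_bounds {a c : Fin 8 → ℤ} (ha : form a a = 2) (hc : form c c = 2) :
    -2 ≤ form a c ∧ form a c ≤ 2 := by
  have h1 := form_self_nonneg (a + c)
  have h2 := form_self_nonneg (a + -c)
  simp only [form_add_left, form_add_right, form_neg_left, form_neg_right, form_comm c a] at h1 h2
  omega

lemma add_eq_zero_of_form {a c : Fin 8 → ℤ} (ha : form a a = 2) (hc : form c c = 2)
    (h : form a c = -2) : c = -a := by
  have : a + c = 0 := eq_zero_of_form_self _ (by
    simp only [form_add_left, form_add_right, form_comm c a]; omega)
  exact eq_neg_of_add_eq_zero_right this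

lemma eq_of_form {a c : Fin 8 → ℤ} (ha : form a a = 2) (hc : form c c = 2)
    (h : form a c = 2) : c = a := by
  have : a + -c = 0 := eq_zero_of_form_self _ (by
    simp only [form_add_left, form_add_right, form_neg_left, form_neg_right, form_comm c a]; omega)
  exact (add_neg_eq_zero.mp this).symm

lemma form_add_self {a c : Fin 8 → ℤ} (ha : form a a = 2) (hc : form c c = 2) :
    form (a + c) (a + c) = 4 + 2 * form a c := by
  simp only [form_add_left, form_add_right, form_comm c a]; omega

lemma sign_add_left (a c d : Fin 8 → ℤ) : sign (a + c) d = sign a d * sign c d := by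
  simp [sign, half_add_left, Int.negOnePow_add]

lemma sign_add_right (a c d : Fin 8 → ℤ) : sign a (c + d) = sign a c * sign a d := by
  simp [sign, half_add_right, Int.negOnePow_add]

lemma sign_neg_left (a c : Fin 8 → ℤ) : sign (-a) c = sign a c := by
  simp [sign, half_neg_left, Int.negOnePow_neg]

lemma sign_neg_right (a c : Fin 8 → ℤ) : sign a (-c) = sign a c := by
  simp [sign, half_neg_right, Int.negOnePow_neg]

lemma sign_self {a : Fin 8 → ℤ} (ha : form a a = 2) : sign a a = -1 := by
  have := half_add_half a a
  have h1 : half a a = 1 := by omega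
  simp [sign, h1]

lemma sign_swap (a c : Fin 8 → ℤ) : sign c a = (form a c).negOnePow * sign a c := by
  have h1 := half_add_half a c
  have h2 : half c a = form a c - half a c := by omega
  simp [sign, h2, Int.negOnePow_sub]

lemma sign_cases (a c : Fin 8 → ℤ) : sign a c = 1 ∨ sign a c = -1 := by
  rcases Int.units_eq_one_or (half a c).negOnePow with h | h <;> simp [sign, h]

section Jacobi

variable (k : Type*) [CommRing k]

lemma bracketMap_basisVec (s t : Fin 8 ⊕ Root) :
    bracketMap k (basisVec k s) (basisVec k t) = basisBracket k s t := by
  simp only [bracketMap, basisVec]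
  erw [Finsupp.linearCombination_single, one_smul, Finsupp.linearCombination_single, one_smul]

lemma rootVec_of {v : Fin 8 → ℤ} (hv : form v v = 2) :
    rootVec k v = basisVec k (Sum.inr ⟨v, hv⟩) := dif_pos hv

lemma rootVec_not {v : Fin 8 → ℤ} (hv : form v v ≠ 2) : rootVec k v = 0 := dif_neg hv

lemma cartan_neg (v : Fin 8 → ℤ) : cartan k (-v) = -cartan k v := by
  simp [cartan]

lemma cartan_add (u v : Fin 8 → ℤ) : cartan k (u + v) = cartan k u + cartan k v := by
  simp [cartan, add_smul, Finset.sum_add_distrib]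

lemma cartan_single (i : Fin 8) : cartan k (Pi.single i 1) = basisVec k (Sum.inl i) := by
  simp [cartan, Pi.single_apply]

lemma form_sum_single (u v : Fin 8 → ℤ) : ∑ i, u i * form (Pi.single i 1) v = form u v := by
  simp [form, Pi.single_apply, Finset.mul_sum, mul_assoc]

lemma bracket_cartan_cartan (u v : Fin 8 → ℤ) : bracketMap k (cartan k u) (cartan k v) = 0 := by
  simp [cartan, map_sum, LinearMap.sum_apply, bracketMap_basisVec, basisBracket]

lemma bracket_cartan_rootVec (u v : Fin 8 → ℤ) :
    bracketMap k (cartan k u) (rootVec k v) = form u v • rootVec k v := by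
  by_cases hv : form v v = 2
  · simp only [rootVec_of k hv, cartan, map_sum, LinearMap.sum_apply, map_zsmul,
      LinearMap.smul_apply, bracketMap_basisVec, basisBracket, smul_smul, ← Finset.sum_smul,
      form_sum_single]
  · simp [rootVec_not k hv]

lemma bracket_rootVec_cartan (u v : Fin 8 → ℤ) :
    bracketMap k (rootVec k v) (cartan k u) = -(form u v • rootVec k v) := by
  by_cases hv : form v v = 2
  · simp only [rootVec_of k hv, cartan, map_sum, map_zsmul,
      bracketMap_basisVec, basisBracket, smul_neg, smul_smul, Finset.sum_neg_distrib,
      ← Finset.sum_smul, form_sum_single]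
  · simp [rootVec_not k hv]

lemma bracket_rootVec_rootVec {u v : Fin 8 → ℤ} (hu : form u u = 2) (hv : form v v = 2) :
    bracketMap k (rootVec k u) (rootVec k v) =
      sign u v • (rootVec k (u + v) + if u + v = 0 then cartan k u else 0) := by
  simp only [rootVec_of k hu, rootVec_of k hv, bracketMap_basisVec, basisBracket]

lemma bracket_root {u v : Fin 8 → ℤ} (hu : form u u = 2) (hv : form v v = 2)
    (huv : form u v = -1) :
    bracketMap k (rootVec k u) (rootVec k v) = sign u v • rootVec k (u + v) := by
  have : u + v ≠ 0 := fun h0 => by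
    have := form_add_self hu hv
    rw [h0, form_zero_left] at this; omega
  rw [bracket_rootVec_rootVec k hu hv, if_neg this, add_zero]

lemma bracket_zero {u v : Fin 8 → ℤ} (hu : form u u = 2) (hv : form v v = 2)
    (huv : 0 ≤ form u v) :
    bracketMap k (rootVec k u) (rootVec k v) = 0 := by
  have h1 := form_add_self hu hv
  have : u + v ≠ 0 := fun h0 => by
    rw [h0, form_zero_left] at h1; omega
  rw [bracket_rootVec_rootVec k hu hv, if_neg this, add_zero, rootVec_not k (by omega), smul_zero]

lemma bracket_opp {u : Fin 8 → ℤ} (hu : form u u = 2) :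
    bracketMap k (rootVec k u) (rootVec k (-u)) = -cartan k u := by
  have hu' : form (-u) (-u) = 2 := by simp [form_neg_left, form_neg_right, hu]
  rw [bracket_rootVec_rootVec k hu hu', add_neg_cancel, if_pos rfl,
    rootVec_not k (by rw [form_zero_left]; omega), sign_neg_right, sign_self hu]
  simp

lemma bracket_opp' {u : Fin 8 → ℤ} (hu : form u u = 2) :
    bracketMap k (rootVec k (-u)) (rootVec k u) = cartan k u := by
  have hu' : form (-u) (-u) = 2 := by simp [form_neg_left, form_neg_right, hu]
  have := bracket_opp k hu'
  rwa [neg_neg, cartan_neg, neg_neg] at this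

lemma bracket_skew_root {u v : Fin 8 → ℤ} (hu : form u u = 2) (hv : form v v = 2) :
    bracketMap k (rootVec k u) (rootVec k v) = -bracketMap k (rootVec k v) (rootVec k u) := by
  obtain ⟨h1, h2⟩ := form_bounds hu hv
  have hc := form_comm v u
  rcases le_or_gt 0 (form u v) with h | h
  · rw [bracket_zero k hu hv h, bracket_zero k hv hu (by omega), neg_zero]
  · have : form u v = -1 ∨ form u v = -2 := by omega
    rcases this with h | h
    · rw [bracket_root k hu hv h, bracket_root k hv hu (by omega), sign_swap u v, h, add_comm v u]
      simp
    · obtain rfl := add_eq_zero_of_form hu hv h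
      rw [bracket_opp k hu, bracket_opp' k hu]

lemma jacobi_opp {u v : Fin 8 → ℤ} (hu : form u u = 2) (hv : form v v = 2) :
    bracketMap k (rootVec k u) (bracketMap k (rootVec k v) (rootVec k (-v)))
      + bracketMap k (rootVec k v) (bracketMap k (rootVec k (-v)) (rootVec k u))
      + bracketMap k (rootVec k (-v)) (bracketMap k (rootVec k u) (rootVec k v)) = 0 := by
  have hv' : form (-v) (-v) = 2 := by simp [form_neg_left, form_neg_right, hv]
  have hc := form_comm v u
  have hn : form (-v) u = -form u v := by rw [form_neg_left, hc]
  rw [bracket_opp k hv, map_neg, bracket_rootVec_cartan, neg_neg]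
  obtain ⟨h1, h2⟩ := form_bounds hu hv
  have : form u v = -2 ∨ form u v = -1 ∨ form u v = 0 ∨ form u v = 1 ∨ form u v = 2 := by omega
  rcases this with h | h | h | h | h
  · obtain rfl : u = -v := by
      rw [add_eq_zero_of_form hu hv h, neg_neg]
    rw [bracket_zero k hv' hv' (by omega), bracket_opp' k hv, bracket_rootVec_cartan, hc, h]
    simp
  · have hw : form (u + v) (u + v) = 2 := by rw [form_add_self hu hv, h]; norm_num
    rw [bracket_zero k hv' hu (by omega), bracket_root k hu hv h, map_zsmul,
      bracket_root k hv' hw (by rw [form_add_right, hn, form_neg_left]; omega),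
      hc, h, sign_neg_left, sign_add_right, sign_self hv, sign_swap u v, h]
    have : -v + (u + v) = u := by abel
    rw [this]
    rcases sign_cases u v with h' | h' <;> simp [h']
  · rw [bracket_zero k hv' hu (by omega), bracket_zero k hu hv (by omega), hc, h]
    simp
  · have hw : form (-v + u) (-v + u) = 2 := by rw [form_add_self hv' hu, hn, h]; norm_num
    rw [bracket_zero k hu hv (by omega), bracket_root k hv' hu (by omega), map_zsmul,
      bracket_root k hv hw (by rw [form_add_right, hc, form_neg_right]; omega),
      hc, h, sign_neg_left, sign_add_right, sign_neg_right, sign_self hv]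
    have : v + (-v + u) = u := by abel
    rw [this]
    rcases sign_cases v u with h' | h' <;> simp [h']
  · obtain rfl := eq_of_form hu hv h
    rw [bracket_zero k hv hv (by omega), bracket_opp' k hv, bracket_rootVec_cartan]
    simp

lemma jacobi_two {u v w : Fin 8 → ℤ} (hu : form u u = 2) (hv : form v v = 2) (hw : form w w = 2)
    (huv : form u v = -1) (hvw : form v w = -1) (hwu : 0 ≤ form w u) :
    bracketMap k (rootVec k u) (bracketMap k (rootVec k v) (rootVec k w))
      + bracketMap k (rootVec k v) (bracketMap k (rootVec k w) (rootVec k u))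
      + bracketMap k (rootVec k w) (bracketMap k (rootVec k u) (rootVec k v)) = 0 := by
  have h1 : form (v + w) (v + w) = 2 := by rw [form_add_self hv hw, hvw]; norm_num
  have h2 : form (u + v) (u + v) = 2 := by rw [form_add_self hu hv, huv]; norm_num
  have h3 : form u (v + w) = form w u - 1 := by rw [form_add_right, form_comm u w]; omega
  have h4 : form w (u + v) = form w u - 1 := by rw [form_add_right, form_comm w v]; omega
  rw [bracket_zero k hw hu hwu, bracket_root k hu hv huv, bracket_root k hv hw hvw, map_zsmul,
    map_zsmul, map_zero, add_zero]
  rcases hwu.eq_or_lt with h | h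
  · rw [bracket_root k hu h1 (by omega), bracket_root k hw h2 (by omega), sign_add_right,
      sign_add_right, sign_swap v w, sign_swap u w, hvw, form_comm u w, ← h]
    have : w + (u + v) = u + (v + w) := by abel
    rw [this, smul_smul, smul_smul, ← add_smul]
    rcases sign_cases u v with s1 | s1 <;> rcases sign_cases v w with s2 | s2 <;>
      rcases sign_cases u w with s3 | s3 <;> simp [s1, s2, s3]
  · rw [bracket_zero k hu h1 (by omega), bracket_zero k hw h2 (by omega)]
    simp

lemma jacobi_three {u v w : Fin 8 → ℤ} (hu : form u u = 2) (hv : form v v = 2) (hw : form w w = 2)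
    (huv : form u v = -1) (hvw : form v w = -1) (hwu : form w u = -1) :
    bracketMap k (rootVec k u) (bracketMap k (rootVec k v) (rootVec k w))
      + bracketMap k (rootVec k v) (bracketMap k (rootVec k w) (rootVec k u))
      + bracketMap k (rootVec k w) (bracketMap k (rootVec k u) (rootVec k v)) = 0 := by
  have h2 : form (u + v) (u + v) = 2 := by rw [form_add_self hu hv, huv]; norm_num
  obtain rfl : w = -(u + v) := add_eq_zero_of_form h2 hw (by
    rw [form_add_left, hvw, form_comm, hwu]; norm_num)
  rw [bracket_root k hu hv huv, bracket_root k hv hw hvw, bracket_root k hw hu hwu, map_zsmul,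
    map_zsmul, map_zsmul]
  have e1 : v + -(u + v) = -u := by abel
  have e2 : -(u + v) + u = -v := by abel
  rw [e1, e2, bracket_opp k hu, bracket_opp k hv, bracket_opp' k h2, cartan_add, sign_neg_right,
    sign_neg_left, sign_add_right, sign_add_left, sign_self hu, sign_self hv, sign_swap u v, huv]
  rcases sign_cases u v with h' | h' <;> simp [h'] <;> abel

lemma jacobi_zero {u v w : Fin 8 → ℤ} (hu : form u u = 2) (hv : form v v = 2) (hw : form w w = 2)
    (huv : 0 ≤ form u v) (hwu : 0 ≤ form w u) (hvw : -1 ≤ form v w) :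
    bracketMap k (rootVec k u) (bracketMap k (rootVec k v) (rootVec k w))
      + bracketMap k (rootVec k v) (bracketMap k (rootVec k w) (rootVec k u))
      + bracketMap k (rootVec k w) (bracketMap k (rootVec k u) (rootVec k v)) = 0 := by
  rw [bracket_zero k hu hv huv, bracket_zero k hw hu hwu, map_zero, map_zero, add_zero, add_zero]
  rcases hvw.eq_or_lt with h | h
  · have h1 : form (v + w) (v + w) = 2 := by rw [form_add_self hv hw, ← h]; norm_num
    rw [bracket_root k hv hw h.symm, map_zsmul, bracket_zero k hu h1, smul_zero]
    rw [form_add_right, form_comm u w]; omega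
  · rw [bracket_zero k hv hw (by omega), map_zero]

lemma jacobi_root {u v w : Fin 8 → ℤ} (hu : form u u = 2) (hv : form v v = 2)
    (hw : form w w = 2) :
    bracketMap k (rootVec k u) (bracketMap k (rootVec k v) (rootVec k w))
      + bracketMap k (rootVec k v) (bracketMap k (rootVec k w) (rootVec k u))
      + bracketMap k (rootVec k w) (bracketMap k (rootVec k u) (rootVec k v)) = 0 := by
  have rot : ∀ p q r : Alg k, r + p + q = 0 → p + q + r = 0 := fun p q r h => by
    rw [← h]; abel
  have rot' : ∀ p q r : Alg k, q + r + p = 0 → p + q + r = 0 := fun p q r h => by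
    rw [← h]; abel
  obtain ⟨b1, -⟩ := form_bounds hu hv
  obtain ⟨b2, -⟩ := form_bounds hv hw
  obtain ⟨b3, -⟩ := form_bounds hw hu
  by_cases c2 : form v w = -2
  · obtain rfl := add_eq_zero_of_form hv hw c2
    exact jacobi_opp k hu hv
  by_cases c3 : form w u = -2
  · obtain rfl := add_eq_zero_of_form hw hu c3
    exact rot' _ _ _ (jacobi_opp k hv hw)
  by_cases c1 : form u v = -2
  · obtain rfl := add_eq_zero_of_form hu hv c1
    exact rot _ _ _ (jacobi_opp k hw hu)
  by_cases d1 : form u v = -1 <;> by_cases d2 : form v w = -1 <;> by_cases d3 : form w u = -1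
  · exact jacobi_three k hu hv hw d1 d2 d3
  · exact jacobi_two k hu hv hw d1 d2 (by omega)
  · exact rot _ _ _ (jacobi_two k hw hu hv d3 d1 (by omega))
  · exact rot _ _ _ (jacobi_zero k hw hu hv (by omega) (by omega) (by omega))
  · exact rot' _ _ _ (jacobi_two k hv hw hu d2 d3 (by omega))
  · exact jacobi_zero k hu hv hw (by omega) (by omega) (by omega)
  · exact rot' _ _ _ (jacobi_zero k hv hw hu (by omega) (by omega) (by omega))
  · exact jacobi_zero k hu hv hw (by omega) (by omega) (by omega)

lemma ext_basisVec {M : Type*} [AddCommGroup M] [Module k M] {f g : Alg k →ₗ[k] M}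
    (h : ∀ s, f (basisVec k s) = g (basisVec k s)) : f = g :=
  Finsupp.lhom_ext' fun s => LinearMap.ext_ring (h s)

lemma basisVec_inr (a : Root) : basisVec k (Sum.inr a) = rootVec k a.1 := (rootVec_of k a.2).symm

lemma bracket_skew (y z : Alg k) : bracketMap k y z = -bracketMap k z y := by
  have : bracketMap k = -(bracketMap k).flip := by
    refine ext_basisVec k fun s => ext_basisVec k fun t => ?_
    simp only [LinearMap.neg_apply, LinearMap.flip_apply]
    rcases s with i | a <;> rcases t with j | c
    · simp only [← cartan_single, bracket_cartan_cartan, neg_zero]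
    · simp only [← cartan_single, basisVec_inr, bracket_cartan_rootVec, bracket_rootVec_cartan,
        neg_neg]
    · simp only [← cartan_single, basisVec_inr, bracket_cartan_rootVec, bracket_rootVec_cartan]
    · simp only [basisVec_inr]
      exact bracket_skew_root k a.2 c.2
  exact congrArg (fun f : Alg k →ₗ[k] Alg k →ₗ[k] Alg k => f y z) this

lemma bracket_basisVec_self (s : Fin 8 ⊕ Root) :
    bracketMap k (basisVec k s) (basisVec k s) = 0 := by
  rcases s with i | a
  · simp only [← cartan_single, bracket_cartan_cartan]
  · rw [basisVec_inr]
    exact bracket_zero k a.2 a.2 (by rw [a.2]; norm_num)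

lemma bracket_add_self {y z : Alg k} (hy : bracketMap k y y = 0) (hz : bracketMap k z z = 0) :
    bracketMap k (y + z) (y + z) = 0 := by
  simp only [map_add, LinearMap.add_apply, hy, hz, bracket_skew k y z]
  simp

lemma bracket_self (y : Alg k) : bracketMap k y y = 0 := by
  refine Finsupp.induction_linear (motive := fun y : Alg k => bracketMap k y y = 0) y ?_ ?_ ?_
  · exact map_zero _
  · exact fun f g hf hg => bracket_add_self k hf hg
  · intro s t
    have : (Finsupp.single s t : (Fin 8 ⊕ Root) →₀ k) = t • (basisVec k s : Alg k) := by
      change Finsupp.single s t = t • Finsupp.single s (1 : k)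
      rw [Finsupp.smul_single, smul_eq_mul, mul_one]
    rw [this]
    simp [bracket_basisVec_self]

lemma bracket_cartan_bracket {u v w : Fin 8 → ℤ} (hv : form v v = 2) (hw : form w w = 2) :
    bracketMap k (cartan k u) (bracketMap k (rootVec k v) (rootVec k w)) =
      form u (v + w) • bracketMap k (rootVec k v) (rootVec k w) := by
  rw [bracket_rootVec_rootVec k hv hw, map_zsmul, map_add, bracket_cartan_rootVec]
  split_ifs with h
  · simp [h, bracket_cartan_cartan, form_comm u 0, form_zero_left]
  · simp [smul_comm (sign v w)]

lemma leibniz_basis (s t r : Fin 8 ⊕ Root) :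
    bracketMap k (basisVec k s) (bracketMap k (basisVec k t) (basisVec k r)) =
    bracketMap k (bracketMap k (basisVec k s) (basisVec k t)) (basisVec k r)
      + bracketMap k (basisVec k t) (bracketMap k (basisVec k s) (basisVec k r)) := by
  rcases s with i | a <;> rcases t with j | c <;> rcases r with l | d
  · simp only [← cartan_single, bracket_cartan_cartan, map_zero, LinearMap.zero_apply, add_zero]
  · simp only [← cartan_single, basisVec_inr, bracket_cartan_cartan, bracket_cartan_rootVec,
      map_zsmul, LinearMap.zero_apply, map_zero, zero_add]
    rw [smul_comm]
  · simp only [← cartan_single, basisVec_inr, bracket_cartan_cartan, bracket_cartan_rootVec,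
      bracket_rootVec_cartan, map_zsmul, map_neg, LinearMap.smul_apply, map_zero, add_zero, smul_neg]
    rw [smul_comm]
  · simp only [← cartan_single, basisVec_inr, bracket_cartan_rootVec, map_zsmul,
      LinearMap.smul_apply]
    rw [bracket_cartan_bracket k c.2 d.2, form_add_right, add_smul]
  · simp only [← cartan_single, basisVec_inr, bracket_cartan_cartan, bracket_rootVec_cartan,
      map_zsmul, map_neg, LinearMap.neg_apply, LinearMap.smul_apply, map_zero, smul_neg, neg_neg,
      bracket_cartan_rootVec]
    rw [smul_comm]; simp
  · simp only [← cartan_single, basisVec_inr, bracket_cartan_rootVec, bracket_rootVec_cartan,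
      map_zsmul, map_neg, LinearMap.neg_apply, LinearMap.smul_apply]
    rw [bracket_cartan_bracket k a.2 d.2, form_add_right, add_smul]
    abel
  · simp only [← cartan_single, basisVec_inr, bracket_rootVec_cartan, map_zsmul, map_neg]
    rw [bracket_skew k (bracketMap k (rootVec k a.1) (rootVec k c.1)) (cartan k _),
      bracket_cartan_bracket k a.2 c.2, form_add_right, add_smul,
      bracket_skew_root k c.2 a.2]
    simp
  · simp only [basisVec_inr]
    have h := jacobi_root k a.2 c.2 d.2
    rw [bracket_skew k (bracketMap k (rootVec k a.1) (rootVec k c.1)) (rootVec k d.1)]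
    rw [bracket_skew_root k d.2 a.2, map_neg] at h
    rw [← sub_eq_zero, ← h]
    abel

lemma bracket_leibniz (y z w : Alg k) : bracketMap k y (bracketMap k z w) =
    bracketMap k (bracketMap k y z) w + bracketMap k z (bracketMap k y w) := by
  have step1 : ∀ s t w, bracketMap k (basisVec k s) (bracketMap k (basisVec k t) w) =
      bracketMap k (bracketMap k (basisVec k s) (basisVec k t)) w
        + bracketMap k (basisVec k t) (bracketMap k (basisVec k s) w) := fun s t w =>
    congrArg (fun f : Alg k →ₗ[k] Alg k => f w) (ext_basisVec k
      (f := bracketMap k (basisVec k s) ∘ₗ bracketMap k (basisVec k t))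
      (g := bracketMap k (bracketMap k (basisVec k s) (basisVec k t))
        + bracketMap k (basisVec k t) ∘ₗ bracketMap k (basisVec k s))
      fun r => leibniz_basis k s t r)
  have step2 : ∀ s z w, bracketMap k (basisVec k s) (bracketMap k z w) =
      bracketMap k (bracketMap k (basisVec k s) z) w
        + bracketMap k z (bracketMap k (basisVec k s) w) := fun s z w =>
    congrArg (fun f : Alg k →ₗ[k] Alg k => f z) (ext_basisVec k
      (f := bracketMap k (basisVec k s) ∘ₗ (bracketMap k).flip w)
      (g := (bracketMap k).flip w ∘ₗ bracketMap k (basisVec k s)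
        + (bracketMap k).flip (bracketMap k (basisVec k s) w))
      fun t => step1 s t w)
  exact congrArg (fun f : Alg k →ₗ[k] Alg k => f y) (ext_basisVec k
      (f := (bracketMap k).flip (bracketMap k z w))
      (g := (bracketMap k).flip w ∘ₗ (bracketMap k).flip z
        + bracketMap k z ∘ₗ (bracketMap k).flip w)
      fun s => step2 s z w)

instance : LieRing (Alg k) where
  bracket y z := bracketMap k y z
  add_lie y z w := by
    change bracketMap k (y + z) w = _
    rw [map_add]; rfl
  lie_add y z w := map_add (bracketMap k y) z w
  lie_self := bracket_self k
  leibniz_lie := bracket_leibniz k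

instance : LieAlgebra k (Alg k) where
  lie_smul t y z := map_smul (bracketMap k y) t z

lemma lie_def (y z : Alg k) : ⁅y, z⁆ = bracketMap k y z := rfl

/-- Root vectors satisfy `(ad e)³ = 0`. -/
lemma ad_cube (a : Root) (y : Alg k) :
    ⁅rootVec k a.1, ⁅rootVec k a.1, ⁅rootVec k a.1, y⁆⁆⁆ = 0 := by
  simp only [lie_def]
  have h0 := bracket_self k (rootVec k a.1)
  refine congrArg (fun f : Alg k →ₗ[k] Alg k => f y) (ext_basisVec k
    (f := bracketMap k (rootVec k a.1) ∘ₗ bracketMap k (rootVec k a.1) ∘ₗ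
      bracketMap k (rootVec k a.1)) (g := 0) fun s => ?_)
  simp only [LinearMap.comp_apply, LinearMap.zero_apply]
  rcases s with i | c
  · rw [← cartan_single, bracket_rootVec_cartan]
    simp [h0]
  · rw [basisVec_inr]
    obtain ⟨h1, h2⟩ := form_bounds a.2 c.2
    have h3 := form_add_self a.2 c.2
    rcases le_or_gt 0 (form a.1 c.1) with h | h
    · rw [bracket_zero k a.2 c.2 h]; simp
    · have : form a.1 c.1 = -1 ∨ form a.1 c.1 = -2 := by omega
      rcases this with h | h
      · rw [bracket_root k a.2 c.2 h, map_zsmul, bracket_zero k a.2 (by omega)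
          (by rw [form_add_right, a.2, h]; norm_num)]
        simp
      · rw [add_eq_zero_of_form a.2 c.2 h, bracket_opp k a.2, map_neg, bracket_rootVec_cartan]
        simp [h0]

end Jacobi

/-! ### The group of type `E₈` and the nilpotent orbit -/

section Orbit

variable (k : Type*) [Field k] [CharP k 3]

/-- The root group element `exp (t • ad e_a) = 1 + t • ad e_a + (t² / 2) • (ad e_a)²` acting on the
Lie algebra (characteristic three). -/
def rootElement (a : Root) (t : k) : Alg k ≃ₗ[k] Alg k :=
  have key : ∀ (t : k) (y : Alg k),
      (fun y : Alg k => y + t • ⁅rootVec k a.1, y⁆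
          + (t ^ 2 / 2) • ⁅rootVec k a.1, ⁅rootVec k a.1, y⁆⁆)
        (y + (-t) • ⁅rootVec k a.1, y⁆
          + ((-t) ^ 2 / 2) • ⁅rootVec k a.1, ⁅rootVec k a.1, y⁆⁆) = y := fun t y => by
    have h2 : (2 : k) ≠ 0 := fun h => by
      have h3 : ((3 : ℕ) : k) = 0 := CharP.cast_eq_zero k 3
      have h1 : (1 : k) = 0 := by
        have : (1 : k) = ((3 : ℕ) : k) - 2 := by norm_num
        rw [this, h3, h, sub_zero]
      exact one_ne_zero h1
    simp only [lie_add, lie_smul, ad_cube, smul_zero, add_zero]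
    match_scalars <;> field_simp <;> ring
  { toFun := fun y => y + t • ⁅rootVec k a.1, y⁆
        + (t ^ 2 / 2) • ⁅rootVec k a.1, ⁅rootVec k a.1, y⁆⁆
    invFun := fun y => y + (-t) • ⁅rootVec k a.1, y⁆
        + ((-t) ^ 2 / 2) • ⁅rootVec k a.1, ⁅rootVec k a.1, y⁆⁆
    map_add' := fun y z => by
      simp only [lie_add, smul_add]; abel
    map_smul' := fun c y => by
      simp only [lie_smul, smul_add, RingHom.id_apply, smul_comm c]
    left_inv := fun y => by
      have := key (-t) y
      rwa [neg_neg] at this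
    right_inv := key t }

/-- The Chevalley group of type `E₈` in its adjoint representation: the subgroup of `GL(𝔤)`
generated by all root group elements. Over an algebraically closed field this is the group of
points of the (simply connected and adjoint) algebraic group of type `E₈`, and its action is the
adjoint action. -/
def chevalleyGroup : Subgroup (Alg k ≃ₗ[k] Alg k) :=
  Subgroup.closure {g | ∃ (a : Root) (t : k), g = rootElement k a t}

/-- The element `e_{α₁} + e_{α₃} + e_{α₅} + e_{α₆} + e_{α₂} + e_{α₈}` (Bourbaki numbering; index `i`
of `Fin 8` is the node `i + 1`): the sum of the simple root vectors of the standard Levi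
subalgebra of type `A₂ + A₂ + A₁ + A₁`. -/
def standardRep : Alg k := ∑ i ∈ ({0, 2, 4, 5, 1, 7} : Finset (Fin 8)), rootVec k (Pi.single i 1)

/-- The nilpotent orbit labelled `A₂² + A₁²`. -/
def orbitA2A2A1A1 : Set (Alg k) := {e | ∃ g ∈ chevalleyGroup k, e = g (standardRep k)}

end Orbit

end ExceptionalE8

/-! ### Centraliser, normaliser, and the quotients by the line `k e` -/

namespace LieLine

variable {k L : Type*} [CommRing k] [LieRing L] [LieAlgebra k L]

/-- The centraliser of an element. -/
def centralizer (e : L) : LieSubalgebra k L where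
  carrier := {y | ⁅y, e⁆ = 0}
  zero_mem' := zero_lie e
  add_mem' := fun {y z} (hy : ⁅y, e⁆ = 0) (hz : ⁅z, e⁆ = 0) => by
    change ⁅y + z, e⁆ = 0
    rw [add_lie, hy, hz, add_zero]
  smul_mem' := fun c y (hy : ⁅y, e⁆ = 0) => by
    change ⁅c • y, e⁆ = 0
    rw [smul_lie, hy, smul_zero]
  lie_mem' := fun {y z} (hy : ⁅y, e⁆ = 0) (hz : ⁅z, e⁆ = 0) => by
    change ⁅⁅y, z⁆, e⁆ = 0
    rw [lie_lie, hy, hz, lie_zero, lie_zero, sub_zero]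

/-- The line `k e` as a Lie subalgebra. -/
def line (e : L) : LieSubalgebra k L where
  toSubmodule := k ∙ e
  lie_mem' := fun {y z} hy hz => by
    obtain ⟨c, rfl⟩ := Submodule.mem_span_singleton.mp hy
    obtain ⟨d, rfl⟩ := Submodule.mem_span_singleton.mp hz
    simp

/-- The normaliser `{y | [y, e] ∈ k e}` of (the line spanned by) an element. -/
def normalizer (e : L) : LieSubalgebra k L := (line (k := k) e).normalizer

lemma centralizer_le_normalizer (e : L) : centralizer (k := k) e ≤ normalizer e := fun y hy => by
  refine (LieSubalgebra.mem_normalizer_iff _ _).mpr fun z hz => ?_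
  obtain ⟨c, rfl⟩ := Submodule.mem_span_singleton.mp hz
  have : ⁅y, e⁆ = 0 := hy
  rw [lie_smul, this, smul_zero]
  exact zero_mem _

/-- The line `k e` as an ideal of a Lie subalgebra which normalises it; for `e ∈ K`, the quotient
`K / k e` is `K ⧸ lineIdeal e K hK`. -/
def lineIdeal (e : L) (K : LieSubalgebra k L) (hK : K ≤ normalizer e) : LieIdeal k K where
  toSubmodule := (k ∙ e).comap K.toSubmodule.subtype
  lie_mem := fun {y z} hz => (LieSubalgebra.mem_normalizer_iff _ _).mp (hK y.2) z.1 hz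

/-- The quotient `𝔤_e / k e`. -/
abbrev CentralizerQuotient (k : Type*) {L : Type*} [CommRing k] [LieRing L] [LieAlgebra k L]
    (e : L) : Type _ :=
  centralizer (k := k) e ⧸ lineIdeal e (centralizer (k := k) e) (centralizer_le_normalizer e)

/-- The quotient `𝔫_e / k e`. -/
abbrev NormalizerQuotient (k : Type*) {L : Type*} [CommRing k] [LieRing L] [LieAlgebra k L]
    (e : L) : Type _ :=
  normalizer (k := k) e ⧸ lineIdeal e (normalizer (k := k) e) le_rfl

end LieLine

/-! ### The Hamiltonian Lie algebra `H(2m; 1)` -/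

namespace Hamiltonian

open MvPolynomial

section Poly

variable (p m : ℕ) (k : Type*) [CommRing k]

/-- The ideal generated by the `p`-th powers of the `2 m` variables. -/
def truncIdeal : Ideal (MvPolynomial (Fin m ⊕ Fin m) k) :=
  Ideal.span (Set.range fun i => X i ^ p)

/-- The truncated polynomial ring `O(2m; 1)` in characteristic `p`. The variables `x_1, ..., x_m`
are indexed by `Sum.inl` and `x_{m+1}, ..., x_{2m}` by `Sum.inr`. -/
abbrev Trunc : Type _ := MvPolynomial (Fin m ⊕ Fin m) k ⧸ truncIdeal p m k

/-- The variables. -/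
def var (i : Fin m ⊕ Fin m) : Trunc p m k := Ideal.Quotient.mk _ (X i)

lemma derivation_ext {D E : Derivation k (Trunc p m k) (Trunc p m k)}
    (h : ∀ i, D (var p m k i) = E (var p m k i)) : D = E := by
  let π : MvPolynomial (Fin m ⊕ Fin m) k →ₐ[k] Trunc p m k := Ideal.Quotient.mkₐ k _
  ext f
  obtain ⟨f, rfl⟩ := Ideal.Quotient.mk_surjective f
  change D (π f) = E (π f)
  induction f using MvPolynomial.induction_on with
  | C a =>
    have : π (C a) = algebraMap k _ a := π.commutes a
    rw [this, Derivation.map_algebraMap, Derivation.map_algebraMap]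
  | add f g hf hg => rw [map_add, map_add, map_add, hf, hg]
  | mul_X f i hf =>
    have : D (π (X i)) = E (π (X i)) := h i
    rw [map_mul, Derivation.leibniz, Derivation.leibniz, hf, this]

lemma sum_apply {ι : Type*} (t : Finset ι) (F : ι → Derivation k (Trunc p m k) (Trunc p m k))
    (f : Trunc p m k) : (∑ i ∈ t, F i) f = ∑ i ∈ t, F i f := by
  change Derivation.coeFnAddMonoidHom (∑ i ∈ t, F i) f = _
  rw [map_sum, Finset.sum_apply]; rfl

variable [CharP k p]

lemma pderiv_mem (i : Fin m ⊕ Fin m) {f : MvPolynomial (Fin m ⊕ Fin m) k}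
    (hf : f ∈ truncIdeal p m k) : pderiv i f ∈ truncIdeal p m k := by
  refine Submodule.span_induction ?_ ?_ ?_ ?_ hf
  · rintro _ ⟨j, rfl⟩
    simp [Derivation.leibniz_pow]
  · simp
  · intro f g _ _ hf hg
    rw [map_add]
    exact add_mem hf hg
  · intro c f hf' hf
    rw [smul_eq_mul, Derivation.leibniz]
    exact add_mem (Ideal.mul_mem_left _ _ hf) (Ideal.mul_mem_right _ _ hf')

/-- The partial derivatives of the truncated polynomial ring. -/
def partialD (i : Fin m ⊕ Fin m) : Derivation k (Trunc p m k) (Trunc p m k) :=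
  Derivation.mk'
    (Submodule.mapQ ((truncIdeal p m k).restrictScalars k)
      ((truncIdeal p m k).restrictScalars k) (pderiv i).toLinearMap
      fun _ hf => pderiv_mem p m k i hf : Trunc p m k →ₗ[k] Trunc p m k)
    (by
      intro f g
      obtain ⟨f, rfl⟩ := Ideal.Quotient.mk_surjective f
      obtain ⟨g, rfl⟩ := Ideal.Quotient.mk_surjective g
      change Ideal.Quotient.mk (truncIdeal p m k) (pderiv i (f * g)) =
        Ideal.Quotient.mk _ f * Ideal.Quotient.mk _ (pderiv i g)
          + Ideal.Quotient.mk _ g * Ideal.Quotient.mk _ (pderiv i f)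
      rw [Derivation.leibniz, map_add, smul_eq_mul, smul_eq_mul, map_mul, map_mul])

lemma partialD_mk (i : Fin m ⊕ Fin m) (f : MvPolynomial (Fin m ⊕ Fin m) k) :
    partialD p m k i (Ideal.Quotient.mk _ f) = Ideal.Quotient.mk _ (pderiv i f) := rfl

lemma partialD_var (i j : Fin m ⊕ Fin m) :
    partialD p m k i (var p m k j) = if i = j then 1 else 0 := by
  rw [var, partialD_mk, pderiv_X, Pi.single_apply]
  by_cases h : i = j
  · subst h; simp
  · rw [if_neg h, if_neg (Ne.symm h), map_zero]

/-- Every derivation is `∑ i, D(x_i) ∂_i`. -/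
lemma derivation_eq (D : Derivation k (Trunc p m k) (Trunc p m k)) (f : Trunc p m k) :
    D f = ∑ i, D (var p m k i) * partialD p m k i f := by
  have : D = ∑ i, D (var p m k i) • partialD p m k i := by
    refine derivation_ext p m k fun j => ?_
    rw [sum_apply, Finset.sum_eq_single j]
    · simp [partialD_var]
    · intro i _ hi
      simp [partialD_var, hi]
    · simp
  conv_lhs => rw [this]
  rw [sum_apply]; rfl

lemma partialD_comm (i j : Fin m ⊕ Fin m) (f : Trunc p m k) :
    partialD p m k i (partialD p m k j f) = partialD p m k j (partialD p m k i f) := by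
  have : ⁅partialD p m k i, partialD p m k j⁆ = 0 := by
    refine derivation_ext p m k fun l => ?_
    rw [Derivation.commutator_apply, partialD_var, partialD_var]
    split_ifs <;> simp
  have h := congrArg (fun D : Derivation k (Trunc p m k) (Trunc p m k) => D f) this
  simp only [Derivation.commutator_apply, Derivation.coe_zero, Pi.zero_apply] at h
  exact sub_eq_zero.mp h

/-- The sign `σ(j)`: `1` for the first `m` indices and `-1` for the last `m`. -/
def sgn {m : ℕ} : Fin m ⊕ Fin m → ℤ
  | Sum.inl _ => 1
  | Sum.inr _ => -1

lemma sgn_swap {m : ℕ} (j : Fin m ⊕ Fin m) : sgn j.swap = -sgn j := by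
  cases j <;> simp [sgn]

lemma partialD_apply (i : Fin m ⊕ Fin m) (D : Derivation k (Trunc p m k) (Trunc p m k))
    (f : Trunc p m k) : partialD p m k i (D f) =
      ∑ l, partialD p m k i (D (var p m k l)) * partialD p m k l f + D (partialD p m k i f) := by
  rw [derivation_eq p m k D f, derivation_eq p m k D (partialD p m k i f), map_sum,
    ← Finset.sum_add_distrib]
  refine Finset.sum_congr rfl fun l _ => ?_
  rw [Derivation.leibniz, smul_eq_mul, smul_eq_mul, partialD_comm p m k i l]
  ring

/-- The Hamiltonian Lie algebra `H(2m; 1)`: all `D = ∑ i, f_i ∂_i` (so `f_i = D x_i`) in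
`W(2m; 1) = Der O(2m; 1)` with `σ(j') ∂_i f_{j'} = σ(i') ∂_j f_{i'}` for all `i, j`, where
`j ↦ j'` exchanges `x_j` and `x_{j+m}`; equivalently, `D` annihilates `∑ j, dx_j ∧ dx_{j+m}`. -/
def H : LieSubalgebra k (Derivation k (Trunc p m k) (Trunc p m k)) where
  carrier := {D | ∀ i j : Fin m ⊕ Fin m,
    sgn j.swap • partialD p m k i (D (var p m k j.swap)) =
      sgn i.swap • partialD p m k j (D (var p m k i.swap))}
  zero_mem' := fun i j => by simp
  add_mem' := fun {D E} hD hE i j => by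
    simp only [Derivation.add_apply, map_add, smul_add]
    rw [hD i j, hE i j]
  smul_mem' := fun c D hD i j => by
    simp only [Derivation.smul_apply, Derivation.map_smul]
    rw [smul_comm, hD i j, smul_comm]
  lie_mem' := fun {D E} hD hE i j => by
    have hT : ∀ D E : Derivation k (Trunc p m k) (Trunc p m k),
        (∀ i j : Fin m ⊕ Fin m,
          sgn j.swap • partialD p m k i (E (var p m k j.swap)) =
            sgn i.swap • partialD p m k j (E (var p m k i.swap))) → ∀ i j : Fin m ⊕ Fin m,
        sgn j.swap • partialD p m k i (D (E (var p m k j.swap))) =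
          ∑ l : Fin m ⊕ Fin m, sgn l.swap • (partialD p m k i (D (var p m k l)) *
            partialD p m k j (E (var p m k l.swap)))
          + D (sgn j.swap • partialD p m k i (E (var p m k j.swap))) := by
      intro D E hE i j
      rw [partialD_apply, smul_add, Finset.smul_sum, map_zsmul]
      congr 1
      refine Finset.sum_congr rfl fun l _ => ?_
      rw [← mul_smul_comm, hE l j, mul_smul_comm]
    have hS : ∀ (D E : Derivation k (Trunc p m k) (Trunc p m k)) (i j : Fin m ⊕ Fin m),
        ∑ l : Fin m ⊕ Fin m, sgn l.swap • (partialD p m k i (E (var p m k l)) *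
            partialD p m k j (D (var p m k l.swap))) =
        -∑ l : Fin m ⊕ Fin m, sgn l.swap • (partialD p m k j (D (var p m k l)) *
            partialD p m k i (E (var p m k l.swap))) := by
      intro D E i j
      rw [← (Equiv.sumComm (Fin m) (Fin m)).sum_comp, ← Finset.sum_neg_distrib]
      refine Finset.sum_congr rfl fun l _ => ?_
      simp only [Equiv.sumComm_apply, Sum.swap_swap, sgn_swap, neg_smul, neg_neg]
      rw [mul_comm]
    simp only [Derivation.commutator_apply, map_sub, smul_sub]
    rw [hT D E hE i j, hT D E hE j i, hT E D hD i j, hT E D hD j i, hE i j, hD i j, hS D E i j,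
      hS D E j i]
    abel

/-- The derived subalgebra `H(2m; 1)^{(1)}`. -/
abbrev HDerived : Type _ := LieAlgebra.derivedSeries k (H p m k) 1

end Poly

end Hamiltonian
end

/-! Grade 𝔤 by giving degree 2 to the six simple roots that occur in e, degree -5 to α₄ and degree
-3 to α₇ (`degree`). In characteristic three the centraliser of e contains four commuting elements
X₀, ..., X₃ of degree -1 with (ad Xᵢ)³ = 0, and 𝔫_e lies in the sum of their span and the subalgebra
N of nonnegative degrees. So 𝔫_e looks like an algebra of vector fields in four variables in which
the Xᵢ are the constant fields and N consists of the fields vanishing at the origin. The realisation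
is by Taylor series: with πⱼ the functionals dual to the Xⱼ, an element y goes to the derivation
whose coefficient at ∂ⱼ is πⱼ(exp(∑ xᵢ ad Xᵢ) y) (`jet`, `Frame.toDer`).

Under this map ad Xᵢ becomes bracketing with ∂ᵢ. An equation between truncated polynomials that is
inherited by derivatives therefore has to be verified only for constant terms
(`eq_zero_of_partialD_closed`). In this way the map is a homomorphism on 𝔫_e (`Frame.toDer_lie`) and
sends 𝔤_e into H(4;1) (`Frame.toDer_mem_H`). Its kernel on 𝔫_e is the line spanned by e
(`Frame.toDer_eq_zero_iff`): the operators ad Xᵢ are nilpotent and commute, and an element which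
they map into the line is a combination of e and the Xᵢ.

The derived algebra of H(4;1) consists of the Hamiltonian fields of polynomials without top
coefficient (`mem_derivedSeries_one`), and it is perfect. Four root vectors of degree five in 𝔤_e
give the fields of the first derivatives of the top monomial, and differentiation produces all the
others, so the image of 𝔤_e lies between H(4;1)^{(1)} and H(4;1). Perfectness then identifies the
second derived algebra of 𝔤_e / k e. Since 𝔤_e is an ideal of 𝔫_e, the image of 𝔫_e normalises
H(4;1)^{(1)}, and it acts faithfully (`eq_zero_of_lie_hamField`).

For maximality let M properly contain 𝔫_e. Because (ad e)³ = 0 and the ad Xᵢ are nilpotent, [e, M]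
contains a combination of the Xᵢ that is not zero. Modulo e the span of the Xᵢ is irreducible under
the quadratic fields, which span 𝔰𝔭₄, so every Xᵢ lies in [e, M] (`Frame.HasTop.exists_lie_eq`).
Preimages of X₀, X₁, X₂ under ad e together with 𝔤_e generate 𝔤 (`eq_top_of_preimage_mem`).

What is special to E₈ is collected in the structure `Frame` and the property `Frame.HasTop`, apart
from the element acting on e as the identity and the generation of 𝔤. These facts are finite checks
on 248 basis vectors, encoded by numbers, with coefficients modulo three. The orbit is reduced to
its representative by showing that the root group elements are automorphisms of 𝔤
(`rootElement_lie`). -/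

noncomputable section

namespace ExceptionalE8

/-! ### Sparse vectors

A lattice vector `v` is encoded by the number `∑ (v j + 32) * 64 ^ j`, and the simple coroots by
the numbers `0, ..., 7`.  A sparse vector is a list of pairs of a coefficient (modulo three) and
a code. -/

/-- Search trees whose keys are codes of basis vectors; the values are rows of a matrix. -/
inductive CodeTree
  | leaf
  | node (key : ℕ) (val : List (ℕ × ℕ × ℕ)) (l r : CodeTree)

/-- The value stored at a key. -/
def CodeTree.find (t : CodeTree) : ℕ → Option (List (ℕ × ℕ × ℕ)) :=
  CodeTree.rec (fun _ => none) (fun key val _ _ fl fr c =>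
    bif Nat.beq c key then some val else bif Nat.blt c key then fl c else fr c) t

/-- The list of all keys. -/
def CodeTree.keys : CodeTree → List ℕ
  | leaf => []
  | node key _ l r => l.keys ++ key :: r.keys

/-- The codes of the `248` basis vectors. The entries `(i, r, s)` at the key `u` describe the `i`-th
of five matrices: the coefficient of the basis vector `s` in the image of `u` is `r`. -/
def codeTable : CodeTree :=
  .node 142971416737823 [] (.node 138503577012256 [(0, 1, 138503560235040)] (.node
  138433732667359 [(0, 2, 138432658925535)] (.node 138432641619806 [(0, 2, 138432641615710)]
  (.node 7 [(0, 2, 138573370230816)] (.node 3 [] (.node 1 [(1, 1, 142900515698656), (0, 2,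
  142971416741856)] (.node 0 [(1, 1, 142901606213599), (2, 2, 142971416475679), (0, 2,
  142971416741919)] .leaf .leaf) (.node 2 [(0, 2, 142971416737824)] .leaf .leaf)) (.node 5 [(1,
  2, 142900515698656), (2, 2, 142970325960736), (0, 2, 142970343000096), (4, 2, 142972507523168)]
  (.node 4 [(0, 2, 142971399964704)] .leaf .leaf) (.node 6 [] .leaf .leaf))) (.node
  138432624576350 [(0, 1, 138431550834526)] (.node 138362831357790 [(0, 1, 133964784846686)]
  (.node 133964784846686 [] .leaf .leaf) (.node 138431550834526 [] .leaf .leaf)) (.node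
  138432641615710 [] (.node 138432641353566 [(0, 1, 138432624576350)] .leaf .leaf) (.node
  138432641615774 [] .leaf .leaf)))) (.node 138432658659231 [] (.node 138432641882014 [] (.node
  138432641619870 [(0, 2, 138432641615774)] (.node 138432641619807 [(0, 2, 138432641619806), (0,
  2, 138432641615774)] .leaf .leaf) (.node 138432641619871 [] .leaf .leaf)) (.node
  138432641886111 [(1, 2, 138362831357790), (0, 2, 138432641882015)] (.node 138432641882015 [(0,
  2, 138432641882014)] .leaf .leaf) (.node 138432658659230 [] .leaf .leaf))) (.node
  138433732401054 [(0, 2, 138432658659230), (3, 1, 142901589440479)] (.node 138432658925471 []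
  (.node 138432658663327 [] .leaf .leaf) (.node 138432658925535 [] .leaf .leaf)) (.node
  138433732405151 [] (.node 138433732401055 [(0, 2, 138432658659231)] .leaf .leaf) (.node
  138433732667295 [(0, 2, 138432658925471)] .leaf .leaf))))) (.node 138503542663071 [(1, 2,
  138432641619807), (0, 1, 142900498655135), (0, 2, 138502468921247), (0, 1, 138502452144095)]
  (.node 138502451881887 [(1, 1, 138432641353566), (0, 1, 142900498388894), (0, 2,
  138502451877791)] (.node 138433749710815 [(0, 1, 138433749706719)] (.node 138433749444575 []
  (.node 138433749444511 [(0, 2, 138433732667295), (0, 1, 138432658925535)] .leaf .leaf) (.node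
  138433749706719 [] .leaf .leaf)) (.node 138502451877790 [] (.node 138433749710816 [(0, 1,
  138433749710815)] .leaf .leaf) (.node 138502451877791 [(0, 2, 138502451877790)] .leaf .leaf)))
  (.node 138502468921311 [(1, 1, 138432641619870), (0, 2, 138502452144095), (4, 1,
  138503559706591)] (.node 138502452144095 [] (.node 138502452144031 [] .leaf .leaf) (.node
  138502468921247 [(0, 2, 138502452144031)] .leaf .leaf)) (.node 138502469187551 [(0, 1,
  138502469183455)] (.node 138502469183455 [] .leaf .leaf) (.node 138502469187552 [(3, 2, 7), (2,
  2, 138502468921311), (0, 1, 138502469187551)] .leaf .leaf)))) (.node 138503559968735 [] (.node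
  138503542929376 [(1, 1, 138433732401055), (0, 2, 142901589436383), (0, 1, 138503559702495), (0,
  1, 138503542929375)] (.node 138503542925279 [] (.node 138503542663135 [(1, 1, 138432641619871)]
  .leaf .leaf) (.node 138503542929375 [] .leaf .leaf)) (.node 138503559706591 [(0, 2,
  142901589436383), (0, 1, 138503559702495)] (.node 138503559702495 [(3, 1, 0), (3, 2, 4), (3, 1,
  5), (0, 1, 142900515694559), (0, 2, 138503542925279), (4, 2, 138503559968800)] .leaf .leaf)
  (.node 138503559706592 [(1, 1, 138433732405151)] .leaf .leaf))) (.node 138503559972832 [(1, 2,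
  138433749444511), (0, 1, 142901606479839), (0, 2, 138503559968799), (0, 1, 138503559968736)]
  (.node 138503559968799 [] (.node 138503559968736 [(0, 1, 138503559968735)] .leaf .leaf) (.node
  138503559968800 [(1, 2, 138433732667359), (0, 1, 138503559968799), (2, 1, 138503542929376)]
  .leaf .leaf)) (.node 138503560235040 [] (.node 138503559972896 [(1, 1, 138433749444575), (2, 1,
  138503559706592)] .leaf .leaf) .leaf))))) (.node 142970308650975 [(0, 2, 142970308650911)]
  (.node 142901589440479 [] (.node 142900515432351 [(0, 2, 142900498655135), (3, 2,
  142971416475616)] (.node 142900498388895 [(0, 2, 142900498388894)] (.node 138573370230816 []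
  (.node 138504650754080 [(1, 2, 138433749710816), (0, 1, 142901606746144), (0, 1,
  138503577012256)] .leaf .leaf) (.node 142900498388894 [] .leaf .leaf)) (.node 142900498655135
  [] (.node 142900498392991 [] .leaf .leaf) (.node 142900498655199 [] .leaf .leaf))) (.node
  142900515698656 [(1, 1, 138432658663327), (0, 1, 142900515698655), (3, 1, 147369463253024)]
  (.node 142900515694559 [] (.node 142900515432415 [(4, 1, 142901606217695), (3, 1,
  142971416475680)] .leaf .leaf) (.node 142900515698655 [(3, 2, 4), (1, 1, 138432641886111)]
  .leaf .leaf)) (.node 142901589174239 [] (.node 142901589174175 [] .leaf .leaf) (.node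
  142901589436383 [(1, 2, 138433732401054), (1, 1, 138432658659231), (0, 2, 142900515694559)]
  .leaf .leaf)))) (.node 142901606479904 [(2, 1, 142901589440480), (3, 2, 142971433785441)]
  (.node 142901606217696 [] (.node 142901606213599 [(0, 2, 142901589436383)] (.node
  142901589440480 [] .leaf .leaf) (.node 142901606217695 [(0, 2, 142901606213599), (0, 1,
  142901589440479)] .leaf .leaf)) (.node 142901606479840 [(0, 1, 142901606479839), (3, 1,
  142971433785377)] (.node 142901606479839 [] .leaf .leaf) (.node 142901606479903 [] .leaf
  .leaf))) (.node 142901623523360 [(0, 1, 142901606746144), (3, 1, 142972524566625)] (.node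
  142901606484000 [] (.node 142901606483936 [] .leaf .leaf) (.node 142901606746144 [] .leaf
  .leaf)) (.node 142970308650911 [] (.node 142902697265184 [] .leaf .leaf) .leaf)))) (.node
  142971399436255 [(0, 2, 142970325694431)] (.node 142970325956576 [(0, 1, 142970325956575)]
  (.node 142970325690335 [] (.node 142970308917215 [(0, 1, 142970308913119)] (.node
  142970308913119 [] .leaf .leaf) (.node 142970308917216 [(2, 2, 142970308650975), (0, 1,
  142970308917215)] .leaf .leaf)) (.node 142970325694432 [(1, 2, 142900498392991)] (.node
  142970325694431 [(1, 2, 138502451881887)] .leaf .leaf) (.node 142970325956575 [] .leaf .leaf)))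
  (.node 142970325960736 [(1, 2, 142900515432415), (2, 1, 142970325694432), (0, 1,
  142971399698400), (0, 1, 142970325960672)] (.node 142970325956640 [(2, 1, 142970308917216)]
  (.node 142970325956639 [] .leaf .leaf) (.node 142970325960672 [(1, 1, 142900515432351), (0, 1,
  142970325956576)] .leaf .leaf)) (.node 142970343000096 [(0, 1, 142970326222880)] (.node
  142970326222880 [] .leaf .leaf) (.node 142971399432159 [(1, 1, 142900498388895), (0, 2,
  142970325690335), (4, 1, 142971399698464)] .leaf .leaf)))) (.node 142971399964704 [] (.node
  142971399698463 [(4, 1, 4), (1, 1, 142900498655199), (2, 2, 142971399432159), (2, 2,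
  142970325694431), (0, 2, 142970325956639)] (.node 142971399698399 [] (.node 142971399436256 []
  .leaf .leaf) (.node 142971399698400 [(1, 2, 138503542663071)] .leaf .leaf)) (.node
  142971399702496 [(1, 1, 142901589174175), (0, 1, 142971399698400)] (.node 142971399698464 [(1,
  1, 138503542663135), (0, 2, 142971416475615), (0, 2, 142971399698463)] .leaf .leaf) (.node
  142971399702560 [(1, 2, 142901589174239)] .leaf .leaf))) (.node 142971416475680 [(0, 1,
  142971399698464)] (.node 142971416475616 [(0, 2, 142971416475615), (0, 2, 142971399698463)]
  (.node 142971416475615 [(4, 1, 1), (4, 2, 2), (4, 1, 4), (4, 1, 5), (0, 2, 142971399698399),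
  (0, 2, 142970325956639), (3, 2, 147439273515040)] .leaf .leaf) (.node 142971416475679 [(0, 2,
  142971416475615), (0, 1, 142971399698463)] .leaf .leaf)) (.node 142971416479776 [] (.node
  142971416479712 [] .leaf .leaf) .leaf)))))) (.node 143042334828641 [(0, 2, 147439290820705),
  (0, 1, 143042318051425), (0, 2, 143041244309665), (3, 2, 147510191868066)] (.node
  142972507527265 [] (.node 142971433781344 [(0, 1, 142971417004128), (4, 2, 142972524566624),
  (4, 2, 142972507789409), (3, 1, 147439290820769)] (.node 142971417004064 [] (.node
  142971416741921 [(0, 2, 0), (0, 1, 0), (0, 1, 0), (0, 1, 0), (0, 1, 1), (0, 1, 2), (0, 2, 2),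
  (0, 2, 3), (0, 2, 5), (0, 1, 5), (0, 2, 6), (0, 1, 6), (0, 2, 6), (0, 2, 7)] (.node
  142971416741856 [] (.node 142971416737824 [(0, 1, 142971416737823)] .leaf .leaf) (.node
  142971416741919 [] .leaf .leaf)) (.node 142971416746016 [(0, 2, 1), (0, 1, 2), (0, 1, 3), (0,
  2, 5), (0, 1, 6)] (.node 142971416741984 [(0, 2, 0), (0, 2, 2), (0, 1, 5)] .leaf .leaf) (.node
  142971416746017 [(1, 2, 142901606217696), (0, 2, 142971416746016)] .leaf .leaf))) (.node
  142971417008224 [(1, 1, 142901606479903), (4, 1, 142971434051681)] (.node 142971417008160 [(0,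
  2, 142971417004064)] (.node 142971417004128 [] .leaf .leaf) (.node 142971417008161 [(2, 1, 0),
  (2, 2, 1), (0, 2, 142971417008160), (3, 1, 147440364562529)] .leaf .leaf)) (.node
  142971433519136 [(0, 2, 0), (0, 2, 6)] (.node 142971417008225 [(2, 1, 142971416741984), (0, 2,
  142971417008224), (3, 2, 147440364562593)] .leaf .leaf) (.node 142971433781280 [] .leaf
  .leaf)))) (.node 142972490483744 [(0, 1, 0), (0, 1, 6), (0, 1, 7)] (.node 142971433785441 [(1,
  2, 142901606484000)] (.node 142971433785377 [(1, 1, 142901606483936), (2, 2, 142971433519136),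
  (0, 2, 142972507523104), (0, 2, 142971433785376), (0, 2, 142971433781344)] (.node
  142971433785376 [(1, 2, 138503559972832), (3, 2, 143042334828641)] .leaf .leaf) (.node
  142971433785440 [(1, 1, 138503559972896)] .leaf .leaf)) (.node 142971434047585 [(0, 2,
  142971434047584)] (.node 142971434047584 [] .leaf .leaf) (.node 142971434051681 [(1, 1,
  142901623523360), (0, 2, 142971434047585), (4, 2, 142972524832929)] .leaf .leaf))) (.node
  142972507527200 [(0, 2, 142972507523104), (0, 2, 142971433781344)] (.node 142972507523104 [(1,
  2, 142901606479840), (0, 1, 142971433781280), (0, 1, 142971417004128)] (.node 142972507260960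
  [] .leaf .leaf) (.node 142972507523168 [(1, 1, 142901606479904), (0, 1, 142971433781344)] .leaf
  .leaf)) (.node 142972507527264 [(0, 2, 142971433785440)] (.node 142972507527201 [] .leaf .leaf)
  .leaf)))) (.node 143041227004000 [(0, 2, 143041226999904), (4, 2, 143041244047457)] (.node
  142972524832929 [(0, 1, 142972524832865)] (.node 142972524566624 [(2, 1, 142971433785440), (0,
  1, 142972507789408), (3, 2, 147440381606049)] (.node 142972507789409 [(1, 1, 138504650754080),
  (2, 1, 142971417008225), (3, 1, 143042335094946)] (.node 142972507789408 [] .leaf .leaf) (.node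
  142972507793505 [(1, 1, 142902697265184)] .leaf .leaf)) (.node 142972524570721 [] (.node
  142972524566625 [(0, 1, 142972507789409)] .leaf .leaf) (.node 142972524832865 [] .leaf .leaf)))
  (.node 143041226999840 [] (.node 143041209960480 [(0, 2, 143040136218656)] (.node
  143040136218656 [] .leaf .leaf) (.node 143041226737696 [(0, 2, 147438182729760), (0, 2,
  143041209960480)] .leaf .leaf)) (.node 143041227003936 [(0, 2, 143041226999840)] (.node
  143041226999904 [] .leaf .leaf) (.node 143041227003937 [(2, 2, 143041226737696), (0, 2,
  147439273510944), (0, 2, 143041227003936), (0, 1, 143041226999904)] .leaf .leaf)))) (.node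
  143041244309601 [] (.node 143041227270241 [(1, 2, 7), (0, 2, 143041227266145), (4, 1,
  143042318051489)] (.node 143041227266144 [] (.node 143041227004001 [] .leaf .leaf) (.node
  143041227266145 [(0, 2, 143041227266144)] .leaf .leaf)) (.node 143041244043361 [(2, 2,
  143041227003937)] (.node 143041244043360 [] .leaf .leaf) (.node 143041244047457 [(0, 1,
  147439290554464), (0, 2, 143042317785184), (2, 1, 143041227004001), (0, 2, 143041244043361),
  (3, 2, 147510191601825)] .leaf .leaf))) (.node 143042317789281 [] (.node 143042317785184 [(1,
  2, 2), (1, 2, 5), (2, 1, 143041227004000), (0, 2, 147439273777248), (0, 1, 143041244043360)]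
  (.node 143041244309665 [] .leaf .leaf) (.node 143042317785185 [(1, 2, 142972490483744), (0, 1,
  147439290554464), (0, 2, 143042317785184)] .leaf .leaf)) (.node 143042318051489 [(1, 2,
  142971417008225), (2, 2, 143042317785185), (0, 1, 143041244309665), (3, 1, 147510191864034)]
  (.node 143042318051425 [(0, 1, 143041244309601)] .leaf .leaf) .leaf))))) (.node 147440381606049
  [(1, 2, 142972507793505), (0, 1, 147440381601953)] (.node 147439273777249 [(2, 2,
  147439273511008), (3, 2, 147509101082786)] (.node 147439273248800 [(1, 2, 142971399436256)]
  (.node 143042335094946 [(2, 1, 143042334828705), (0, 2, 147440381601953), (0, 1,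
  143042335094945), (3, 2, 147511282649314)] (.node 143042335090849 [] (.node 143042334828705
  [(2, 2, 143042317789281)] .leaf .leaf) (.node 143042335094945 [(0, 1, 143042335090849)] .leaf
  .leaf)) (.node 147438182729760 [] (.node 147369463253024 [(0, 2, 0)] .leaf .leaf) (.node
  147439256471584 [(1, 2, 142971399436255), (0, 2, 147438182729760)] .leaf .leaf))) (.node
  147439273515041 [(1, 2, 142971416479712)] (.node 147439273511008 [(2, 2, 147439256471584)]
  (.node 147439273510944 [] .leaf .leaf) (.node 147439273515040 [(1, 1, 142971399702496), (0, 2,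
  147439273510944)] .leaf .leaf)) (.node 147439273515105 [(1, 1, 142971416479776)] (.node
  147439273515104 [(1, 2, 142971399702560), (4, 2, 147439290558561)] .leaf .leaf) (.node
  147439273777248 [] .leaf .leaf)))) (.node 147440364296289 [(1, 2, 142972507260960), (0, 2,
  147439290554465)] (.node 147439290558561 [(1, 1, 142971416746017)] (.node 147439290554464 [(1,
  1, 2), (0, 1, 147439273777248), (3, 1, 147510191597729), (3, 2, 147510174824609)] (.node
  147439273781345 [(0, 2, 147439273777249)] .leaf .leaf) (.node 147439290554465 [] .leaf .leaf))
  (.node 147439290820769 [] (.node 147439290820705 [] .leaf .leaf) (.node 147440364296288 [(2, 1,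
  147439273515104), (0, 1, 147439290554464)] .leaf .leaf))) (.node 147440381339745 [(1, 2,
  142972507527201)] (.node 147440364562529 [(1, 2, 142972507527200), (1, 2, 142972507523168), (2,
  2, 147440364296288), (2, 1, 147439273781345), (0, 1, 147439290820705)] (.node 147440364300385
  [] .leaf .leaf) (.node 147440364562593 [(1, 1, 142972507527264), (2, 2, 147440364296289)] .leaf
  .leaf)) (.node 147440381601953 [] (.node 147440381339809 [(1, 1, 142972507527265)] .leaf .leaf)
  .leaf)))) (.node 147510174824610 [(2, 1, 147510174558369)] (.node 147509100816545 [(2, 2,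
  147509083777121), (0, 1, 147509084039329)] (.node 147509083777121 [(1, 1, 147439273248800), (0,
  2, 147509083773025)] (.node 147509083773024 [] (.node 147440381606050 [(1, 1, 142972524570721)]
  .leaf .leaf) (.node 147509083773025 [(0, 2, 147509083773024)] .leaf .leaf)) (.node
  147509084039329 [] (.node 147509084039265 [] .leaf .leaf) (.node 147509100816481 [(0, 1,
  147509084039265)] .leaf .leaf))) (.node 147510174558305 [(1, 2, 147439273515041), (0, 1,
  147509100816481), (0, 2, 147509084039329)] (.node 147509101082785 [(0, 1, 147509101078689)]
  (.node 147509101078689 [] .leaf .leaf) (.node 147509101082786 [(2, 1, 147509100816545), (0, 1,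
  147509101082785), (3, 1, 151978048637154)] .leaf .leaf)) (.node 147510174820513 [] (.node
  147510174558369 [(1, 1, 147439273515105)] .leaf .leaf) (.node 147510174824609 [(1, 1,
  147440364296288), (1, 1, 147439273781345), (2, 1, 147510174558305)] .leaf .leaf)))) (.node
  147510191868066 [(1, 2, 147440381339745), (0, 1, 147510191864033), (0, 1, 147510191863970)]
  (.node 147510191863969 [] (.node 147510191601825 [(0, 1, 147510174824609)] (.node
  147510191597729 [(1, 2, 147439290554465), (0, 1, 147510174820513)] .leaf .leaf) (.node
  147510191601826 [(1, 2, 147440364300385)] .leaf .leaf)) (.node 147510191864033 [] (.node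
  147510191863970 [(0, 1, 147510191863969)] .leaf .leaf) (.node 147510191864034 [(0, 1,
  147510191864033), (2, 2, 147510174824610)] .leaf .leaf))) (.node 147511282649314 [(1, 2,
  147440381606050), (2, 2, 147510191868130), (0, 2, 147510208907490)] (.node 147510192130274 []
  (.node 147510191868130 [(1, 1, 147440381339809), (2, 1, 147510191601826)] .leaf .leaf) (.node
  147510208907490 [(0, 2, 147510192130274)] .leaf .leaf)) (.node 151978048637154 [(0, 2,
  147580002126050)] (.node 147580002126050 [] .leaf .leaf) .leaf))))))

/-- The type of sparse vectors. -/
abbrev SVec : Type := List (ℕ × ℕ)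

/-- The code of the zero vector of the root lattice. -/
def zeroCode : ℕ := 142971416741920

/-- Whether a number is the code of a basis vector. -/
def isCode (c : ℕ) : Bool := (codeTable.find c).isSome

/-- The `j`-th digit of a code. -/
def digit (c j : ℕ) : ℕ := c / 64 ^ j % 64

/-- The neighbours of a node in the Dynkin diagram. -/
def neighbors : ℕ → List ℕ
  | 0 => [2]
  | 1 => [3]
  | 2 => [0, 3]
  | 3 => [1, 2, 4]
  | 4 => [3, 5]
  | 5 => [4, 6]
  | 6 => [5, 7]
  | _ => [6]

/-- The pairing of the root with code `c` with the `i`-th simple root, modulo three. -/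
def pairingCode (i c : ℕ) : ℕ :=
  2 * (digit c i + 1 + (neighbors i).foldr (fun j n => digit c j + 1 + n) 0) % 3

/-- The structure constant `sign`, modulo three. -/
def signCode (a c : ℕ) : ℕ :=
  1 + (digit a 0 * digit c 0 + digit a 1 * digit c 1 + digit a 2 * digit c 2
    + digit a 3 * digit c 3 + digit a 4 * digit c 4 + digit a 5 * digit c 5
    + digit a 6 * digit c 6 + digit a 7 * digit c 7 + digit a 0 * digit c 2
    + digit a 1 * digit c 3 + digit a 2 * digit c 3 + digit a 3 * digit c 4
    + digit a 4 * digit c 5 + digit a 5 * digit c 6 + digit a 6 * digit c 7) % 2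

/-- Function application after evaluation of the argument. -/
def force {α : Type} (n : ℕ) (f : ℕ → α) : α := Nat.rec (f 0) (fun m _ => f (m + 1)) n

/-- The bracket of two root vectors whose roots have the sum with code `w`. -/
def rootBracket (a c w : ℕ) : SVec :=
  bif Nat.beq w zeroCode then [0, 1, 2, 3, 4, 5, 6, 7].map fun i => (2 + 2 * digit a i, i)
  else bif Nat.blt w 8 then [] else bif isCode w then
    force (signCode a c) fun s => [(s, w)] else []

/-- The bracket of two basis vectors. -/
def codeBracket (a c : ℕ) : SVec :=
  bif Nat.blt a 8 then
    bif Nat.blt c 8 then [] else [(pairingCode a c, c)]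
  else bif Nat.blt c 8 then [(2 * pairingCode c a, a)]
  else force (a + c - zeroCode) (rootBracket a c)

/-- The sparse vector with the given first term; a zero coefficient is omitted. -/
def consTerm (n c : ℕ) (l : SVec) : SVec := bif Nat.beq n 0 then l else (n, c) :: l

/-- Add a term to a sparse vector. -/
def addTerm (n c : ℕ) (l : SVec) : SVec :=
  List.rec (force (n % 3) fun r => consTerm r c [])
    (fun t l h => bif Nat.beq t.2 c then force ((n + t.1) % 3) fun r => consTerm r c l
      else t :: h) l

/-- Collect terms. -/
def collect (l : SVec) : SVec := l.foldr (fun t m => addTerm t.1 t.2 m) []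

/-- Multiply a sparse vector by a number. -/
def smulVec (n : ℕ) (l : SVec) : SVec := l.map fun t => (n * t.1, t.2)

/-- The bracket of sparse vectors. -/
def svBracket (x y : SVec) : SVec :=
  collect (x.flatMap fun s => y.flatMap fun t => smulVec (s.1 * t.1) (codeBracket s.2 t.2))

/-- Equality of the vectors represented by sparse vectors. -/
def svEq (x y : SVec) : Bool := (collect (x ++ smulVec 2 y)).isEmpty

/-- The nilpotent element `e`. -/
def svE : SVec :=
  [(1, 142971416741921), (1, 142971416746016), (1, 142971433519136), (1, 142972490483744), (1,
   142971416741984), (1, 147369463253024)]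

/-- The element `X_0`, which acts as a partial derivative. -/
def svX0 : SVec :=
  [(1, 143041227270241), (1, 143041244043361), (1, 147439273777249), (1, 143042317785184), (2,
   147439290554464)]

/-- The element `X_1`, which acts as a partial derivative. -/
def svX1 : SVec :=
  [(1, 142971417008161), (2, 142971417008224), (1, 142971433781344), (1, 142971433785376), (1,
   142972507523104)]

/-- The element `X_2`, which acts as a partial derivative. -/
def svX2 : SVec :=
  [(1, 138502469187552), (1, 138503542929375), (1, 142900515698655), (1, 138503559702495), (2,
   142901589436383)]

/-- The element `X_3`, which acts as a partial derivative. -/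
def svX3 : SVec :=
  [(1, 142970325956640), (2, 142970325960672), (2, 142971399698400), (2, 142971399698463), (2,
   142971416475615)]

/-- The elements `e` and `X₀, ..., X₃`. -/
def opVec : ℕ → SVec
  | 0 => svE
  | 1 => svX0
  | 2 => svX1
  | 3 => svX2
  | _ => svX3

/-- The roots at which the coordinate functionals dual to `X₀, ..., X₃` are taken. -/
def opCode : ℕ → ℕ
  | 1 => 143041227270241
  | 2 => 142971417008161
  | 3 => 138502469187552
  | _ => 142970325956640

/-- The rows of the matrices in `codeTable`. -/
def tableRow (i c : ℕ) : SVec :=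
  match codeTable.find c with
  | none => []
  | some l => l.filterMap fun t => bif Nat.beq t.1 i then some t.2 else none

/-- Apply one of the matrices in `codeTable` to a sparse vector. -/
def tableApply (i : ℕ) (x : SVec) : SVec :=
  x.flatMap fun t => smulVec t.1 (tableRow i t.2)

end ExceptionalE8

end


noncomputable section

namespace ExceptionalE8

/-! ### The roots and their codes -/

/-- The lattice vector with a given code. -/
def vecOf (c : ℕ) : Fin 8 → ℤ := fun j => (digit c j : ℤ) - 32

/-- The code of a lattice vector, as an integer. -/
def codeOf (v : Fin 8 → ℤ) : ℤ :=
  v 0 + 32 + (v 1 + 32) * 64 + (v 2 + 32) * 4096 + (v 3 + 32) * 262144 + (v 4 + 32) * 16777216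
    + (v 5 + 32) * 1073741824 + (v 6 + 32) * 68719476736 + (v 7 + 32) * 4398046511104

/-- The bound is `64 ^ 8`; below it a number is recovered from eight digits in base 64. -/
lemma codeOf_vecOf {c : ℕ} (hc : c < 281474976710656) : codeOf (vecOf c) = c := by
  simp only [codeOf, vecOf, digit, Fin.isValue, Fin.coe_ofNat_eq_mod, sub_add_cancel]
  norm_num
  omega

lemma codeOf_add (u v : Fin 8 → ℤ) : codeOf (u + v) + zeroCode = codeOf u + codeOf v := by
  simp only [codeOf, Pi.add_apply, zeroCode]; push_cast; ring

lemma codeOf_zero : codeOf 0 = zeroCode := by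
  simp [codeOf, zeroCode]

lemma eq_zero_of_add_mul {x y : ℤ} (h : x + 64 * y = 0) (h1 : x ≤ 31) (h2 : -x ≤ 31) :
    x = 0 ∧ y = 0 := by omega

/-- Uniqueness of balanced expansions in base 64: the differences of coordinates have absolute value
at most 31, so each of them is forced to vanish modulo 64, beginning with the lowest. -/
lemma codeOf_injective {u v : Fin 8 → ℤ} (h : codeOf u = codeOf v)
    (hb : ∀ j, u j - v j ≤ 31 ∧ v j - u j ≤ 31) : u = v := by
  have hb' : ∀ j, u j - v j ≤ 31 ∧ -(u j - v j) ≤ 31 := fun j => by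
    rw [neg_sub]; exact hb j
  have h0 : (u 0 - v 0) + 64 * ((u 1 - v 1) + 64 * ((u 2 - v 2) + 64 * ((u 3 - v 3)
      + 64 * ((u 4 - v 4) + 64 * ((u 5 - v 5) + 64 * ((u 6 - v 6) + 64 * ((u 7 - v 7)
      + 64 * 0))))))) = 0 := by
    simp only [codeOf] at h
    linear_combination h
  obtain ⟨e0, h1⟩ := eq_zero_of_add_mul h0 (hb' 0).1 (hb' 0).2
  obtain ⟨e1, h2⟩ := eq_zero_of_add_mul h1 (hb' 1).1 (hb' 1).2
  obtain ⟨e2, h3⟩ := eq_zero_of_add_mul h2 (hb' 2).1 (hb' 2).2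
  obtain ⟨e3, h4⟩ := eq_zero_of_add_mul h3 (hb' 3).1 (hb' 3).2
  obtain ⟨e4, h5⟩ := eq_zero_of_add_mul h4 (hb' 4).1 (hb' 4).2
  obtain ⟨e5, h6⟩ := eq_zero_of_add_mul h5 (hb' 5).1 (hb' 5).2
  obtain ⟨e6, h7⟩ := eq_zero_of_add_mul h6 (hb' 6).1 (hb' 6).2
  obtain ⟨e7, -⟩ := eq_zero_of_add_mul h7 (hb' 7).1 (hb' 7).2
  funext j
  fin_cases j <;> simp only [Fin.isValue, Fin.mk_one, Fin.zero_eta, Fin.reduceFinMk] <;> omega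

lemma form_simple (i : Fin 8) (v : Fin 8 → ℤ) : form (Pi.single i 1) v =
    ![2 * v 0 - v 2, 2 * v 1 - v 3, 2 * v 2 - v 0 - v 3, 2 * v 3 - v 1 - v 2 - v 4,
      2 * v 4 - v 3 - v 5, 2 * v 5 - v 4 - v 6, 2 * v 6 - v 5 - v 7, 2 * v 7 - v 6] i := by
  rw [form_expand]
  fin_cases i <;> simp

lemma CodeTree.mem_keys {t : CodeTree} {c : ℕ} (h : (t.find c).isSome) : c ∈ t.keys := by
  induction t with
  | leaf => simp [CodeTree.find] at h
  | node key val l r hl hr =>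
    simp only [CodeTree.keys, List.mem_append, List.mem_cons]
    have : (CodeTree.node key val l r).find c =
      bif Nat.beq c key then some val else bif Nat.blt c key then l.find c else r.find c := rfl
    rw [this] at h
    cases h1 : Nat.beq c key with
    | true => exact Or.inr (Or.inl (Nat.eq_of_beq_eq_true h1))
    | false =>
      rw [h1, cond_false] at h
      cases h2 : Nat.blt c key with
      | true => rw [h2, cond_true] at h; exact Or.inl (hl h)
      | false => rw [h2, cond_false] at h; exact Or.inr (Or.inr (hr h))

-- The tree is correctly ordered, so the search finds each key. With `CodeTree.mem_keys`, the test
-- `isCode` and membership in `keys` become interchangeable.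
set_option maxRecDepth 100000 in
lemma isCode_of_mem_keys : ∀ c ∈ codeTable.keys, isCode c = true := by decide +kernel

-- Digits from 24 to 40 are coordinates from -8 to 8, small enough for sums of two roots to be
-- encoded without a carry. The last condition is norm two in the shape given by `form_expand`.
set_option maxRecDepth 100000 in
lemma keys_check : ∀ c ∈ codeTable.keys, 8 ≤ c → c < 281474976710656 ∧
    (∀ j : Fin 8, 24 ≤ digit c j ∧ digit c j ≤ 40) ∧
    (2 * (vecOf c 0 * vecOf c 0 + vecOf c 1 * vecOf c 1 + vecOf c 2 * vecOf c 2
      + vecOf c 3 * vecOf c 3 + vecOf c 4 * vecOf c 4 + vecOf c 5 * vecOf c 5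
      + vecOf c 6 * vecOf c 6 + vecOf c 7 * vecOf c 7) - vecOf c 0 * vecOf c 2
      - vecOf c 2 * vecOf c 0 - vecOf c 1 * vecOf c 3 - vecOf c 3 * vecOf c 1
      - vecOf c 2 * vecOf c 3 - vecOf c 3 * vecOf c 2 - vecOf c 3 * vecOf c 4
      - vecOf c 4 * vecOf c 3 - vecOf c 4 * vecOf c 5 - vecOf c 5 * vecOf c 4
      - vecOf c 5 * vecOf c 6 - vecOf c 6 * vecOf c 5 - vecOf c 6 * vecOf c 7
      - vecOf c 7 * vecOf c 6 = 2) := by decide +kernel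

/-- The sum of the digits of a code at the neighbours of a node. -/
def neighborSum (i c : ℕ) : ℕ := (neighbors i).foldr (fun j n => digit c j + n) 0

lemma form_simple_vecOf (i : Fin 8) (c : ℕ) : form (Pi.single i 1) (vecOf c) =
    2 * digit c i + 32 * (neighbors i).length - neighborSum i c - 64 := by
  rw [form_simple]
  fin_cases i <;> simp [vecOf, neighbors, neighborSum] <;> ring

/-- Whether the codes of the sums of a root with a simple root or its negative, if they are roots,
occur in the table. -/
def closedAt (c i : ℕ) : Bool :=
  bif Nat.beq (2 * digit c i + 1 + 32 * (neighbors i).length) (neighborSum i c + 64) then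
    isCode (c + 64 ^ i)
  else bif Nat.beq (2 * digit c i + 32 * (neighbors i).length) (neighborSum i c + 65) then
    isCode (c - 64 ^ i)
  else true

-- By `form_simple_vecOf` the two tests in `closedAt` express that the pairing with the simple root
-- is -1 or 1. Together with `simple_isCode` and `root_induction`, this closure shows that no root
-- is missing from the table.
set_option maxRecDepth 100000 in
lemma keys_closed : ∀ c ∈ codeTable.keys, 8 ≤ c →
    (closedAt c 0 && closedAt c 1 && closedAt c 2 && closedAt c 3 && closedAt c 4 && closedAt c 5
      && closedAt c 6 && closedAt c 7) = true := by
  decide +kernel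

lemma closedAt_of_mem_keys {c : ℕ} (hc : c ∈ codeTable.keys) (h8 : 8 ≤ c) (i : Fin 8) :
    closedAt c i = true := by
  have := keys_closed c hc h8
  simp only [Bool.and_eq_true] at this
  obtain ⟨⟨⟨⟨⟨⟨⟨h0, h1⟩, h2⟩, h3⟩, h4⟩, h5⟩, h6⟩, h7⟩ := this
  fin_cases i
  exacts [h0, h1, h2, h3, h4, h5, h6, h7]

lemma isCode_add_of_form {c : ℕ} (hc : c ∈ codeTable.keys) (h8 : 8 ≤ c) {i : Fin 8}
    (h : form (Pi.single i 1) (vecOf c) = -1) : isCode (c + 64 ^ (i : ℕ)) = true := by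
  have h1 := closedAt_of_mem_keys hc h8 i
  rw [form_simple_vecOf] at h
  have h2 : Nat.beq (2 * digit c i + 1 + 32 * (neighbors i).length) (neighborSum i c + 64) = true :=
    by rw [Nat.beq_eq]; omega
  rwa [closedAt, h2, cond_true] at h1

lemma isCode_sub_of_form {c : ℕ} (hc : c ∈ codeTable.keys) (h8 : 8 ≤ c) {i : Fin 8}
    (h : form (Pi.single i 1) (vecOf c) = 1) : isCode (c - 64 ^ (i : ℕ)) = true := by
  have h1 := closedAt_of_mem_keys hc h8 i
  rw [form_simple_vecOf] at h
  have h2 : Nat.beq (2 * digit c i + 1 + 32 * (neighbors i).length) (neighborSum i c + 64) = false :=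
    Bool.eq_false_iff.mpr fun h' => by rw [Nat.beq_eq] at h'; omega
  have h3 : Nat.beq (2 * digit c i + 32 * (neighbors i).length) (neighborSum i c + 65) = true :=
    by rw [Nat.beq_eq]; omega
  rwa [closedAt, h2, h3, cond_true, cond_false] at h1

set_option maxRecDepth 100000 in
lemma simple_isCode : ∀ i : Fin 8, isCode (zeroCode + 64 ^ (i : ℕ)) = true ∧
    isCode (zeroCode - 64 ^ (i : ℕ)) = true ∧ vecOf (zeroCode + 64 ^ (i : ℕ)) = Pi.single i 1 ∧
    vecOf (zeroCode - 64 ^ (i : ℕ)) = -Pi.single i 1 ∧ 8 ≤ zeroCode - 64 ^ (i : ℕ) := by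
  decide +kernel

lemma mem_keys_of_isCode {c : ℕ} (h : isCode c = true) : c ∈ codeTable.keys := CodeTree.mem_keys h

/-- Codes of roots. -/
def IsRootCode (c : ℕ) : Prop := 8 ≤ c ∧ isCode c = true

lemma IsRootCode.codeOf_vecOf {c : ℕ} (h : IsRootCode c) : codeOf (vecOf c) = c :=
  ExceptionalE8.codeOf_vecOf (keys_check c (mem_keys_of_isCode h.2) h.1).1

lemma IsRootCode.bounds {c : ℕ} (h : IsRootCode c) (j : Fin 8) :
    -8 ≤ vecOf c j ∧ vecOf c j ≤ 8 := by
  have := (keys_check c (mem_keys_of_isCode h.2) h.1).2.1 j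
  simp only [vecOf]; omega

lemma IsRootCode.form {c : ℕ} (h : IsRootCode c) : form (vecOf c) (vecOf c) = 2 := by
  rw [form_expand]; exact (keys_check c (mem_keys_of_isCode h.2) h.1).2.2

/-- Ensures that the natural subtraction `c - 64 ^ i` is not truncated and stays out of the range 0,
..., 7 reserved for coroots. -/
lemma IsRootCode.pow_add_le {c : ℕ} (h : IsRootCode c) (i : Fin 8) : 64 ^ (i : ℕ) + 8 ≤ c := by
  have h1 := h.codeOf_vecOf
  have h0 := h.bounds
  have := h0 0; have := h0 1; have := h0 2; have := h0 3
  have := h0 4; have := h0 5; have := h0 6; have := h0 7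
  have h2 : (64 : ℕ) ^ (i : ℕ) ≤ 64 ^ 7 := Nat.pow_le_pow_right (by norm_num) (by omega)
  norm_num at h2
  simp only [codeOf] at h1
  omega

/-- The bound 23 is chosen so that 23 + 8 = 31, as `codeOf_injective` requires; it leaves room for
sums of two roots. -/
lemma IsRootCode.vecOf_eq {c : ℕ} (h : IsRootCode c) {v : Fin 8 → ℤ}
    (hv : ∀ j, -23 ≤ v j ∧ v j ≤ 23) (hc : codeOf v = c) : vecOf c = v :=
  codeOf_injective (h.codeOf_vecOf.trans hc.symm) fun j => by
    have := h.bounds j; have := hv j; omega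

lemma codeOf_single (i : Fin 8) : codeOf (Pi.single i 1) = zeroCode + 64 ^ (i : ℕ) := by
  fin_cases i <;> simp [codeOf, zeroCode]

lemma codeOf_neg (v : Fin 8 → ℤ) : codeOf (-v) = 2 * zeroCode - codeOf v := by
  simp only [codeOf, Pi.neg_apply, zeroCode]; push_cast; ring

lemma form_self_eq_sum (a : Fin 8 → ℤ) : form a a = ∑ i, a i * form (Pi.single i 1) a :=
  (form_sum_single a a).symm

lemma form_single_self (i : Fin 8) : form (Pi.single i 1) (Pi.single i 1) = 2 := by
  rw [form_simple]; fin_cases i <;> simp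

lemma sum_natAbs_lt {a b : Fin 8 → ℤ} (i : Fin 8) (hi : (b i).natAbs < (a i).natAbs)
    (hj : ∀ j, j ≠ i → b j = a j) : ∑ j, (b j).natAbs < ∑ j, (a j).natAbs := by
  refine Finset.sum_lt_sum (fun j _ => ?_) ⟨i, Finset.mem_univ _, hi⟩
  by_cases h : j = i
  · subst h; exact hi.le
  · rw [hj j h]

/-- Induction on roots: a property of the simple roots and their negatives, which is preserved by
adding simple roots and their negatives, holds for all roots. -/
lemma root_induction {P : (Fin 8 → ℤ) → Prop} (hs : ∀ i, P (Pi.single i 1))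
    (hn : ∀ i, P (-Pi.single i 1))
    (ha : ∀ i a, form a a = 2 → form (Pi.single i 1) a = -1 → P a → P (a + Pi.single i 1))
    (hb : ∀ i a, form a a = 2 → form (Pi.single i 1) a = 1 → P a → P (a + -Pi.single i 1))
    (a : Fin 8 → ℤ) (h : form a a = 2) : P a := by
  induction hN : ∑ j, (a j).natAbs using Nat.strong_induction_on generalizing a with
  | _ N ih =>
  subst hN
  -- The numbers `a i * form (Pi.single i 1) a` add up to `form a a = 2`, so one of them is
  -- positive. Moving `a` by a simple root or its negative towards zero in that coordinate gives a
  -- root with smaller `∑ |a j|`, unless `a` itself is simple or minus a simple root.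
  have hpos : ∃ i, 0 < a i * form (Pi.single i 1) a := by
    by_contra hcon
    push Not at hcon
    have := Finset.sum_nonpos fun i (_ : i ∈ Finset.univ) => hcon i
    rw [← form_self_eq_sum, h] at this
    omega
  obtain ⟨i, hi⟩ := hpos
  have hb1 := form_bounds (form_single_self i) h
  rcases pos_and_pos_or_neg_and_neg_of_mul_pos hi with ⟨h1, h2⟩ | ⟨h1, h2⟩
  · have : form (Pi.single i 1) a = 1 ∨ form (Pi.single i 1) a = 2 := by omega
    rcases this with h3 | h3
    · have hf : form (a + -Pi.single i 1) (a + -Pi.single i 1) = 2 := by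
        rw [form_add_left, form_add_right, form_add_right]
        simp only [form_neg_left, form_neg_right, form_comm a, form_single_self, h, h3]; norm_num
      have := ha i (a + -Pi.single i 1) hf
        (by rw [form_add_right, form_neg_right, h3, form_single_self]; norm_num)
        (ih _ (sum_natAbs_lt i (by simp; omega) fun j hj => by simp [hj]) _ hf rfl)
      simpa using this
    · rw [eq_of_form (form_single_self i) h h3]; exact hs i
  · have : form (Pi.single i 1) a = -1 ∨ form (Pi.single i 1) a = -2 := by omega
    rcases this with h3 | h3
    · have hf : form (a + Pi.single i 1) (a + Pi.single i 1) = 2 := by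
        rw [form_add_left, form_add_right, form_add_right]
        simp only [form_comm a, form_single_self, h, h3]; norm_num
      have := hb i (a + Pi.single i 1) hf
        (by rw [form_add_right, h3, form_single_self]; norm_num)
        (ih _ (sum_natAbs_lt i (by simp; omega) fun j hj => by simp [hj]) _ hf rfl)
      simpa using this
    · rw [add_eq_zero_of_form (form_single_self i) h h3]; exact hn i

/-- Every root has a code. -/
lemma exists_code (a : Fin 8 → ℤ) (h : form a a = 2) : ∃ c, IsRootCode c ∧ vecOf c = a := by
  refine root_induction (P := fun a => ∃ c, IsRootCode c ∧ vecOf c = a) (fun i => ?_)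
    (fun i => ?_) ?_ ?_ a h
  · obtain ⟨h1, -, h3, -, -⟩ := simple_isCode i
    exact ⟨_, ⟨le_trans (by norm_num [zeroCode]) (Nat.le_add_right _ _), h1⟩, h3⟩
  · obtain ⟨-, h2, -, h4, h5⟩ := simple_isCode i
    exact ⟨_, ⟨h5, h2⟩, h4⟩
  · rintro i _ - h2 ⟨c, hc, rfl⟩
    have h3 : IsRootCode (c + 64 ^ (i : ℕ)) := ⟨le_trans hc.1 (Nat.le_add_right _ _),
      isCode_add_of_form (mem_keys_of_isCode hc.2) hc.1 h2⟩
    refine ⟨_, h3, IsRootCode.vecOf_eq h3 (fun j => ?_) ?_⟩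
    · have := hc.bounds j
      have : (Pi.single i 1 : Fin 8 → ℤ) j = 0 ∨ (Pi.single i 1 : Fin 8 → ℤ) j = 1 := by
        by_cases hj : j = i
        · subst hj; simp
        · simp [hj]
      rw [Pi.add_apply]; omega
    · have := codeOf_add (vecOf c) (Pi.single i 1)
      rw [codeOf_single, hc.codeOf_vecOf] at this
      push_cast at this ⊢; linarith
  · rintro i _ - h2 ⟨c, hc, rfl⟩
    have h4 := hc.pow_add_le i
    have h3 : IsRootCode (c - 64 ^ (i : ℕ)) := ⟨by omega,
      isCode_sub_of_form (mem_keys_of_isCode hc.2) hc.1 h2⟩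
    refine ⟨_, h3, IsRootCode.vecOf_eq h3 (fun j => ?_) ?_⟩
    · have := hc.bounds j
      have : (Pi.single i 1 : Fin 8 → ℤ) j = 0 ∨ (Pi.single i 1 : Fin 8 → ℤ) j = 1 := by
        by_cases hj : j = i
        · subst hj; simp
        · simp [hj]
      rw [Pi.add_apply, Pi.neg_apply]; omega
    · have := codeOf_add (vecOf c) (-Pi.single i 1)
      rw [codeOf_neg, codeOf_single, hc.codeOf_vecOf] at this
      rw [Nat.cast_sub (by omega)]
      push_cast at this ⊢; linarith

end ExceptionalE8

end


noncomputable section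

namespace ExceptionalE8

/-! ### Evaluation of sparse vectors -/

section Evaluation

variable (k : Type*) [CommRing k]

/-- The basis vector with a given code. -/
def codeVec (c : ℕ) : Alg k :=
  if h : c < 8 then basisVec k (Sum.inl ⟨c, h⟩) else rootVec k (vecOf c)

/-- The element represented by a sparse vector. -/
def eval (x : SVec) : Alg k := (x.map fun t => (t.1 : k) • codeVec k t.2).sum

/-- Whether all terms of a sparse vector have codes of basis vectors. -/
def Valid (x : SVec) : Prop := ∀ t ∈ x, isCode t.2 = true

instance (x : SVec) : Decidable (Valid x) := by unfold Valid; infer_instance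

@[simp] lemma eval_nil : eval k [] = 0 := rfl

@[simp] lemma eval_cons (t : ℕ × ℕ) (x : SVec) :
    eval k (t :: x) = (t.1 : k) • codeVec k t.2 + eval k x := by simp [eval]

@[simp] lemma eval_append (x y : SVec) : eval k (x ++ y) = eval k x + eval k y := by simp [eval]

@[simp] lemma eval_smulVec (n : ℕ) (x : SVec) : eval k (smulVec n x) = (n : k) • eval k x := by
  induction x with
  | nil => simp [smulVec]
  | cons t x ih =>
    rw [smulVec, List.map_cons, eval_cons, ← smulVec, ih, eval_cons, smul_add, smul_smul]
    push_cast; rfl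

lemma eval_flatMap {α : Type*} (x : List α) (f : α → SVec) :
    eval k (x.flatMap f) = (x.map fun t => eval k (f t)).sum := by
  induction x with
  | nil => simp
  | cons t x ih => simp [ih]

lemma Valid.cons {t : ℕ × ℕ} {x : SVec} (ht : isCode t.2 = true) (hx : Valid x) :
    Valid (t :: x) := List.forall_mem_cons.mpr ⟨ht, hx⟩

lemma Valid.smulVec {x : SVec} (hx : Valid x) (n : ℕ) : Valid (smulVec n x) := by
  intro t ht
  obtain ⟨s, hs, rfl⟩ := List.mem_map.mp ht
  exact hx s hs

lemma Valid.flatMap {α : Type*} {x : List α} {f : α → SVec} (h : ∀ t ∈ x, Valid (f t)) :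
    Valid (x.flatMap f) := by
  intro t ht
  obtain ⟨s, hs, hst⟩ := List.mem_flatMap.mp ht
  exact h s hs t hst

lemma force_eq {α : Type} (n : ℕ) (f : ℕ → α) : force n f = f n := by
  cases n <;> rfl

lemma Valid.collect {x : SVec} (hx : Valid x) : Valid (collect x) := by
  have h1 : ∀ n c (l : SVec), isCode c = true → Valid l → Valid (consTerm n c l) := by
    intro n c l hc hl
    unfold consTerm
    cases Nat.beq n 0
    · exact Valid.cons hc hl
    · exact hl
  have h2 : ∀ n c (l : SVec), isCode c = true → Valid l → Valid (addTerm n c l) := by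
    intro n c l hc hl
    induction l with
    | nil => rw [addTerm, force_eq]; exact h1 _ _ _ hc hl
    | cons t l ih =>
      have hl' := List.forall_mem_cons.mp hl
      change Valid (bif Nat.beq t.2 c then force ((n + t.1) % 3) fun r => consTerm r c l
        else t :: addTerm n c l)
      cases Nat.beq t.2 c
      · exact Valid.cons hl'.1 (ih hl'.2)
      · rw [cond_true, force_eq]; exact h1 _ _ _ hc hl'.2
  induction x with
  | nil => exact hx
  | cons t x ih =>
    have hx' := List.forall_mem_cons.mp hx
    exact h2 _ _ _ hx'.1 (ih hx'.2)

lemma codeVec_of_lt {c : ℕ} (h : c < 8) : codeVec k c = basisVec k (Sum.inl ⟨c, h⟩) := dif_pos h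

lemma codeVec_of_le {c : ℕ} (h : 8 ≤ c) : codeVec k c = rootVec k (vecOf c) :=
  dif_neg (by omega)

lemma eval_consTerm (n c : ℕ) (x : SVec) :
    eval k (consTerm n c x) = (n : k) • codeVec k c + eval k x := by
  unfold consTerm
  cases h : Nat.beq n 0
  · simp
  · rw [Nat.eq_of_beq_eq_true h]; simp

variable [CharP k 3]

lemma cast_mod_three (n : ℕ) : ((n % 3 : ℕ) : k) = n := by
  conv_rhs => rw [← Nat.mod_add_div n 3]
  rw [Nat.cast_add, Nat.cast_mul, CharP.cast_eq_zero k 3, zero_mul, add_zero]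

lemma three_eq_zero : (3 : k) = 0 := by
  have := CharP.cast_eq_zero k 3
  exact_mod_cast this

lemma eval_addTerm (n c : ℕ) (x : SVec) :
    eval k (addTerm n c x) = (n : k) • codeVec k c + eval k x := by
  induction x with
  | nil => rw [addTerm, force_eq, eval_consTerm, cast_mod_three]
  | cons t x ih =>
    change eval k (bif Nat.beq t.2 c then force ((n + t.1) % 3) fun r => consTerm r c x
      else t :: addTerm n c x) = _
    cases h : Nat.beq t.2 c
    · rw [cond_false, eval_cons, ih, eval_cons]; abel
    · rw [cond_true, force_eq, eval_consTerm, cast_mod_three, eval_cons,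
        ← Nat.eq_of_beq_eq_true h, Nat.cast_add, add_smul, add_assoc]

@[simp] lemma eval_collect (x : SVec) : eval k (collect x) = eval k x := by
  induction x with
  | nil => rfl
  | cons t x ih => rw [collect, List.foldr_cons, ← collect, eval_addTerm, ih, eval_cons]

/-- As 2 = -1 in `k`, the collected list represents the difference of the two vectors. Only
soundness of the test is needed. -/
lemma eval_eq_of_svEq {x y : SVec} (h : svEq x y = true) : eval k x = eval k y := by
  have h1 : eval k (collect (x ++ smulVec 2 y)) = 0 := by
    rw [svEq, List.isEmpty_iff] at h
    rw [h, eval_nil]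
  rw [eval_collect, eval_append, eval_smulVec] at h1
  have h2 : ((2 : ℕ) : k) = -1 := by
    have := three_eq_zero k
    push_cast
    linear_combination this
  rw [h2, neg_smul, one_smul, ← sub_eq_add_neg] at h1
  exact sub_eq_zero.mp h1

/-! ### The bracket of sparse vectors -/

/-- Modulo three, a row `2 vᵢ - ∑ vⱼ` of the Cartan matrix is `2 (vᵢ + ∑ vⱼ)`, and the offset -32 of
each digit is 1. -/
lemma pairingCode_cast (i : Fin 8) (c : ℕ) :
    (pairingCode i c : k) = (form (Pi.single i 1) (vecOf c) : k) := by
  rw [form_simple_vecOf, pairingCode, cast_mod_three]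
  have h3 := three_eq_zero k
  fin_cases i <;> simp [neighbors, neighborSum] <;> grind

/-- Only the parity of `half` matters, so the signs of its terms and the even offset 32 can be
dropped. The value `1 + n % 2` is 1 for even n and 2 = -1 for odd n. -/
lemma signCode_cast (a c : ℕ) : (signCode a c : k) = (sign (vecOf a) (vecOf c) : k) := by
  have key : ∃ n : ℕ, signCode a c = 1 + n % 2 ∧ ∃ m : ℤ, half (vecOf a) (vecOf c) = n - 2 * m := by
    refine ⟨_, rfl, ?_⟩
    rw [half_expand]
    push_cast
    simp only [vecOf, Fin.isValue, Fin.coe_ofNat_eq_mod]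
    norm_num
    generalize (digit a 0 : ℤ) = a0; generalize (digit a 1 : ℤ) = a1
    generalize (digit a 2 : ℤ) = a2; generalize (digit a 3 : ℤ) = a3
    generalize (digit a 4 : ℤ) = a4; generalize (digit a 5 : ℤ) = a5
    generalize (digit a 6 : ℤ) = a6; generalize (digit a 7 : ℤ) = a7
    generalize (digit c 0 : ℤ) = c0; generalize (digit c 1 : ℤ) = c1
    generalize (digit c 2 : ℤ) = c2; generalize (digit c 3 : ℤ) = c3
    generalize (digit c 4 : ℤ) = c4; generalize (digit c 5 : ℤ) = c5
    generalize (digit c 6 : ℤ) = c6; generalize (digit c 7 : ℤ) = c7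
    -- Half of the discrepancy that arises when the products of shifted digits are expanded and the
    -- seven mixed products change sign.
    refine ⟨16 * (a0 + c0 + a1 + c1 + a2 + c2 + a3 + c3 + a4 + c4 + a5 + c5 + a6 + c6 + a7 + c7)
      - 16 * (a0 + c2 + a1 + c3 + a2 + c3 + a3 + c4 + a4 + c5 + a5 + c6 + a6 + c7) - 512
      + (a0 * c2 + a1 * c3 + a2 * c3 + a3 * c4 + a4 * c5 + a5 * c6 + a6 * c7), by ring⟩
  obtain ⟨n, h1, m, h2⟩ := key
  have h3 := three_eq_zero k
  rw [h1, sign, h2, Int.negOnePow_sub, Int.negOnePow_even (2 * m) (even_two_mul m)]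
  rcases Nat.mod_two_eq_zero_or_one n with h | h
  · rw [h, Int.negOnePow_even _ (by exact_mod_cast Nat.even_iff.mpr h)]; simp
  · rw [h, Int.negOnePow_odd _ (by exact_mod_cast Nat.odd_iff.mpr h)]
    simp; linear_combination h3

end Evaluation

end ExceptionalE8

end


/-! ### Agreement of the bracket on codes with the Lie bracket -/

noncomputable section

namespace ExceptionalE8

section Evaluation

variable (k : Type*) [CommRing k]

/-- Encoding is additive up to `zeroCode`. The subtraction takes place in the natural numbers, and
`8 ≤ w` excludes truncation. -/
lemma codeOf_eq_of_root {a c w : ℕ} (ha : IsRootCode a) (hc : IsRootCode c)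
    (hw : IsRootCode w) : w = a + c - zeroCode ↔ vecOf w = vecOf a + vecOf c := by
  have h1 := codeOf_add (vecOf a) (vecOf c)
  rw [ha.codeOf_vecOf, hc.codeOf_vecOf] at h1
  have h8 := hw.1
  constructor
  · intro h
    refine hw.vecOf_eq (fun j => ?_) (by omega)
    have := ha.bounds j; have := hc.bounds j
    rw [Pi.add_apply]; omega
  · intro h
    rw [← h, hw.codeOf_vecOf] at h1
    omega

lemma zeroCode_eq_iff {a c : ℕ} (ha : IsRootCode a) (hc : IsRootCode c) :
    a + c - zeroCode = zeroCode ↔ vecOf a + vecOf c = 0 := by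
  have h1 := codeOf_add (vecOf a) (vecOf c)
  rw [ha.codeOf_vecOf, hc.codeOf_vecOf] at h1
  have hz : 0 < zeroCode := by norm_num [zeroCode]
  constructor
  · intro h
    refine codeOf_injective (v := 0) ?_ fun j => ?_
    · rw [codeOf_zero]; omega
    · have := ha.bounds j; have := hc.bounds j
      rw [Pi.add_apply, Pi.zero_apply]; omega
  · intro h
    rw [h, codeOf_zero] at h1
    omega

lemma Valid.singleton {n c : ℕ} (h : isCode c = true) : Valid [(n, c)] :=
  Valid.cons h fun _ h => absurd h List.not_mem_nil

lemma valid_nil : Valid [] := fun _ h => absurd h List.not_mem_nil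

set_option maxRecDepth 10000 in
lemma isCode_of_lt : ∀ i < 8, isCode i = true := by decide +kernel

lemma valid_codeBracket {a c : ℕ} (ha : isCode a = true) (hc : isCode c = true) :
    Valid (codeBracket a c) := by
  unfold codeBracket
  cases Nat.blt a 8
  · cases Nat.blt c 8
    · rw [cond_false, cond_false, force_eq, rootBracket]
      cases Nat.beq (a + c - zeroCode) zeroCode
      · rw [cond_false]
        cases Nat.blt (a + c - zeroCode) 8
        · rw [cond_false]
          cases h : isCode (a + c - zeroCode)
          · exact valid_nil
          · rw [cond_true, force_eq]; exact Valid.singleton h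
        · exact valid_nil
      · rw [cond_true]
        intro t ht
        obtain ⟨i, hi, rfl⟩ := List.mem_map.mp ht
        refine isCode_of_lt i ?_
        simp only [List.mem_cons, List.not_mem_nil, or_false] at hi
        omega
    · exact Valid.singleton ha
  · cases Nat.blt c 8
    · exact Valid.singleton hc
    · exact valid_nil

lemma Valid.svBracket {x y : SVec} (hx : Valid x) (hy : Valid y) : Valid (svBracket x y) :=
  (Valid.flatMap fun s hs => Valid.flatMap fun t ht =>
    (valid_codeBracket (hx s hs) (hy t ht)).smulVec _).collect

lemma zsmul_eq_cast_smul (n : ℤ) (x : Alg k) : n • x = (n : k) • x :=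
  (Int.cast_smul_eq_zsmul k n x).symm

variable [CharP k 3]

lemma cartan_eq_eval (a : ℕ) : -cartan k (vecOf a) =
    eval k ([0, 1, 2, 3, 4, 5, 6, 7].map fun i => (2 + 2 * digit a i, i)) := by
  have h3 := three_eq_zero k
  have h : ∀ i (hi : i < 8), ((2 + 2 * digit a i : ℕ) : k) • codeVec k i =
      -(vecOf a ⟨i, hi⟩ • basisVec k (Sum.inl ⟨i, hi⟩)) := by
    intro i hi
    rw [codeVec_of_lt k hi, zsmul_eq_cast_smul, ← neg_smul]
    congr 1
    simp only [vecOf]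
    push_cast
    -- With d the digit, `2 + 2 d` and `-(d - 32)` differ by `3 (d - 10)`.
    linear_combination (-10 + (digit a i : k)) * h3
  simp only [List.map_cons, List.map_nil, eval_cons, eval_nil, add_zero]
  rw [h 0 (by norm_num), h 1 (by norm_num), h 2 (by norm_num), h 3 (by norm_num),
    h 4 (by norm_num), h 5 (by norm_num), h 6 (by norm_num), h 7 (by norm_num)]
  rw [cartan, Fin.sum_univ_eight]
  simp only [neg_add, add_assoc]
  rfl

lemma eval_codeBracket {a c : ℕ} (ha : isCode a = true) (hc : isCode c = true) :
    eval k (codeBracket a c) = ⁅codeVec k a, codeVec k c⁆ := by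
  have blt_true : ∀ n : ℕ, n < 8 → Nat.blt n 8 = true := fun n h => by
    rw [Nat.blt_eq]; exact h
  have blt_false : ∀ n : ℕ, ¬ n < 8 → Nat.blt n 8 = false := fun n h => by
    rw [Bool.eq_false_iff, ne_eq, Nat.blt_eq]; exact h
  rw [lie_def, codeBracket]
  by_cases ha8 : a < 8 <;> by_cases hc8 : c < 8
  · rw [blt_true a ha8, blt_true c hc8, codeVec_of_lt k ha8, codeVec_of_lt k hc8,
      ← cartan_single, ← cartan_single, bracket_cartan_cartan]
    rfl
  · rw [blt_true a ha8, blt_false c hc8, codeVec_of_lt k ha8, codeVec_of_le k (not_lt.mp hc8),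
      ← cartan_single, bracket_cartan_rootVec, cond_true, cond_false, eval_cons, eval_nil,
      add_zero, zsmul_eq_cast_smul, codeVec_of_le k (not_lt.mp hc8)]
    congr 1
    exact pairingCode_cast k ⟨a, ha8⟩ c
  · rw [blt_false a ha8, blt_true c hc8, codeVec_of_lt k hc8, codeVec_of_le k (not_lt.mp ha8),
      ← cartan_single, bracket_rootVec_cartan, cond_false, cond_true, eval_cons, eval_nil,
      add_zero, zsmul_eq_cast_smul, codeVec_of_le k (not_lt.mp ha8), ← neg_smul]
    congr 1
    have h1 := pairingCode_cast k ⟨c, hc8⟩ a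
    have h3 := three_eq_zero k
    simp only at h1 ⊢
    push_cast
    rw [h1]
    linear_combination (form (Pi.single ⟨c, hc8⟩ 1) (vecOf a) : k) * h3
  · have ha' : IsRootCode a := ⟨not_lt.mp ha8, ha⟩
    have hc' : IsRootCode c := ⟨not_lt.mp hc8, hc⟩
    rw [blt_false a ha8, blt_false c hc8, cond_false, cond_false, force_eq, rootBracket,
      codeVec_of_le k ha'.1, codeVec_of_le k hc'.1, bracket_rootVec_rootVec k ha'.form hc'.form]
    by_cases hz : vecOf a + vecOf c = 0
    · have h1 : Nat.beq (a + c - zeroCode) zeroCode = true := by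
        rw [Nat.beq_eq]; exact (zeroCode_eq_iff ha' hc').mpr hz
      rw [h1, cond_true, if_pos hz, hz, rootVec_not k (by rw [form_zero_left]; omega),
        ← cartan_eq_eval, eq_neg_of_add_eq_zero_right hz, sign_neg_right, sign_self ha'.form]
      simp
    · have h1 : Nat.beq (a + c - zeroCode) zeroCode = false := by
        rw [Bool.eq_false_iff, ne_eq, Nat.beq_eq]
        exact fun h => hz ((zeroCode_eq_iff ha' hc').mp h)
      rw [h1, cond_false, if_neg hz, add_zero]
      -- Completeness of the table enters here: if the sum is a root, `exists_code` provides its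
      -- code. So a failing search means that the bracket vanishes.
      have key : (8 ≤ a + c - zeroCode ∧ isCode (a + c - zeroCode) = true) ∨
          rootVec k (vecOf a + vecOf c) = 0 := by
        by_cases hf : form (vecOf a + vecOf c) (vecOf a + vecOf c) = 2
        · obtain ⟨w, hw, hwv⟩ := exists_code _ hf
          rw [← (codeOf_eq_of_root ha' hc' hw).mpr hwv]
          exact Or.inl hw
        · exact Or.inr (rootVec_not k hf)
      by_cases h8 : a + c - zeroCode < 8
      · rw [blt_true _ h8, cond_true, key.resolve_left fun h => by omega, smul_zero, eval_nil]
      · rw [blt_false _ h8, cond_false]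
        cases hw : isCode (a + c - zeroCode)
        · rw [key.resolve_left fun h => by rw [hw] at h; exact absurd h.2 (by decide), smul_zero,
            cond_false, eval_nil]
        · rw [cond_true, force_eq, eval_cons, eval_nil, add_zero,
            codeVec_of_le k (not_lt.mp h8), signCode_cast, zsmul_eq_cast_smul,
            (codeOf_eq_of_root ha' hc' ⟨not_lt.mp h8, hw⟩).mp rfl]

lemma eval_svBracket {x y : SVec} (hx : Valid x) (hy : Valid y) :
    eval k (svBracket x y) = ⁅eval k x, eval k y⁆ := by
  have h1 : ∀ (s : ℕ × ℕ) (y : SVec), isCode s.2 = true → Valid y →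
      (y.map fun t => eval k (smulVec (s.1 * t.1) (codeBracket s.2 t.2))).sum =
        ⁅(s.1 : k) • codeVec k s.2, eval k y⁆ := by
    intro s y hs hy
    induction y with
    | nil => simp
    | cons t y ih =>
      have hy' := List.forall_mem_cons.mp hy
      rw [List.map_cons, List.sum_cons, ih hy'.2, eval_cons, lie_add, eval_smulVec,
        eval_codeBracket k hs hy'.1, lie_smul, smul_lie (s.1 : k) _ (codeVec k t.2), smul_smul, Nat.cast_mul, mul_comm]
  rw [svBracket, eval_collect, eval_flatMap]
  simp only [eval_flatMap]
  induction x with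
  | nil => simp
  | cons s x ih =>
    have hx' := List.forall_mem_cons.mp hx
    rw [List.map_cons, List.sum_cons, ih hx'.2, eval_cons, add_lie, h1 s y hx'.1 hy]

/-! ### Linear maps given on codes -/

/-- The code of a basis vector. -/
def basisCode : Fin 8 ⊕ Root → ℕ
  | Sum.inl i => i
  | Sum.inr a => (codeOf a.1).toNat

lemma basisCode_inr {a : Root} {c : ℕ} (hc : IsRootCode c) (h : vecOf c = a.1) :
    basisCode (Sum.inr a) = c := by
  rw [basisCode, ← h, hc.codeOf_vecOf, Int.toNat_natCast]

lemma isCode_basisCode (s : Fin 8 ⊕ Root) : isCode (basisCode s) = true := by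
  rcases s with i | a
  · exact isCode_of_lt i i.2
  · obtain ⟨c, hc, h⟩ := exists_code a.1 a.2
    rw [basisCode_inr hc h]; exact hc.2

omit [CharP k 3] in
lemma codeVec_basisCode (s : Fin 8 ⊕ Root) : codeVec k (basisCode s) = basisVec k s := by
  rcases s with i | a
  · exact codeVec_of_lt k i.2
  · obtain ⟨c, hc, h⟩ := exists_code a.1 a.2
    rw [basisCode_inr hc h, codeVec_of_le k hc.1, basisVec_inr, h]

lemma exists_basisCode {c : ℕ} (hc : isCode c = true) : ∃ s, basisCode s = c := by
  by_cases h : c < 8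
  · exact ⟨Sum.inl ⟨c, h⟩, rfl⟩
  · have hc' : IsRootCode c := ⟨not_lt.mp h, hc⟩
    exact ⟨Sum.inr ⟨vecOf c, hc'.form⟩, basisCode_inr hc' rfl⟩

variable {k} {M : Type*} [AddCommGroup M] [Module k M]

/-- The linear map with given values on the basis vectors. -/
def codeLift (f : ℕ → M) : Alg k →ₗ[k] M :=
  Finsupp.linearCombination k fun s => f (basisCode s)

omit [CharP k 3] in
lemma codeLift_codeVec (f : ℕ → M) {c : ℕ} (hc : isCode c = true) :
    codeLift f (codeVec k c) = f c := by
  obtain ⟨s, rfl⟩ := exists_basisCode hc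
  rw [codeVec_basisCode, codeLift, basisVec]
  erw [Finsupp.linearCombination_single, one_smul]

omit [CharP k 3] in
lemma codeLift_eval (f : ℕ → M) {x : SVec} (hx : Valid x) :
    codeLift f (eval k x) = (x.map fun t => (t.1 : k) • f t.2).sum := by
  induction x with
  | nil => simp
  | cons t x ih =>
    have hx' := List.forall_mem_cons.mp hx
    rw [eval_cons, map_add, map_smul, codeLift_codeVec f hx'.1, ih hx'.2, List.map_cons,
      List.sum_cons]

omit [CharP k 3] in
/-- Linear maps which agree on the vectors in the table agree. -/
lemma ext_codeVec {f g : Alg k →ₗ[k] M} (h : ∀ c ∈ codeTable.keys, f (codeVec k c) = g (codeVec k c)) :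
    f = g :=
  ext_basisVec k fun s => by
    rw [← codeVec_basisCode]
    exact h _ (mem_keys_of_isCode (isCode_basisCode s))

end Evaluation

end ExceptionalE8

end


noncomputable section

namespace Hamiltonian

open MvPolynomial

/-! ### Coefficients of truncated polynomials -/

section Coefficients

variable {m : ℕ} {k : Type*} [CommRing k]

/-- The ideal is generated by monomials, so membership is decided on the support; the exponents
below `p` survive in the quotient. -/
lemma mem_truncIdeal {p : ℕ} {f : MvPolynomial (Fin m ⊕ Fin m) k} :
    f ∈ truncIdeal p m k ↔ ∀ s ∈ f.support, ∃ i, p ≤ s i := by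
  have h : (Set.range fun i : Fin m ⊕ Fin m => (X i ^ p : MvPolynomial (Fin m ⊕ Fin m) k)) =
      (fun s => monomial s (1 : k)) '' Set.range fun i => Finsupp.single i p := by
    rw [← Set.range_comp]
    congr 1
    funext i
    simp [X_pow_eq_monomial]
  rw [truncIdeal, h, mem_ideal_span_monomial_image]
  simp only [Set.exists_range_iff, Finsupp.single_le_iff]

/-- The exponent of a monomial in the truncated polynomial ring. -/
def expo (b : Fin m ⊕ Fin m → Fin 3) : Fin m ⊕ Fin m →₀ ℕ :=
  Finsupp.equivFunOnFinite.symm fun i => (b i : ℕ)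

@[simp] lemma expo_apply (b : Fin m ⊕ Fin m → Fin 3) (i : Fin m ⊕ Fin m) : expo b i = b i := rfl

lemma expo_injective : Function.Injective (expo (m := m)) := fun b c h => by
  funext i
  exact Fin.ext (DFunLike.congr_fun h i)

/-- The coefficients of a truncated polynomial. -/
def tcoeff (b : Fin m ⊕ Fin m → Fin 3) : Trunc 3 m k →ₗ[k] k :=
  (Submodule.liftQ ((truncIdeal 3 m k).restrictScalars k) (lcoeff k (expo b)) fun f hf => by
    rw [LinearMap.mem_ker, lcoeff_apply]
    by_contra h
    obtain ⟨i, hi⟩ := mem_truncIdeal.mp hf _ (mem_support_iff.mpr h)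
    have := (b i).2
    rw [expo_apply] at hi
    omega : Trunc 3 m k →ₗ[k] k)

lemma tcoeff_mk (b : Fin m ⊕ Fin m → Fin 3) (f : MvPolynomial (Fin m ⊕ Fin m) k) :
    tcoeff b (Ideal.Quotient.mk (truncIdeal 3 m k) f) = coeff (expo b) f := rfl

lemma eq_zero_of_tcoeff {f : Trunc 3 m k} (h : ∀ b, tcoeff b f = 0) : f = 0 := by
  obtain ⟨f, rfl⟩ := Ideal.Quotient.mk_surjective f
  rw [Ideal.Quotient.eq_zero_iff_mem, mem_truncIdeal]
  intro s hs
  by_contra! hcon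
  have h1 : expo (fun i => ⟨s i, hcon i⟩) = s := Finsupp.ext fun i => rfl
  have h2 := h fun i => ⟨s i, hcon i⟩
  rw [tcoeff_mk, h1] at h2
  exact mem_support_iff.mp hs h2

lemma ext_tcoeff {f g : Trunc 3 m k} (h : ∀ b, tcoeff b f = tcoeff b g) : f = g :=
  sub_eq_zero.mp (eq_zero_of_tcoeff fun b => by rw [map_sub, h, sub_self])

/-- The monomials. -/
def tmon (b : Fin m ⊕ Fin m → Fin 3) : Trunc 3 m k :=
  Ideal.Quotient.mk _ (monomial (expo b) 1)

lemma tcoeff_tmon (b c : Fin m ⊕ Fin m → Fin 3) :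
    tcoeff b (tmon c : Trunc 3 m k) = if b = c then 1 else 0 := by
  rw [tmon, tcoeff_mk, coeff_monomial]
  simp only [expo_injective.eq_iff, eq_comm]

lemma tcoeff_sum_tmon (F : (Fin m ⊕ Fin m → Fin 3) → k) (b : Fin m ⊕ Fin m → Fin 3) :
    tcoeff b (∑ c, F c • tmon c : Trunc 3 m k) = F b := by
  rw [map_sum, Finset.sum_eq_single b]
  · rw [map_smul, tcoeff_tmon, if_pos rfl, smul_eq_mul, mul_one]
  · intro c _ hc
    rw [map_smul, tcoeff_tmon, if_neg (Ne.symm hc), smul_zero]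
  · simp

lemma sum_tcoeff_tmon (f : Trunc 3 m k) : ∑ b, tcoeff b f • tmon b = f :=
  ext_tcoeff fun b => tcoeff_sum_tmon _ b

lemma expo_zero : expo (0 : Fin m ⊕ Fin m → Fin 3) = 0 := Finsupp.ext fun _ => rfl

lemma tcoeff_zero_mul (f g : Trunc 3 m k) : tcoeff 0 (f * g) = tcoeff 0 f * tcoeff 0 g := by
  obtain ⟨f, rfl⟩ := Ideal.Quotient.mk_surjective f
  obtain ⟨g, rfl⟩ := Ideal.Quotient.mk_surjective g
  rw [← map_mul, tcoeff_mk, tcoeff_mk, tcoeff_mk, expo_zero]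
  exact map_mul constantCoeff f g

lemma tcoeff_zero_one : tcoeff 0 (1 : Trunc 3 m k) = 1 := by
  rw [← map_one (Ideal.Quotient.mk (truncIdeal 3 m k)), tcoeff_mk, expo_zero]
  simp

variable [CharP k 3]

omit [CharP k 3] in
lemma expo_update (b : Fin m ⊕ Fin m → Fin 3) {i : Fin m ⊕ Fin m} (h : b i ≠ 2) :
    expo (Function.update b i (b i + 1)) = expo b + Finsupp.single i 1 := by
  ext j
  rw [Finsupp.add_apply, expo_apply, expo_apply]
  by_cases hj : j = i
  · subst hj
    rw [Function.update_self, Finsupp.single_eq_same]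
    revert h; generalize b j = c; revert c; decide
  · rw [Function.update_of_ne hj, Finsupp.single_eq_of_ne hj, add_zero]

/-- The addition in `Fin 3` wraps round when `b i = 2`, but then the factor `b i + 1` is 3 = 0, so
the formula holds without exception. -/
lemma tcoeff_partialD (b : Fin m ⊕ Fin m → Fin 3) (i : Fin m ⊕ Fin m) (f : Trunc 3 m k) :
    tcoeff b (partialD 3 m k i f) =
      ((b i : ℕ) + 1 : k) * tcoeff (Function.update b i (b i + 1)) f := by
  obtain ⟨f, rfl⟩ := Ideal.Quotient.mk_surjective f
  rw [partialD_mk, tcoeff_mk, tcoeff_mk, coeff_pderiv, expo_apply]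
  by_cases h : b i = 2
  · have : ((b i : ℕ) + 1 : k) = 0 := by
      rw [h]
      have := CharP.cast_eq_zero k 3
      push_cast at this ⊢
      norm_num
      linear_combination this
    rw [this, mul_zero, zero_mul]
  · rw [expo_update b h, mul_comm]

lemma tcoeff_partialD_of_eq_two {b : Fin m ⊕ Fin m → Fin 3} {i : Fin m ⊕ Fin m} (h : b i = 2)
    (f : Trunc 3 m k) : tcoeff b (partialD 3 m k i f) = 0 := by
  have h3 : ((2 : Fin 3) : ℕ) = 2 := rfl
  have := CharP.cast_eq_zero k 3
  rw [tcoeff_partialD, h, h3]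
  have h4 : ((2 : ℕ) + 1 : k) = 0 := by
    push_cast at this ⊢
    linear_combination this
  rw [h4, zero_mul]

end Coefficients

section Field

variable {m : ℕ} {k : Type*} [Field k] [CharP k 3]

lemma two_ne_zero' : (2 : k) ≠ 0 := fun h => by
  have := CharP.cast_eq_zero k 3
  push_cast at this
  exact one_ne_zero (α := k) (by linear_combination this - h)

lemma fin_cast_ne_zero {c : Fin 3} (hc : c ≠ 0) : ((c : ℕ) : k) ≠ 0 := by
  have h2 := two_ne_zero' (k := k)
  fin_cases c
  · simp at hc
  · simp
  · simpa using h2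

/-- A property of truncated polynomials which is inherited by the derivatives and implies that the
constant term is zero holds only for zero. -/
lemma eq_zero_of_partialD_closed {Q : Trunc 3 m k → Prop}
    (hQ : ∀ f i, Q f → Q (partialD 3 m k i f)) (h0 : ∀ f, Q f → tcoeff 0 f = 0)
    {f : Trunc 3 m k} (hf : Q f) : f = 0 := by
  refine eq_zero_of_tcoeff fun b => ?_
  induction hn : ∑ i, (b i : ℕ) generalizing b f with
  | zero =>
    have : b = 0 := by
      funext i
      have := Finset.sum_eq_zero_iff.mp hn i (Finset.mem_univ i)
      exact Fin.ext this
    rw [this]; exact h0 f hf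
  | succ n ih =>
    have : ∃ i, b i ≠ 0 := by
      by_contra! hcon
      simp [hcon] at hn
    obtain ⟨i, hi⟩ := this
    -- The coefficient of `∂ᵢ f` at the exponent lowered by one in `i` is `b i` times the
    -- coefficient of `f` at `b`, and `b i` is invertible in `k`.
    have h1 := ih (hQ f i hf) (Function.update b i (b i - 1)) (by
      rw [← Finset.add_sum_erase _ _ (Finset.mem_univ i)] at hn ⊢
      have h2 : ∑ j ∈ Finset.univ.erase i, ((Function.update b i (b i - 1) j : Fin 3) : ℕ) =
          ∑ j ∈ Finset.univ.erase i, (b j : ℕ) :=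
        Finset.sum_congr rfl fun j hj => by
          rw [Function.update_of_ne (Finset.ne_of_mem_erase hj)]
      rw [h2, Function.update_self]
      have h3 : ((b i - 1 : Fin 3) : ℕ) + 1 = b i := by
        revert hi; generalize b i = c; revert c; decide
      omega)
    rw [tcoeff_partialD, Function.update_self, sub_add_cancel, Function.update_idem,
      Function.update_eq_self] at h1
    have h3 : ((b i - 1 : Fin 3) : ℕ) + 1 = b i := by
      revert hi; generalize b i = c; revert c; decide
    refine (mul_eq_zero.mp h1).resolve_left ?_
    have := fin_cast_ne_zero (k := k) hi
    rwa [← h3, Nat.cast_add, Nat.cast_one] at this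

/-- The factorial of an exponent. -/
def fac (b : Fin m ⊕ Fin m → Fin 3) : k := ∏ i, (((b i : ℕ).factorial : ℕ) : k)

lemma fac_ne_zero (b : Fin m ⊕ Fin m → Fin 3) : (fac b : k) ≠ 0 := by
  refine Finset.prod_ne_zero_iff.mpr fun i _ => ?_
  have h2 := two_ne_zero' (k := k)
  generalize b i = c
  fin_cases c
  · simp
  · simp
  · simpa [Nat.factorial] using h2

omit [CharP k 3] in
lemma fac_update {b : Fin m ⊕ Fin m → Fin 3} {i : Fin m ⊕ Fin m} (h : b i ≠ 2) :
    (fac (Function.update b i (b i + 1)) : k) = ((b i : ℕ) + 1) * fac b := by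
  rw [fac, fac, ← Finset.mul_prod_erase _ _ (Finset.mem_univ i),
    ← Finset.mul_prod_erase _ (fun j => (((b j : ℕ).factorial : ℕ) : k)) (Finset.mem_univ i),
    ← mul_assoc, Function.update_self]
  congr 1
  · have : ((b i + 1 : Fin 3) : ℕ) = b i + 1 := by
      revert h; generalize b i = c; revert c; decide
    rw [this, Nat.factorial_succ]; push_cast; ring
  · exact Finset.prod_congr rfl fun j hj => by
      rw [Function.update_of_ne (Finset.ne_of_mem_erase hj)]

end Field

/-! ### Taylor series -/

section Jet

variable {k V : Type*} [Field k] [CharP k 3] [AddCommGroup V] [Module k V]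

/-- The monomials in four operators. -/
def multiPow (A : Fin 2 ⊕ Fin 2 → Module.End k V) (b : Fin 2 ⊕ Fin 2 → Fin 3) : Module.End k V :=
  A (Sum.inl 0) ^ (b (Sum.inl 0) : ℕ) * (A (Sum.inl 1) ^ (b (Sum.inl 1) : ℕ) *
    (A (Sum.inr 0) ^ (b (Sum.inr 0) : ℕ) * A (Sum.inr 1) ^ (b (Sum.inr 1) : ℕ)))

variable {A : Fin 2 ⊕ Fin 2 → Module.End k V}

omit [CharP k 3] in
lemma multiPow_zero : multiPow A 0 = 1 := by simp [multiPow]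

omit [CharP k 3] in
lemma multiPow_mul_of_ne (hA : ∀ i j, Commute (A i) (A j)) {b : Fin 2 ⊕ Fin 2 → Fin 3}
    {i : Fin 2 ⊕ Fin 2} (h : b i ≠ 2) :
    multiPow A b * A i = multiPow A (Function.update b i (b i + 1)) := by
  have h1 : ((b i + 1 : Fin 3) : ℕ) = b i + 1 := by
    revert h; generalize b i = c; revert c; decide
  have hc : ∀ i j (n : ℕ), A j ^ n * A i = A i * A j ^ n := fun i j n =>
    ((hA i j).pow_right n).eq.symm
  have hc' : ∀ i j (n : ℕ) (x : Module.End k V), A j ^ n * (A i * x) = A i * (A j ^ n * x) :=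
    fun i j n x => ((hA i j).pow_right n).symm.left_comm x
  rcases i with i | i <;> fin_cases i <;>
    simp only [multiPow, Fin.isValue, Fin.zero_eta, Fin.mk_one, Function.update_self, ne_eq,
      reduceCtorEq, not_false_eq_true, Function.update_of_ne, Sum.inl.injEq, Sum.inr.injEq,
      zero_ne_one, one_ne_zero] at h1 ⊢ <;> rw [h1, pow_succ']
  · simp only [mul_assoc, hc (Sum.inl 0), hc' (Sum.inl 0)]
  · simp only [mul_assoc, hc (Sum.inl 1), hc' (Sum.inl 1)]
  · simp only [mul_assoc, hc (Sum.inr 0), hc' (Sum.inr 0)]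
  · simp only [mul_assoc, hc (Sum.inr 1), hc' (Sum.inr 1)]

omit [CharP k 3] in
lemma multiPow_mul_of_eq (hA : ∀ i j, Commute (A i) (A j)) (h3 : ∀ i, A i ^ 3 = 0)
    {b : Fin 2 ⊕ Fin 2 → Fin 3} {i : Fin 2 ⊕ Fin 2} (h : b i = 2) : multiPow A b * A i = 0 := by
  have hc : ∀ i j (n : ℕ), A j ^ n * A i = A i * A j ^ n := fun i j n =>
    ((hA i j).pow_right n).eq.symm
  have hc' : ∀ i j (n : ℕ) (x : Module.End k V), A j ^ n * (A i * x) = A i * (A j ^ n * x) :=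
    fun i j n x => ((hA i j).pow_right n).symm.left_comm x
  have hz : ∀ i (x : Module.End k V), A i * (A i ^ 2 * x) = 0 := fun i x => by
    rw [← mul_assoc, ← pow_succ', h3, zero_mul]
  have hz' : ∀ i, A i * A i ^ 2 = 0 := fun i => by rw [← pow_succ', h3]
  have h2 : ((2 : Fin 3) : ℕ) = 2 := rfl
  rcases i with i | i <;> fin_cases i <;>
    simp only [multiPow, Fin.isValue, Fin.zero_eta, Fin.mk_one] at h ⊢ <;> rw [h, h2]
  · simp only [mul_assoc, hc (Sum.inl 0), hc' (Sum.inl 0), hz]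
  · simp only [mul_assoc, hc (Sum.inl 1), hc' (Sum.inl 1), hz, mul_zero]
  · simp only [mul_assoc, hc (Sum.inr 0), hc' (Sum.inr 0), hz, mul_zero]
  · simp only [mul_assoc, hc (Sum.inr 1), hz', mul_zero]

/-- The truncated polynomial whose Taylor coefficients are obtained by applying monomials in the
operators `A i` and a functional `π`. -/
def jet (A : Fin 2 ⊕ Fin 2 → Module.End k V) (π : V →ₗ[k] k) : V →ₗ[k] Trunc 3 2 k :=
  ∑ b, (((fac b)⁻¹ : k) • (π ∘ₗ multiPow A b)).smulRight (tmon b)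

omit [CharP k 3] in
lemma tcoeff_jet (π : V →ₗ[k] k) (v : V) (b : Fin 2 ⊕ Fin 2 → Fin 3) :
    tcoeff b (jet A π v) = (fac b)⁻¹ * π (multiPow A b v) := by
  rw [jet, LinearMap.sum_apply]
  exact tcoeff_sum_tmon (fun b => (fac b)⁻¹ * π (multiPow A b v)) b

omit [CharP k 3] in
lemma tcoeff_zero_jet (π : V →ₗ[k] k) (v : V) : tcoeff 0 (jet A π v) = π v := by
  rw [tcoeff_jet, multiPow_zero]
  simp [fac]

/-- The series is `π (exp (∑ xᵢ Aᵢ) v)`, so differentiation inserts `A i`. Truncation does no harm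
because `A i ^ 3 = 0`: at exponent 2 both sides vanish. -/
lemma partialD_jet (hA : ∀ i j, Commute (A i) (A j)) (h3 : ∀ i, A i ^ 3 = 0) (π : V →ₗ[k] k)
    (i : Fin 2 ⊕ Fin 2) (v : V) : partialD 3 2 k i (jet A π v) = jet A π (A i v) := by
  refine ext_tcoeff fun b => ?_
  rw [tcoeff_jet, ← Module.End.mul_apply]
  by_cases h : b i = 2
  · rw [tcoeff_partialD_of_eq_two h, multiPow_mul_of_eq hA h3 h, LinearMap.zero_apply, map_zero,
      mul_zero]
  · have h1 : ((b i : ℕ) + 1 : k) ≠ 0 := fun h' => by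
      have := fac_update (k := k) h
      rw [h', zero_mul] at this
      exact fac_ne_zero _ this
    rw [tcoeff_partialD, tcoeff_jet, multiPow_mul_of_ne hA h, fac_update h]
    field_simp

end Jet

end Hamiltonian

end


noncomputable section

namespace Hamiltonian

open MvPolynomial

/-! ### Hamiltonian vector fields -/

section HamField

variable {k : Type*} [Field k] [CharP k 3]

/-- The derivation with given values at the variables. -/
def ofVals (f : Fin 2 ⊕ Fin 2 → Trunc 3 2 k) : Derivation k (Trunc 3 2 k) (Trunc 3 2 k) :=
  ∑ i, f i • partialD 3 2 k i

lemma ofVals_var (f : Fin 2 ⊕ Fin 2 → Trunc 3 2 k) (j : Fin 2 ⊕ Fin 2) :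
    ofVals f (var 3 2 k j) = f j := by
  rw [ofVals, sum_apply, Finset.sum_eq_single j]
  · simp [partialD_var]
  · intro i _ hi
    simp [partialD_var, hi]
  · simp

/-- The Hamiltonian vector field of a truncated polynomial. -/
def hamField : Trunc 3 2 k →ₗ[k] Derivation k (Trunc 3 2 k) (Trunc 3 2 k) where
  toFun h := ofVals fun j => sgn j • partialD 3 2 k j.swap h
  map_add' f g := derivation_ext 3 2 k fun j => by
    simp only [Derivation.add_apply, ofVals_var, map_add, smul_add]
  map_smul' c f := derivation_ext 3 2 k fun j => by
    rw [RingHom.id_apply, Derivation.smul_apply, ofVals_var, ofVals_var, Derivation.map_smul,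
      smul_comm]

lemma hamField_var (h : Trunc 3 2 k) (j : Fin 2 ⊕ Fin 2) :
    hamField h (var 3 2 k j) = sgn j • partialD 3 2 k j.swap h := ofVals_var _ j

lemma sgn_smul_sgn_smul {M : Type*} [AddCommGroup M] (j : Fin 2 ⊕ Fin 2) (x : M) :
    sgn j • sgn j • x = x := by
  rcases j with j | j <;> simp [sgn]

lemma hamField_mem (h : Trunc 3 2 k) : hamField h ∈ H 3 2 k := fun i j => by
  rw [hamField_var, hamField_var, Sum.swap_swap, Sum.swap_swap, map_zsmul, map_zsmul,
    sgn_smul_sgn_smul, sgn_smul_sgn_smul, partialD_comm]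

lemma partialD_mem (i : Fin 2 ⊕ Fin 2) : partialD 3 2 k i ∈ H 3 2 k := fun j l => by
  rw [partialD_var, partialD_var]
  split_ifs <;> simp

/-- The coefficients of the closed one-form corresponding to a derivation. -/
def oneForm (D : Derivation k (Trunc 3 2 k) (Trunc 3 2 k)) (j : Fin 2 ⊕ Fin 2) : Trunc 3 2 k :=
  sgn j.swap • D (var 3 2 k j.swap)

omit [CharP k 3] in
lemma apply_var_eq (D : Derivation k (Trunc 3 2 k) (Trunc 3 2 k)) (j : Fin 2 ⊕ Fin 2) :
    D (var 3 2 k j) = sgn j • oneForm D j.swap := by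
  rw [oneForm, Sum.swap_swap, sgn_smul_sgn_smul]

lemma partialD_oneForm {D : Derivation k (Trunc 3 2 k) (Trunc 3 2 k)} (hD : D ∈ H 3 2 k)
    (i j : Fin 2 ⊕ Fin 2) :
    partialD 3 2 k i (oneForm D j) = partialD 3 2 k j (oneForm D i) := by
  rw [oneForm, oneForm, map_zsmul, map_zsmul]
  exact hD i j

lemma oneForm_hamField (h : Trunc 3 2 k) (j : Fin 2 ⊕ Fin 2) :
    oneForm (hamField h) j = partialD 3 2 k j h := by
  rw [oneForm, hamField_var, sgn_smul_sgn_smul, Sum.swap_swap]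

omit [CharP k 3] in
lemma sum_swap {M : Type*} [AddCommMonoid M] (F : Fin 2 ⊕ Fin 2 → M) :
    ∑ l : Fin 2 ⊕ Fin 2, F l.swap = ∑ l, F l :=
  (Equiv.sumComm (Fin 2) (Fin 2)).sum_comp F

/-- The Poisson bracket of two closed one-forms. -/
def pairing (D E : Derivation k (Trunc 3 2 k) (Trunc 3 2 k)) : Trunc 3 2 k :=
  ∑ l, D (var 3 2 k l) * oneForm E l

/-- Cartan's formula: contracting the symplectic form with the bracket of two fields preserving it
gives the differential of its value on them. So brackets in `H` have exact one-forms, whereas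
elements of `H` only have closed ones. -/
lemma lie_eq_hamField {D E : Derivation k (Trunc 3 2 k) (Trunc 3 2 k)} (hD : D ∈ H 3 2 k)
    (hE : E ∈ H 3 2 k) : ⁅D, E⁆ = hamField (pairing D E) := by
  refine derivation_ext 3 2 k fun j => ?_
  have h : partialD 3 2 k j.swap (pairing D E) = D (oneForm E j.swap) - E (oneForm D j.swap) := by
    rw [pairing, map_sum, derivation_eq 3 2 k D (oneForm E j.swap),
      derivation_eq 3 2 k E (oneForm D j.swap),
      ← sum_swap (fun i => E (var 3 2 k i) * partialD 3 2 k i (oneForm D j.swap)),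
      ← Finset.sum_sub_distrib]
    refine Finset.sum_congr rfl fun l _ => ?_
    rw [Derivation.leibniz, smul_eq_mul, smul_eq_mul, apply_var_eq E, apply_var_eq D l, map_zsmul,
      Sum.swap_swap, partialD_oneForm hD j.swap, partialD_oneForm hE j.swap, sgn_swap,
      mul_smul_comm, neg_smul]
    simp only [zsmul_eq_mul]
    ring
  rw [hamField_var, h, smul_sub, Derivation.commutator_apply, apply_var_eq E j, apply_var_eq D j,
    map_zsmul, map_zsmul]

lemma pairing_hamField (D : Derivation k (Trunc 3 2 k) (Trunc 3 2 k)) (g : Trunc 3 2 k) :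
    pairing D (hamField g) = D g := by
  rw [pairing, derivation_eq 3 2 k D g]
  simp only [oneForm_hamField]

lemma lie_hamField {D : Derivation k (Trunc 3 2 k) (Trunc 3 2 k)} (hD : D ∈ H 3 2 k)
    (g : Trunc 3 2 k) : ⁅D, hamField g⁆ = hamField (D g) := by
  rw [lie_eq_hamField hD (hamField_mem g), pairing_hamField]

/-! ### The top coefficient -/

/-- The exponent of the top monomial. -/
def topExp : Fin 2 ⊕ Fin 2 → Fin 3 := fun _ => 2

lemma tcoeff_top_partialD (i : Fin 2 ⊕ Fin 2) (f : Trunc 3 2 k) :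
    tcoeff topExp (partialD 3 2 k i f) = 0 := tcoeff_partialD_of_eq_two rfl f

/-- The Euler operator. -/
def euler (f : Trunc 3 2 k) : Trunc 3 2 k := ∑ i, var 3 2 k i * partialD 3 2 k i f

/-- Use `xᵢ ∂ᵢ f = ∂ᵢ (xᵢ f) - f`: derivatives have no top coefficient, and there are four
variables. -/
lemma tcoeff_top_euler (f : Trunc 3 2 k) : tcoeff topExp (euler f) = -4 * tcoeff topExp f := by
  have h : euler f = ∑ i : Fin 2 ⊕ Fin 2, (partialD 3 2 k i (var 3 2 k i * f) - f) := by
    refine Finset.sum_congr rfl fun i _ => ?_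
    rw [Derivation.leibniz, partialD_var, if_pos rfl, smul_eq_mul, smul_eq_mul, mul_one,
      add_sub_cancel_right]
  rw [h, map_sum]
  simp only [map_sub, tcoeff_top_partialD]
  simp

lemma euler_pairing (D E : Derivation k (Trunc 3 2 k) (Trunc 3 2 k)) :
    euler (pairing D E) = ∑ l, sgn l • (euler (oneForm D l.swap) * oneForm E l) +
      ∑ l, sgn l • (oneForm D l.swap * euler (oneForm E l)) := by
  simp only [euler, pairing, map_sum, Finset.mul_sum, Finset.sum_mul, Finset.smul_sum]
  rw [Finset.sum_comm, ← Finset.sum_add_distrib]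
  refine Finset.sum_congr rfl fun l _ => ?_
  rw [← Finset.sum_add_distrib]
  refine Finset.sum_congr rfl fun i _ => ?_
  rw [apply_var_eq D, Derivation.leibniz, map_zsmul, smul_eq_mul, smul_eq_mul]
  simp only [zsmul_eq_mul]
  ring

/-- A primitive, up to the Euler operator, of a closed one-form. -/
lemma exists_partialD_eq {D : Derivation k (Trunc 3 2 k) (Trunc 3 2 k)} (hD : D ∈ H 3 2 k) :
    ∃ f, ∀ i, partialD 3 2 k i f = oneForm D i + euler (oneForm D i) := by
  -- The homotopy of the Poincaré lemma, contraction with the Euler field. On coefficients of degree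
  -- d it reproduces the form with the factor d + 1, which may vanish modulo three; a primitive of
  -- the form itself need not exist.
  refine ⟨∑ j, var 3 2 k j * oneForm D j, fun i => ?_⟩
  rw [map_sum, euler]
  have : oneForm D i = ∑ j, partialD 3 2 k i (var 3 2 k j) * oneForm D j := by
    rw [Finset.sum_eq_single i]
    · simp [partialD_var]
    · intro j _ hj
      simp [partialD_var, hj.symm]
    · simp
  conv_rhs => lhs; rw [this]
  rw [← Finset.sum_add_distrib]
  refine Finset.sum_congr rfl fun j _ => ?_
  rw [Derivation.leibniz, smul_eq_mul, smul_eq_mul, partialD_oneForm hD i j]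
  ring

/-- Elements of `H` are divergence free: exchanging an index with its partner reverses the sign,
while closedness preserves the derivative. So the sum equals its own negative. -/
lemma sum_sgn_partialD_oneForm {E : Derivation k (Trunc 3 2 k) (Trunc 3 2 k)} (hE : E ∈ H 3 2 k) :
    ∑ l, sgn l • partialD 3 2 k l.swap (oneForm E l) = 0 := by
  have h : ∑ l, sgn l • partialD 3 2 k l.swap (oneForm E l) =
      -∑ l, sgn l • partialD 3 2 k l.swap (oneForm E l) := by
    conv_lhs => rw [← sum_swap]
    rw [← Finset.sum_neg_distrib]
    refine Finset.sum_congr rfl fun l _ => ?_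
    rw [Sum.swap_swap, sgn_swap, neg_smul, partialD_oneForm hE]
  set S := ∑ l, sgn l • partialD 3 2 k l.swap (oneForm E l)
  have h2 : (2 : k) • S = 0 := by
    rw [two_smul]
    nth_rw 2 [h]
    exact add_neg_cancel S
  exact (smul_eq_zero.mp h2).resolve_left two_ne_zero'

/-- Integration by parts, with the top coefficient as the integral: the field of `E` is divergence
free, so the sum is a sum of derivatives. This is the case of `tcoeff_top_pairing` in which one of
the one-forms is exact. -/
lemma tcoeff_top_sum_partialD {E : Derivation k (Trunc 3 2 k) (Trunc 3 2 k)} (hE : E ∈ H 3 2 k)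
    (f : Trunc 3 2 k) :
    tcoeff topExp (∑ l, sgn l • (partialD 3 2 k l.swap f * oneForm E l)) = 0 := by
  have h : ∑ l, sgn l • (partialD 3 2 k l.swap f * oneForm E l) =
      ∑ l, sgn l • partialD 3 2 k l.swap (f * oneForm E l) -
        f * ∑ l, sgn l • partialD 3 2 k l.swap (oneForm E l) := by
    rw [Finset.mul_sum, ← Finset.sum_sub_distrib]
    refine Finset.sum_congr rfl fun l _ => ?_
    rw [Derivation.leibniz, smul_eq_mul, smul_eq_mul]
    simp only [zsmul_eq_mul]
    ring
  rw [h, sum_sgn_partialD_oneForm hE, mul_zero, sub_zero, map_sum]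
  simp only [map_zsmul, tcoeff_top_partialD, smul_zero, Finset.sum_const_zero]

/-- The one-forms need not be exact, but they become so on applying 1 + `euler`. Using
`tcoeff_top_sum_partialD` once for each argument shows that `2 • pairing D E + euler (pairing D E)`
has no top coefficient. By `tcoeff_top_euler` this coefficient is 2 - 4 times that of `pairing D E`,
and -2 is not zero. -/
lemma tcoeff_top_pairing {D E : Derivation k (Trunc 3 2 k) (Trunc 3 2 k)} (hD : D ∈ H 3 2 k)
    (hE : E ∈ H 3 2 k) : tcoeff topExp (pairing D E) = 0 := by
  obtain ⟨f, hf⟩ := exists_partialD_eq hD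
  obtain ⟨g, hg⟩ := exists_partialD_eq hE
  have h1 := tcoeff_top_sum_partialD hE f
  have h2 := tcoeff_top_sum_partialD hD g
  rw [← sum_swap] at h2
  simp only [hf, hg, Sum.swap_swap] at h1 h2
  have h3 : pairing D E = ∑ l, sgn l • (oneForm D l.swap * oneForm E l) :=
    Finset.sum_congr rfl fun l _ => by rw [apply_var_eq D, smul_mul_assoc]
  have h4 : (2 : k) • pairing D E + euler (pairing D E) =
      ∑ l, sgn l • ((oneForm D l.swap + euler (oneForm D l.swap)) * oneForm E l) -
      ∑ l : Fin 2 ⊕ Fin 2,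
        sgn l.swap • ((oneForm E l + euler (oneForm E l)) * oneForm D l.swap) := by
    rw [euler_pairing, two_smul, h3, ← Finset.sum_sub_distrib, ← Finset.sum_add_distrib,
      ← Finset.sum_add_distrib, ← Finset.sum_add_distrib]
    refine Finset.sum_congr rfl fun l _ => ?_
    rw [sgn_swap]
    simp only [zsmul_eq_mul]
    push_cast
    ring
  have h5 := congrArg (tcoeff topExp) h4
  rw [map_add, map_smul, map_sub, h1, h2, tcoeff_top_euler, smul_eq_mul] at h5
  have h6 : (2 : k) * tcoeff topExp (pairing D E) = 0 := by linear_combination -h5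
  exact (mul_eq_zero.mp h6).resolve_left two_ne_zero'

/-! ### The derived algebra -/

lemma tmon_eq_smul_partialD {b : Fin 2 ⊕ Fin 2 → Fin 3} {i : Fin 2 ⊕ Fin 2} (h : b i ≠ 2) :
    (tmon b : Trunc 3 2 k) =
      ((b i : ℕ) + 1 : k)⁻¹ • partialD 3 2 k i (tmon (Function.update b i (b i + 1))) := by
  have h1 : ((b i : ℕ) + 1 : k) ≠ 0 := fun h' => by
    have := fac_update (k := k) h
    rw [h', zero_mul] at this
    exact fac_ne_zero _ this
  refine ext_tcoeff fun c => ?_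
  rw [map_smul, tcoeff_partialD, tcoeff_tmon, tcoeff_tmon, smul_eq_mul]
  by_cases hc : c = b
  · subst hc
    rw [if_pos rfl, if_pos rfl, mul_one, inv_mul_cancel₀ h1]
  · rw [if_neg hc]
    by_cases hu : Function.update c i (c i + 1) = Function.update b i (b i + 1)
    · exfalso
      refine hc (funext fun j => ?_)
      have := congrFun hu j
      by_cases hj : j = i
      · subst hj
        simpa using this
      · simpa [Function.update_of_ne hj] using this
    · rw [if_neg hu]; simp

/-- A subspace which is stable under the derivatives and contains the derivatives of the top
monomial contains all other monomials. -/
lemma tmon_mem {J : Submodule k (Trunc 3 2 k)} (hJ : ∀ f ∈ J, ∀ i, partialD 3 2 k i f ∈ J)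
    (ht : ∀ i, tmon (Function.update topExp i 1) ∈ J) {b : Fin 2 ⊕ Fin 2 → Fin 3}
    (hb : b ≠ topExp) : tmon b ∈ J := by
  induction hn : ∑ i, (2 - (b i : ℕ)) generalizing b with
  | zero =>
    refine absurd (funext fun i => ?_) hb
    have h1 := Finset.sum_eq_zero_iff.mp hn i (Finset.mem_univ i)
    have h2 := (b i).2
    exact Fin.ext (show (b i : ℕ) = 2 by omega)
  | succ n ih =>
    obtain ⟨i, hi⟩ : ∃ i, b i ≠ 2 := by
      by_contra! hcon
      exact hb (funext hcon)
    -- Unless raising the exponent leads to the excluded top monomial, the monomial is a multiple of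
    -- the derivative of one closer to the top.
    by_cases h : Function.update b i (b i + 1) = topExp
    · have : b = Function.update topExp i 1 := by
        rw [← h, Function.update_idem]
        have h1 := congrFun h i
        rw [Function.update_self, topExp] at h1
        have h2 : b i = 1 := by revert h1; generalize b i = c; revert c; decide
        rw [← h2, Function.update_eq_self]
      rw [this]; exact ht i
    · rw [tmon_eq_smul_partialD hi]
      refine J.smul_mem _ (hJ _ (ih h ?_) i)
      rw [← Finset.add_sum_erase _ _ (Finset.mem_univ i)] at hn ⊢
      have h2 : ∑ j ∈ Finset.univ.erase i, (2 - (Function.update b i (b i + 1) j : ℕ)) =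
          ∑ j ∈ Finset.univ.erase i, (2 - (b j : ℕ)) :=
        Finset.sum_congr rfl fun j hj => by
          rw [Function.update_of_ne (Finset.ne_of_mem_erase hj)]
      rw [h2, Function.update_self]
      have h3 : ((b i + 1 : Fin 3) : ℕ) = b i + 1 := by
        revert hi; generalize b i = c; revert c; decide
      have h4 : (b i : ℕ) < 2 := by
        revert hi; generalize b i = c; revert c; decide
      omega

omit [CharP k 3] in
lemma mem_of_tmon_mem {J : Submodule k (Trunc 3 2 k)}
    (ht : ∀ b : Fin 2 ⊕ Fin 2 → Fin 3, b ≠ topExp → tmon b ∈ J) {f : Trunc 3 2 k}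
    (hf : tcoeff topExp f = 0) : f ∈ J := by
  rw [← sum_tcoeff_tmon f]
  refine sum_mem fun b _ => ?_
  by_cases h : b = topExp
  · rw [h, hf, zero_smul]; exact J.zero_mem
  · exact J.smul_mem _ (ht b h)

omit [CharP k 3] in
lemma derivedSeries_succ_eq_span {L : Type*} [LieRing L] [LieAlgebra k L] (n : ℕ) :
    (LieAlgebra.derivedSeries k L (n + 1)).toSubmodule =
      Submodule.span k {⁅x, y⁆ | (x ∈ LieAlgebra.derivedSeries k L n)
        (y ∈ LieAlgebra.derivedSeries k L n)} := by
  rw [LieAlgebra.derivedSeries_def, LieAlgebra.derivedSeriesOfIdeal_succ,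
    LieSubmodule.lieIdeal_oper_eq_linear_span']

end HamField

end Hamiltonian

end


/-! ### The derived Hamiltonian algebra: description, perfectness, normaliser -/

noncomputable section

namespace Hamiltonian

open MvPolynomial

section Derived

variable {k : Type*} [Field k] [CharP k 3]

section Bracket

variable (D E F : Derivation k (Trunc 3 2 k) (Trunc 3 2 k))

omit [CharP k 3] in
lemma der_add_lie : ⁅D + E, F⁆ = ⁅D, F⁆ + ⁅E, F⁆ := add_lie D E F

omit [CharP k 3] in
lemma der_lie_add : ⁅D, E + F⁆ = ⁅D, E⁆ + ⁅D, F⁆ := lie_add D E F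

omit [CharP k 3] in
lemma der_zero_lie : ⁅(0 : Derivation k (Trunc 3 2 k) (Trunc 3 2 k)), F⁆ = 0 := by
  ext f; simp [Derivation.commutator_apply]

omit [CharP k 3] in
lemma der_lie_zero : ⁅D, (0 : Derivation k (Trunc 3 2 k) (Trunc 3 2 k))⁆ = 0 := by
  ext f; simp [Derivation.commutator_apply]

omit [CharP k 3] in
lemma der_smul_lie (c : k) : ⁅c • D, F⁆ = c • ⁅D, F⁆ := smul_lie c D F

omit [CharP k 3] in
lemma der_lie_smul (c : k) : ⁅D, c • F⁆ = c • ⁅D, F⁆ := lie_smul c D F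

omit [CharP k 3] in
lemma der_lie_lie : ⁅⁅D, E⁆, F⁆ = ⁅D, ⁅E, F⁆⁆ - ⁅E, ⁅D, F⁆⁆ := lie_lie D E F

omit [CharP k 3] in
lemma der_leibniz : ⁅D, ⁅E, F⁆⁆ = ⁅E, ⁅D, F⁆⁆ - ⁅F, ⁅D, E⁆⁆ := by
  ext f; simp only [Derivation.commutator_apply, Derivation.sub_apply, map_sub]; abel

end Bracket

omit [CharP k 3] in
lemma tcoeff_top_var (i : Fin 2 ⊕ Fin 2) : tcoeff topExp (var 3 2 k i) = 0 := by
  rw [var, tcoeff_mk, coeff_X, if_neg]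
  intro h
  obtain ⟨l, h1⟩ : ∃ l, i ≠ l := by
    clear h; revert i; decide
  have := DFunLike.congr_fun h l
  simp [Finsupp.single_eq_of_ne' h1, topExp] at this

-- Two factors cannot involve all four variables. Hence the fields of quadratic monomials, which
-- span 𝔰𝔭₄, belong to the derived algebra.
omit [CharP k 3] in
lemma tcoeff_top_var_mul_var (i j : Fin 2 ⊕ Fin 2) :
    tcoeff topExp (var 3 2 k i * var 3 2 k j) = 0 := by
  rw [var, var, ← map_mul, tcoeff_mk, X, X, monomial_mul, coeff_monomial, if_neg]
  intro h
  obtain ⟨l, h1, h2⟩ : ∃ l, i ≠ l ∧ j ≠ l := by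
    clear h; revert i j; decide
  have := DFunLike.congr_fun h l
  simp [Finsupp.single_eq_of_ne' h1, Finsupp.single_eq_of_ne' h2, topExp] at this

lemma var_mul_partialD_tmon (b : Fin 2 ⊕ Fin 2 → Fin 3) (i : Fin 2 ⊕ Fin 2) :
    var 3 2 k i * partialD 3 2 k i (tmon b) = ((b i : ℕ) : k) • tmon b := by
  rw [tmon, partialD_mk, var, ← map_mul, X_mul_pderiv_monomial, expo_apply, map_nsmul,
    Nat.cast_smul_eq_nsmul]

lemma hamField_var_eq (i : Fin 2 ⊕ Fin 2) :
    hamField (var 3 2 k i) = sgn i.swap • partialD 3 2 k i.swap := by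
  refine derivation_ext 3 2 k fun j => ?_
  rw [hamField_var, Derivation.smul_apply, partialD_var, partialD_var]
  by_cases h : j = i.swap
  · subst h; simp
  · rw [if_neg (fun h' => h (by rw [← h', Sum.swap_swap])), if_neg (Ne.symm h)]
    simp

lemma partialD_eq_hamField (i : Fin 2 ⊕ Fin 2) :
    partialD 3 2 k i = hamField (sgn i • var 3 2 k i.swap) := by
  rw [map_zsmul, hamField_var_eq, Sum.swap_swap, sgn_smul_sgn_smul]

lemma hamField_var_mul_var (i j : Fin 2 ⊕ Fin 2) (g : Trunc 3 2 k) :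
    hamField (var 3 2 k i * var 3 2 k j) g = sgn i.swap • (var 3 2 k j * partialD 3 2 k i.swap g) +
      sgn j.swap • (var 3 2 k i * partialD 3 2 k j.swap g) := by
  have h : hamField (var 3 2 k i * var 3 2 k j) =
      var 3 2 k j • hamField (var 3 2 k i) + var 3 2 k i • hamField (var 3 2 k j) := by
    refine derivation_ext 3 2 k fun l => ?_
    simp only [Derivation.add_apply, Derivation.smul_apply, hamField_var, Derivation.leibniz,
      smul_eq_mul, smul_add, mul_smul_comm]
    rw [add_comm]
  rw [h, hamField_var_eq, hamField_var_eq]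
  simp only [Derivation.add_apply, Derivation.smul_apply, smul_eq_mul, mul_smul_comm]

/-- Hamiltonian vector fields as elements of the Hamiltonian algebra. -/
def hamH : Trunc 3 2 k →ₗ[k] H 3 2 k := LinearMap.codRestrict (H 3 2 k).toSubmodule hamField
  hamField_mem

lemma coe_hamH (f : Trunc 3 2 k) : (hamH f : Derivation k (Trunc 3 2 k) (Trunc 3 2 k)) =
    hamField f := rfl

lemma hamH_lie_hamH (f g : Trunc 3 2 k) : ⁅hamH f, hamH g⁆ = hamH (hamField f g) :=
  Subtype.ext (lie_hamField (hamField_mem f) g)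

/-- A subspace containing all brackets of Hamiltonian vector fields of polynomials without top
coefficient contains all such vector fields. -/
lemma hamH_mem_of_lie_mem {S : Submodule k (H 3 2 k)}
    (hS : ∀ f g : Trunc 3 2 k, tcoeff topExp f = 0 → tcoeff topExp g = 0 → ⁅hamH f, hamH g⁆ ∈ S)
    {f : Trunc 3 2 k} (hf : tcoeff topExp f = 0) : hamH f ∈ S := by
  refine mem_of_tmon_mem (J := S.comap hamH) (fun b hb => ?_) hf
  rw [Submodule.mem_comap]
  by_cases h : ∃ i, b i ≠ 2 ∧ Function.update b i (b i + 1) ≠ topExp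
  · obtain ⟨i, hi, hu⟩ := h
    have h1 := hS (sgn i • var 3 2 k i.swap) (tmon (Function.update b i (b i + 1)))
      (by rw [map_zsmul, tcoeff_top_var, smul_zero]) (by rw [tcoeff_tmon, if_neg hu.symm])
    rw [hamH_lie_hamH, ← partialD_eq_hamField] at h1
    rw [tmon_eq_smul_partialD hi, map_smul]
    exact S.smul_mem _ h1
  -- What remains are the first derivatives of the top monomial, which cannot be obtained by
  -- differentiation since the top monomial is excluded. They are eigenvectors of the field of the
  -- product of `x_i` and its partner, with eigenvalue ±(1 - 2).
  · push Not at h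
    obtain ⟨i, hi⟩ : ∃ i, b i ≠ 2 := by
      by_contra! hcon
      exact hb (funext hcon)
    have h1 := congrFun (h i hi) i
    rw [Function.update_self, topExp] at h1
    have h2 : b i = 1 := by revert h1; generalize b i = c; revert c; decide
    have h3 : b i.swap = 2 := by
      have h4 := congrFun (h i hi) i.swap
      rwa [Function.update_of_ne (show i.swap ≠ i by clear * -; revert i; decide)] at h4
    have h5 := hS (var 3 2 k i * var 3 2 k i.swap) (tmon b) (tcoeff_top_var_mul_var _ _)
      (by rw [tcoeff_tmon, if_neg hb.symm])
    rw [hamH_lie_hamH, hamField_var_mul_var, Sum.swap_swap, var_mul_partialD_tmon,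
      var_mul_partialD_tmon, h2, h3, sgn_swap, neg_smul, neg_add_eq_sub, ← smul_sub, ← sub_smul,
      map_zsmul, map_smul] at h5
    have h7 : (((1 : Fin 3) : ℕ) : k) - (((2 : Fin 3) : ℕ) : k) = -1 := by
      rw [show ((1 : Fin 3) : ℕ) = 1 from rfl, show ((2 : Fin 3) : ℕ) = 2 from rfl]
      push_cast; ring
    rw [h7, neg_one_smul] at h5
    have h8 := S.neg_mem (zsmul_mem h5 (sgn i))
    rwa [sgn_smul_sgn_smul, neg_neg] at h8

/-- Brackets in `H` are Hamiltonian fields of functions without top coefficient by `lie_eq_hamField`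
and `tcoeff_top_pairing`; the converse uses only brackets of such fields, which is also why the
derived algebra is perfect. -/
lemma mem_derivedSeries_one {D : H 3 2 k} :
    D ∈ LieAlgebra.derivedSeries k (H 3 2 k) 1 ↔ ∃ f : Trunc 3 2 k, tcoeff topExp f = 0 ∧ hamH f = D := by
  rw [← LieSubmodule.mem_toSubmodule, derivedSeries_succ_eq_span]
  constructor
  · intro h
    have : Submodule.span k {⁅x, y⁆ | (x ∈ LieAlgebra.derivedSeries k (H 3 2 k) 0)
        (y ∈ LieAlgebra.derivedSeries k (H 3 2 k) 0)} ≤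
        (LinearMap.ker (tcoeff (k := k) topExp)).map hamH := by
      rw [Submodule.span_le]
      rintro _ ⟨x, -, y, -, rfl⟩
      exact ⟨pairing x.1 y.1, tcoeff_top_pairing x.2 y.2,
        Subtype.ext (lie_eq_hamField x.2 y.2).symm⟩
    exact this h
  · rintro ⟨f, hf, rfl⟩
    refine hamH_mem_of_lie_mem (fun f g _ _ => ?_) hf
    exact Submodule.subset_span ⟨hamH f, LieSubmodule.mem_top _, hamH g, LieSubmodule.mem_top _, rfl⟩

/-- The derived algebra of the Hamiltonian algebra is perfect. -/
lemma mem_span_of_mem_derivedSeries {D : H 3 2 k}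
    (hD : D ∈ LieAlgebra.derivedSeries k (H 3 2 k) 1) :
    D ∈ Submodule.span k {⁅x, y⁆ | (x ∈ LieAlgebra.derivedSeries k (H 3 2 k) 1)
      (y ∈ LieAlgebra.derivedSeries k (H 3 2 k) 1)} := by
  obtain ⟨f, hf, rfl⟩ := mem_derivedSeries_one.mp hD
  refine hamH_mem_of_lie_mem (fun f g hf hg => ?_) hf
  exact Submodule.subset_span ⟨hamH f, mem_derivedSeries_one.mpr ⟨f, hf, rfl⟩,
      hamH g, mem_derivedSeries_one.mpr ⟨g, hg, rfl⟩, rfl⟩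

/-- Only zero commutes with all Hamiltonian vector fields of polynomials without top term. -/
lemma eq_zero_of_lie_hamField {E : Derivation k (Trunc 3 2 k) (Trunc 3 2 k)}
    (hE : ∀ f : Trunc 3 2 k, tcoeff topExp f = 0 → ⁅E, hamField f⁆ = 0) : E = 0 := by
  -- Commuting with the fields `∂ᵢ` makes the coefficients of `E` constant.
  have h1 : ∀ i j, partialD 3 2 k i (E (var 3 2 k j)) = 0 := fun i j => by
    have h := congrArg (fun D : Derivation k (Trunc 3 2 k) (Trunc 3 2 k) => D (var 3 2 k j))
      (hE (sgn i • var 3 2 k i.swap) (by rw [map_zsmul, tcoeff_top_var, smul_zero]))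
    simp only [← partialD_eq_hamField, Derivation.commutator_apply, partialD_var,
      Derivation.coe_zero, Pi.zero_apply] at h
    have h2 : E (if i = j then 1 else 0) = 0 := by split_ifs <;> simp
    rw [h2, zero_sub, neg_eq_zero] at h
    exact h
  refine derivation_ext 3 2 k fun j => ?_
  -- The field of the product of `x_j` and its partner multiplies `x_j` by a sign and kills
  -- constants, so commuting with it removes the constant coefficient.
  have h := congrArg (fun D : Derivation k (Trunc 3 2 k) (Trunc 3 2 k) => D (var 3 2 k j))
    (hE _ (tcoeff_top_var_mul_var j j.swap))
  simp only [Derivation.commutator_apply, hamField_var_mul_var, h1, Sum.swap_swap, partialD_var,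
    Derivation.coe_zero, Pi.zero_apply, mul_zero, smul_zero, add_zero, sub_zero] at h
  have h2 : j.swap ≠ j := by clear * -; revert j; decide
  rw [if_neg h2, mul_zero, smul_zero, zero_add, if_pos trivial, mul_one, map_zsmul] at h
  rw [← sgn_smul_sgn_smul j (E (var 3 2 k j)), h, smul_zero]
  rfl

variable (k) in
/-- The derivations which normalise the derived Hamiltonian algebra. -/
def derivedNormalizer : LieSubalgebra k (Derivation k (Trunc 3 2 k) (Trunc 3 2 k)) where
  carrier := {D | ∀ f : Trunc 3 2 k, tcoeff topExp f = 0 → ∃ g : Trunc 3 2 k, tcoeff topExp g = 0 ∧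
    hamField g = ⁅D, hamField f⁆}
  zero_mem' := fun f _ => ⟨0, map_zero _, by rw [der_zero_lie, map_zero]⟩
  add_mem' := fun {D E} hD hE f hf => by
    obtain ⟨g, hg, h1⟩ := hD f hf
    obtain ⟨g', hg', h2⟩ := hE f hf
    exact ⟨g + g', by rw [map_add, hg, hg', add_zero], by rw [map_add, h1, h2, der_add_lie]⟩
  smul_mem' := fun c D hD f hf => by
    obtain ⟨g, hg, h1⟩ := hD f hf
    exact ⟨c • g, by rw [map_smul, hg, smul_zero], by rw [map_smul, h1, der_smul_lie]⟩
  lie_mem' := fun {D E} hD hE f hf => by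
    obtain ⟨g, hg, h1⟩ := hE f hf
    obtain ⟨g', hg', h2⟩ := hD g hg
    obtain ⟨q, hq, h3⟩ := hD f hf
    obtain ⟨q', hq', h4⟩ := hE q hq
    exact ⟨g' - q', by rw [map_sub, hg', hq', sub_zero],
      by rw [map_sub, h2, h4, h1, h3, der_lie_lie]⟩

lemma exists_derived_lie {D : Derivation k (Trunc 3 2 k) (Trunc 3 2 k)}
    (hD : D ∈ derivedNormalizer k) (A : HDerived 3 2 k) :
    ⁅D, (A : H 3 2 k).1⁆ ∈ H 3 2 k ∧ ∀ h : ⁅D, (A : H 3 2 k).1⁆ ∈ H 3 2 k,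
      (⟨_, h⟩ : H 3 2 k) ∈ LieAlgebra.derivedSeries k (H 3 2 k) 1 := by
  obtain ⟨f, hf, hA⟩ := mem_derivedSeries_one.mp A.2
  obtain ⟨g, hg, h⟩ := hD f hf
  rw [← hA, coe_hamH, ← h]
  exact ⟨hamField_mem g, fun _ => mem_derivedSeries_one.mpr ⟨g, hg, rfl⟩⟩

variable (k) in
/-- The action of the normaliser on the derived Hamiltonian algebra. -/
def toLieDerivation : derivedNormalizer k →ₗ⁅k⁆
    LieDerivation k (HDerived 3 2 k) (HDerived 3 2 k) where
  toFun D :=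
    { toFun := fun A => ⟨⟨⁅D.1, (A : H 3 2 k).1⁆, (exists_derived_lie D.2 A).1⟩,
        (exists_derived_lie D.2 A).2 _⟩
      map_add' := fun A B => Subtype.ext (Subtype.ext (der_lie_add D.1 _ _))
      map_smul' := fun c A => Subtype.ext (Subtype.ext (der_lie_smul D.1 _ c))
      leibniz' := fun A B => Subtype.ext (Subtype.ext (by
        change ⁅D.1, ⁅(A : H 3 2 k).1, (B : H 3 2 k).1⁆⁆ =
          ⁅(A : H 3 2 k).1, ⁅D.1, (B : H 3 2 k).1⁆⁆ - ⁅(B : H 3 2 k).1, ⁅D.1, (A : H 3 2 k).1⁆⁆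
        exact der_leibniz _ _ _)) }
  map_add' := fun D E => LieDerivation.ext fun A => Subtype.ext (Subtype.ext (der_add_lie D.1 E.1 _))
  map_smul' := fun c D => LieDerivation.ext fun A => Subtype.ext (Subtype.ext (der_smul_lie D.1 _ c))
  map_lie' := fun {D E} => LieDerivation.ext fun A => Subtype.ext (Subtype.ext (der_lie_lie D.1 E.1 _))

lemma eq_zero_of_toLieDerivation {D : derivedNormalizer k} (h : toLieDerivation k D = 0) :
    D = 0 := by
  refine Subtype.ext (eq_zero_of_lie_hamField fun f hf => ?_)
  have h1 := congrArg (fun F => F (⟨hamH f, mem_derivedSeries_one.mpr ⟨f, hf, rfl⟩⟩ :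
    HDerived 3 2 k)) h
  exact congrArg (fun A : HDerived 3 2 k => A.1.1) h1

/-! ### Algebras between the derived Hamiltonian algebra and the Hamiltonian algebra -/

variable {L : Type*} [LieRing L] [LieAlgebra k L]

/-- As `H^{(1)}` is perfect, its elements are sums of brackets of elements that already have
preimages in the previous derived term. -/
lemma mem_derivedSeries_image {ψ : L →ₗ⁅k⁆ H 3 2 k}
    (h2 : ∀ y ∈ LieAlgebra.derivedSeries k (H 3 2 k) 1, ∃ z, ψ z = y) (n : ℕ) :
    ∀ y ∈ LieAlgebra.derivedSeries k (H 3 2 k) 1, ∃ z ∈ LieAlgebra.derivedSeries k L n, ψ z = y := by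
  induction n with
  | zero =>
    intro y hy
    obtain ⟨z, hz⟩ := h2 y hy
    exact ⟨z, LieSubmodule.mem_top _, hz⟩
  | succ n ih =>
    intro y hy
    have h3 : Submodule.span k {⁅x, y⁆ | (x ∈ LieAlgebra.derivedSeries k (H 3 2 k) 1)
        (y ∈ LieAlgebra.derivedSeries k (H 3 2 k) 1)} ≤
        (LieAlgebra.derivedSeries k L (n + 1)).toSubmodule.map (ψ : L →ₗ[k] H 3 2 k) := by
      rw [Submodule.span_le]
      rintro _ ⟨x, hx, y, hy, rfl⟩
      obtain ⟨x, hx', rfl⟩ := ih x hx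
      obtain ⟨y, hy', rfl⟩ := ih y hy
      refine ⟨⁅x, y⁆, ?_, ψ.map_lie x y⟩
      rw [derivedSeries_succ_eq_span]
      exact Submodule.subset_span ⟨x, hx', y, hy', rfl⟩
    obtain ⟨z, hz, h⟩ := h3 (mem_span_of_mem_derivedSeries hy)
    exact ⟨z, hz, h⟩

/-- The first derived algebra is already sent into `H^{(1)}`, and the second is contained in it. -/
lemma map_mem_derivedSeries (ψ : L →ₗ⁅k⁆ H 3 2 k) {z : L}
    (hz : z ∈ LieAlgebra.derivedSeries k L 2) :
    ψ z ∈ LieAlgebra.derivedSeries k (H 3 2 k) 1 := by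
  have h1 : z ∈ LieAlgebra.derivedSeries k L 1 :=
    LieAlgebra.derivedSeriesOfIdeal_antitone (I := ⊤) (show 1 ≤ 2 by norm_num) hz
  exact LieIdeal.derivedSeries_map_le (f := ψ) 1 (LieIdeal.mem_map h1)

/-- The second derived algebra of an algebra between the derived Hamiltonian algebra and the
Hamiltonian algebra is the derived Hamiltonian algebra. -/
lemma nonempty_derivedSeries_equiv {ψ : L →ₗ⁅k⁆ H 3 2 k} (h1 : Function.Injective ψ)
    (h2 : ∀ y ∈ LieAlgebra.derivedSeries k (H 3 2 k) 1, ∃ z, ψ z = y) :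
    Nonempty (LieAlgebra.derivedSeries k L 2 ≃ₗ⁅k⁆ HDerived 3 2 k) := by
  let χ : LieAlgebra.derivedSeries k L 2 →ₗ⁅k⁆ HDerived 3 2 k :=
    { toFun := fun z => ⟨ψ z.1, map_mem_derivedSeries ψ z.2⟩
      map_add' := fun x y => Subtype.ext (map_add ψ x.1 y.1)
      map_smul' := fun c x => Subtype.ext (map_smul ψ c x.1)
      map_lie' := fun {x y} => Subtype.ext (ψ.map_lie x.1 y.1) }
  refine ⟨LieEquiv.ofBijective χ ⟨fun x y h => ?_, fun y => ?_⟩⟩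
  · exact Subtype.ext (h1 (congrArg (fun A : HDerived 3 2 k => A.1) h))
  · obtain ⟨z, hz, h⟩ := mem_derivedSeries_image h2 2 y.1 y.2
    exact ⟨⟨z, hz⟩, Subtype.ext h⟩

end Derived

end Hamiltonian

end


/-! ### Frames and the Taylor embedding of the normaliser of a line -/

noncomputable section

namespace LieLine

variable {k L : Type*} [CommRing k] [LieRing L] [LieAlgebra k L]

lemma mem_centralizer {e y : L} : y ∈ centralizer (k := k) e ↔ ⁅y, e⁆ = 0 := Iff.rfl

lemma mem_normalizer {e y : L} : y ∈ normalizer (k := k) e ↔ ∃ c : k, ⁅y, e⁆ = c • e := by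
  rw [normalizer, LieSubalgebra.mem_normalizer_iff]
  constructor
  · intro h
    obtain ⟨c, hc⟩ := Submodule.mem_span_singleton.mp (h e (Submodule.mem_span_singleton_self e))
    exact ⟨c, hc.symm⟩
  · rintro ⟨c, hc⟩ z hz
    obtain ⟨d, rfl⟩ := Submodule.mem_span_singleton.mp hz
    rw [lie_smul, hc, smul_comm]
    exact Submodule.mem_span_singleton.mpr ⟨c * d, by rw [mul_smul]⟩

/-- The centraliser is an ideal of the normaliser, since `e` is an eigenvector of every element
normalising the line. -/
lemma lie_mem_centralizer {e y z : L} (hy : y ∈ normalizer (k := k) e)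
    (hz : z ∈ centralizer (k := k) e) : ⁅y, z⁆ ∈ centralizer (k := k) e := by
  obtain ⟨c, hc⟩ := mem_normalizer.mp hy
  rw [mem_centralizer] at hz ⊢
  rw [lie_lie, hz, hc, lie_smul, hz, smul_zero, lie_zero, sub_zero]

end LieLine

namespace Hamiltonian

open LieLine

/-- Data on a Lie algebra from which an embedding of the normaliser of a line into the derivations
of a truncated polynomial ring is constructed. -/
structure Frame (k L : Type*) [Field k] [LieRing L] [LieAlgebra k L] where
  /-- The element spanning the line. -/
  e : L
  /-- Elements which become the partial derivatives. -/
  X : Fin 2 ⊕ Fin 2 → L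
  /-- Functionals dual to the elements `X`. -/
  π : Fin 2 ⊕ Fin 2 → L →ₗ[k] k
  /-- A partial inverse of `ad e`. -/
  R₀ : L →ₗ[k] L
  /-- Partial inverses of `ad (X i)`. -/
  R : Fin 2 ⊕ Fin 2 → L →ₗ[k] L
  /-- The coefficient of `e`. -/
  ρ : L →ₗ[k] k
  /-- A subalgebra complementary to the span of the `X i`. -/
  N : LieSubalgebra k L
  lie_e : ∀ i, ⁅X i, e⁆ = 0
  lie_X : ∀ i j, ⁅X i, X j⁆ = 0
  cube : ∀ i (y : L), ⁅X i, ⁅X i, ⁅X i, y⁆⁆⁆ = 0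
  -- A certificate of transitivity: an element commuting with `e` and all `X i` lies in the span of
  -- `e` and the `X i`. The operators turn this into a linear identity that can be verified on a
  -- basis.
  decomp : ∀ y : L, R₀ ⁅e, y⁆ + ∑ i, R i ⁅X i, y⁆ + ρ y • e + ∑ i, π i y • X i = y
  R₀_e : R₀ e = 0
  R_e : ∀ i, R i e = 0
  R_mem : ∀ i (y : L), R i y ∈ N
  e_mem : e ∈ N
  π_of_mem : ∀ i, ∀ y ∈ N, π i y = 0
  π_X : ∀ i j, π i (X j) = if i = j then 1 else 0
  -- The constant terms of the equations that define `H`.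
  symplectic : ∀ y : L, ⁅e, y⁆ = 0 → ∀ i j : Fin 2 ⊕ Fin 2,
    sgn j.swap • π j.swap ⁅X i, y⁆ = sgn i.swap • π i.swap ⁅X j, y⁆

namespace Frame

set_option maxRecDepth 4000

variable {k L : Type*} [Field k] [CharP k 3] [LieRing L] [LieAlgebra k L] (F : Frame k L)

/-- The operators `ad (X i)`. -/
def A (i : Fin 2 ⊕ Fin 2) : Module.End k L := LieAlgebra.ad k L (F.X i)

omit [CharP k 3] in
lemma A_apply (i : Fin 2 ⊕ Fin 2) (y : L) : F.A i y = ⁅F.X i, y⁆ := rfl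

omit [CharP k 3] in
lemma lie_X_comm (i j : Fin 2 ⊕ Fin 2) (y : L) : ⁅F.X i, ⁅F.X j, y⁆⁆ = ⁅F.X j, ⁅F.X i, y⁆⁆ := by
  rw [leibniz_lie, F.lie_X, zero_lie, zero_add]

omit [CharP k 3] in
lemma commute (i j : Fin 2 ⊕ Fin 2) : Commute (F.A i) (F.A j) :=
  LinearMap.ext fun y => F.lie_X_comm i j y

omit [CharP k 3] in
lemma A_cube (i : Fin 2 ⊕ Fin 2) : F.A i ^ 3 = 0 := LinearMap.ext fun y => F.cube i y

/-- The embedding into derivations. -/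
def toDer : L →ₗ[k] Derivation k (Trunc 3 2 k) (Trunc 3 2 k) where
  toFun y := ofVals fun j => jet F.A (F.π j) y
  map_add' y z := derivation_ext 3 2 k fun j => by
    rw [Derivation.add_apply, ofVals_var, ofVals_var, ofVals_var, map_add]
  map_smul' c y := derivation_ext 3 2 k fun j => by
    rw [RingHom.id_apply, Derivation.smul_apply, ofVals_var, ofVals_var, map_smul]

lemma toDer_var (y : L) (j : Fin 2 ⊕ Fin 2) :
    F.toDer y (var 3 2 k j) = jet F.A (F.π j) y := by
  change ofVals _ (var 3 2 k j) = _
  rw [ofVals_var]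

lemma partialD_toDer_var (y : L) (i j : Fin 2 ⊕ Fin 2) :
    partialD 3 2 k i (F.toDer y (var 3 2 k j)) = F.toDer ⁅F.X i, y⁆ (var 3 2 k j) := by
  rw [toDer_var, toDer_var, partialD_jet F.commute F.A_cube, A_apply]

lemma lie_partialD_apply_var (D : Derivation k (Trunc 3 2 k) (Trunc 3 2 k))
    (i j : Fin 2 ⊕ Fin 2) :
    ⁅partialD 3 2 k i, D⁆ (var 3 2 k j) = partialD 3 2 k i (D (var 3 2 k j)) := by
  rw [Derivation.commutator_apply, partialD_var]
  split_ifs <;> simp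

lemma toDer_lie_X (y : L) (i : Fin 2 ⊕ Fin 2) :
    F.toDer ⁅F.X i, y⁆ = ⁅partialD 3 2 k i, F.toDer y⁆ := derivation_ext 3 2 k fun j => by
  rw [lie_partialD_apply_var, partialD_toDer_var]

lemma tcoeff_zero_toDer (y : L) (j : Fin 2 ⊕ Fin 2) :
    tcoeff 0 (F.toDer y (var 3 2 k j)) = F.π j y := by
  rw [toDer_var, tcoeff_zero_jet]

omit [CharP k 3] in
lemma X_mem_centralizer (i : Fin 2 ⊕ Fin 2) : F.X i ∈ centralizer (k := k) F.e := F.lie_e i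

omit [CharP k 3] in
lemma lie_X_mem {y : L} (hy : y ∈ normalizer (k := k) F.e) (i : Fin 2 ⊕ Fin 2) :
    ⁅F.X i, y⁆ ∈ normalizer (k := k) F.e :=
  (normalizer (k := k) F.e).lie_mem (centralizer_le_normalizer _ (F.X_mem_centralizer i)) hy

omit [CharP k 3] in
lemma R₀_lie {y : L} (hy : y ∈ normalizer (k := k) F.e) : F.R₀ ⁅F.e, y⁆ = 0 := by
  obtain ⟨c, hc⟩ := mem_normalizer.mp hy
  rw [← lie_skew, hc, map_neg, map_smul, F.R₀_e, smul_zero, neg_zero]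

omit [CharP k 3] in
/-- An element of the normaliser is a combination of the `X i` up to an element of `N`. -/
lemma exists_decomp {y : L} (hy : y ∈ normalizer (k := k) F.e) :
    ∃ y₀ ∈ F.N, y = y₀ + ∑ i, F.π i y • F.X i := by
  refine ⟨F.R₀ ⁅F.e, y⁆ + ∑ i, F.R i ⁅F.X i, y⁆ + F.ρ y • F.e, ?_, (F.decomp y).symm⟩
  rw [F.R₀_lie hy, zero_add]
  exact add_mem (sum_mem fun i _ => F.R_mem i _) (F.N.smul_mem _ F.e_mem)

-- Modulo `N` both elements are combinations of the `X i`. These commute, and `N` is a subalgebra on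
-- which the functionals vanish, so only the mixed brackets contribute. The result matches
-- `tcoeff_zero_apply_apply`.
omit [CharP k 3] in
lemma π_lie {y z : L} (hy : y ∈ normalizer (k := k) F.e) (hz : z ∈ normalizer (k := k) F.e)
    (j : Fin 2 ⊕ Fin 2) : F.π j ⁅y, z⁆ =
      ∑ l, F.π l y * F.π j ⁅F.X l, z⁆ - ∑ l, F.π l z * F.π j ⁅F.X l, y⁆ := by
  obtain ⟨y₀, hy₀, h1⟩ := F.exists_decomp hy
  obtain ⟨z₀, hz₀, h2⟩ := F.exists_decomp hz
  have h3 : ⁅y, z⁆ = ⁅y₀, z₀⁆ + ∑ l, F.π l y • ⁅F.X l, z⁆ - ∑ l, F.π l z • ⁅F.X l, y⁆ := by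
    have h4 : ∀ l, ⁅F.X l, y⁆ = ⁅F.X l, y₀⁆ := fun l => by
      conv_lhs => rw [h1]
      rw [lie_add, lie_sum]
      simp only [lie_smul, F.lie_X, smul_zero, Finset.sum_const_zero, add_zero]
    have h5 : ⁅y₀, z⁆ = ⁅y₀, z₀⁆ - ∑ l, F.π l z • ⁅F.X l, y⁆ := by
      conv_lhs => rw [h2]
      rw [lie_add, lie_sum, sub_eq_add_neg, ← Finset.sum_neg_distrib]
      congr 1
      refine Finset.sum_congr rfl fun l _ => ?_
      rw [lie_smul, h4, ← lie_skew, smul_neg]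
    conv_lhs => rw [h1]
    rw [add_lie, h5, sum_lie]
    simp only [smul_lie]
    abel
  rw [h3, map_sub, map_add, F.π_of_mem j _ (F.N.lie_mem hy₀ hz₀), zero_add, map_sum, map_sum]
  simp only [map_smul, smul_eq_mul]

lemma tcoeff_zero_apply_apply (y z : L) (j : Fin 2 ⊕ Fin 2) :
    tcoeff 0 (F.toDer y (F.toDer z (var 3 2 k j))) = ∑ l, F.π l y * F.π j ⁅F.X l, z⁆ := by
  rw [derivation_eq 3 2 k (F.toDer y), map_sum]
  refine Finset.sum_congr rfl fun l _ => ?_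
  rw [tcoeff_zero_mul, tcoeff_zero_toDer, partialD_toDer_var, tcoeff_zero_toDer]

/-- The failure of `toDer` to be a homomorphism. -/
def defect (y z : L) : Derivation k (Trunc 3 2 k) (Trunc 3 2 k) :=
  F.toDer ⁅y, z⁆ - ⁅F.toDer y, F.toDer z⁆

/-- By the Jacobi identity on both sides, and because `toDer` turns `ad (X i)` into the bracket with
`∂ᵢ`, the derivative of a defect is a sum of defects. -/
lemma partialD_defect (y z : L) (i j : Fin 2 ⊕ Fin 2) :
    partialD 3 2 k i (F.defect y z (var 3 2 k j)) =
      F.defect ⁅F.X i, y⁆ z (var 3 2 k j) + F.defect y ⁅F.X i, z⁆ (var 3 2 k j) := by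
  rw [← lie_partialD_apply_var, ← Derivation.add_apply]
  congr 1
  have h1 : F.toDer ⁅⁅F.X i, y⁆, z⁆ + F.toDer ⁅y, ⁅F.X i, z⁆⁆ =
      ⁅partialD 3 2 k i, F.toDer ⁅y, z⁆⁆ := by
    rw [← map_add, ← toDer_lie_X, leibniz_lie (F.X i) y z]
  rw [defect, defect, defect, toDer_lie_X, toDer_lie_X]
  ext f
  have h2 := congrArg (fun D : Derivation k (Trunc 3 2 k) (Trunc 3 2 k) => D f) h1
  simp only [Derivation.commutator_apply, Derivation.sub_apply, Derivation.add_apply, map_sub]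
    at h2 ⊢
  linear_combination (-1 : Trunc 3 2 k) * h2

/-- The coefficients of all defects span a space that is stable under derivatives
(`partialD_defect`) and has no constant terms (`π_lie`), so it is zero. -/
lemma toDer_lie {y z : L} (hy : y ∈ normalizer (k := k) F.e) (hz : z ∈ normalizer (k := k) F.e) :
    F.toDer ⁅y, z⁆ = ⁅F.toDer y, F.toDer z⁆ := by
  let S : Submodule k (Trunc 3 2 k) := Submodule.span k {f | ∃ y ∈ normalizer (k := k) F.e,
    ∃ z ∈ normalizer (k := k) F.e, ∃ j, F.defect y z (var 3 2 k j) = f}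
  have h0 : S ≤ LinearMap.ker (tcoeff 0) := by
    refine Submodule.span_le.mpr ?_
    rintro _ ⟨y, hy, z, hz, j, rfl⟩
    rw [SetLike.mem_coe, LinearMap.mem_ker, defect, Derivation.sub_apply,
      Derivation.commutator_apply, map_sub, map_sub, tcoeff_zero_toDer, tcoeff_zero_apply_apply,
      tcoeff_zero_apply_apply, F.π_lie hy hz, sub_self]
  have h1 : ∀ i, S ≤ S.comap (partialD 3 2 k i).toLinearMap := fun i => by
    refine Submodule.span_le.mpr ?_
    rintro _ ⟨y, hy, z, hz, j, rfl⟩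
    have := S.add_mem
      (Submodule.subset_span ⟨_, F.lie_X_mem hy i, z, hz, j, rfl⟩)
      (Submodule.subset_span ⟨y, hy, _, F.lie_X_mem hz i, j, rfl⟩)
    rwa [← partialD_defect] at this
  rw [← sub_eq_zero]
  refine derivation_ext 3 2 k fun j => ?_
  rw [Derivation.coe_zero, Pi.zero_apply]
  exact eq_zero_of_partialD_closed (Q := fun f => f ∈ S) (fun f i hf => h1 i hf)
    (fun f hf => h0 hf) (Submodule.subset_span ⟨y, hy, z, hz, j, rfl⟩)

/-! ### The kernel -/

omit [CharP k 3] in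
lemma lie_eq_zero_of_mem_span {z : L} (hz : z ∈ k ∙ F.e) (i : Fin 2 ⊕ Fin 2) : ⁅F.X i, z⁆ = 0 := by
  obtain ⟨c, rfl⟩ := Submodule.mem_span_singleton.mp hz
  rw [lie_smul, F.lie_e, smul_zero]

-- In `decomp` the terms with `R₀` and `R` disappear, because these operators kill `e`.
omit [CharP k 3] in
lemma eq_of_lie_X_mem {z : L} (hz : z ∈ normalizer (k := k) F.e)
    (h : ∀ i, ⁅F.X i, z⁆ ∈ k ∙ F.e) : z = F.ρ z • F.e + ∑ i, F.π i z • F.X i := by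
  have h1 := F.decomp z
  have h2 : ∀ i, F.R i ⁅F.X i, z⁆ = 0 := fun i => by
    obtain ⟨c, hc⟩ := Submodule.mem_span_singleton.mp (h i)
    rw [← hc, map_smul, F.R_e, smul_zero]
  simp only [h2, F.R₀_lie hz, Finset.sum_const_zero, zero_add] at h1
  exact h1.symm

omit [CharP k 3] in
/-- A set stable under the operators `ad (X i)` lies in the line spanned by `e` if those of its
elements do which are mapped into the line by all these operators. -/
lemma subset_line {Z : Set L} (hX : ∀ z ∈ Z, ∀ i, ⁅F.X i, z⁆ ∈ Z)
    (h : ∀ z ∈ Z, (∀ i, ⁅F.X i, z⁆ ∈ k ∙ F.e) → z ∈ k ∙ F.e) {z : L} (hz : z ∈ Z) :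
    z ∈ k ∙ F.e := by
  -- `T` contains the indices for which `⁅X i, z⁆` may leave the line. For a new index `t` the third
  -- power of `ad (X t)` vanishes, and `step` leads back from the second power to the first and then
  -- to `z`. The conditions at the other indices are inherited because the `X i` commute.
  have key : ∀ T : Finset (Fin 2 ⊕ Fin 2), ∀ z ∈ Z, (∀ i ∉ T, ⁅F.X i, z⁆ ∈ k ∙ F.e) →
      z ∈ k ∙ F.e := by
    intro T
    induction T using Finset.induction_on with
    | empty => exact fun z hz h1 => h z hz fun i => h1 i (Finset.notMem_empty i)
    | insert t T ht ih =>
      have step : ∀ z ∈ Z, (∀ i ∉ insert t T, ⁅F.X i, z⁆ ∈ k ∙ F.e) →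
          ⁅F.X t, z⁆ ∈ k ∙ F.e → z ∈ k ∙ F.e := fun z hz h1 h2 => by
        refine ih z hz fun i hi => ?_
        by_cases hit : i = t
        · rw [hit]; exact h2
        · exact h1 i fun hm => (Finset.mem_insert.mp hm).elim hit hi
      have hc : ∀ z, (∀ i ∉ insert t T, ⁅F.X i, z⁆ ∈ k ∙ F.e) →
          ∀ i ∉ insert t T, ⁅F.X i, ⁅F.X t, z⁆⁆ ∈ k ∙ F.e := fun z h1 i hi => by
        rw [F.lie_X_comm, F.lie_eq_zero_of_mem_span (h1 i hi)]
        exact zero_mem _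
      intro z hz h1
      refine step z hz h1 (step _ (hX z hz t) (hc z h1)
        (step _ (hX _ (hX z hz t) t) (hc _ (hc z h1)) ?_))
      rw [F.cube]
      exact zero_mem _
  exact key Finset.univ z hz fun i hi => absurd (Finset.mem_univ i) hi

/-- The kernel is stable under the `ad (X i)`, so by `subset_line` only elements mapped into the
line by all of them matter. They are combinations of `e` and the `X i`, and the constant terms of
their images force the coefficients of the `X i` to vanish. -/
lemma mem_line_of_toDer_eq_zero {y : L} (hy : y ∈ normalizer (k := k) F.e) (h : F.toDer y = 0) :
    y ∈ k ∙ F.e := by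
  refine F.subset_line (Z := {y | y ∈ normalizer (k := k) F.e ∧ F.toDer y = 0})
    (fun z hz i => ⟨F.lie_X_mem hz.1 i, ?_⟩) (fun z hz h1 => ?_) ⟨hy, h⟩
  · rw [toDer_lie_X, hz.2]
    exact der_lie_zero _
  · have h2 : ∀ i, F.π i z = 0 := fun i => by
      rw [← tcoeff_zero_toDer, hz.2, Derivation.coe_zero, Pi.zero_apply, map_zero]
    rw [F.eq_of_lie_X_mem hz.1 h1]
    simp only [h2, zero_smul, Finset.sum_const_zero, add_zero]
    exact Submodule.mem_span_singleton.mpr ⟨_, rfl⟩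

lemma toDer_e : F.toDer F.e = 0 := by
  refine derivation_ext 3 2 k fun j => ?_
  rw [Derivation.coe_zero, Pi.zero_apply]
  refine eq_zero_of_partialD_closed (Q := fun f => f = F.toDer F.e (var 3 2 k j) ∨ f = 0)
    ?_ ?_ (Or.inl rfl)
  · rintro f i (rfl | rfl)
    · right
      rw [partialD_toDer_var, F.lie_e, map_zero, Derivation.coe_zero, Pi.zero_apply]
    · right; rw [map_zero]
  · rintro f (rfl | rfl)
    · rw [tcoeff_zero_toDer, F.π_of_mem j _ F.e_mem]
    · exact map_zero _

lemma toDer_eq_zero_iff {y : L} (hy : y ∈ normalizer (k := k) F.e) :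
    F.toDer y = 0 ↔ y ∈ k ∙ F.e := by
  refine ⟨F.mem_line_of_toDer_eq_zero hy, fun h => ?_⟩
  obtain ⟨c, rfl⟩ := Submodule.mem_span_singleton.mp h
  rw [map_smul, toDer_e, smul_zero]

/-- Differentiating the equations of `H` for `y` gives those for `⁅X l, y⁆`, which is again in the
centraliser. So it suffices to compare constant terms, and these agree by `symplectic`. -/
lemma toDer_mem_H {y : L} (hy : y ∈ centralizer (k := k) F.e) : F.toDer y ∈ H 3 2 k := fun i j => by
  rw [← sub_eq_zero]
  refine eq_zero_of_partialD_closed (Q := fun f => ∃ y ∈ centralizer (k := k) F.e,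
    f = sgn j.swap • partialD 3 2 k i (F.toDer y (var 3 2 k j.swap)) -
      sgn i.swap • partialD 3 2 k j (F.toDer y (var 3 2 k i.swap))) ?_ ?_ ⟨y, hy, rfl⟩
  · rintro _ l ⟨y, hy, rfl⟩
    refine ⟨⁅F.X l, y⁆, (centralizer (k := k) F.e).lie_mem (F.X_mem_centralizer l) hy, ?_⟩
    simp only [map_sub, map_zsmul, partialD_toDer_var]
    rw [F.lie_X_comm l i, F.lie_X_comm l j]
  · rintro _ ⟨y, hy, rfl⟩
    simp only [map_sub, map_zsmul, partialD_toDer_var, tcoeff_zero_toDer]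
    rw [F.symplectic y (by rw [← lie_skew, mem_centralizer.mp hy, neg_zero]), sub_self]

end Frame

end Hamiltonian

end


/-! ### The images of the centraliser and of the normaliser -/

noncomputable section

namespace Hamiltonian

open LieLine

namespace Frame

set_option maxRecDepth 4000

variable {k L : Type*} [Field k] [CharP k 3] [LieRing L] [LieAlgebra k L] (F : Frame k L)

/-- The centraliser of `e` contains elements whose images are the Hamiltonian vector fields of the
derivatives of the top monomial. -/
def HasTop : Prop :=
  ∀ i, ∃ y ∈ centralizer (k := k) F.e, ∃ η : k, η ≠ 0 ∧ ∀ (a : Fin 2 ⊕ Fin 2 → Fin 3) j,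
    F.π j (multiPow F.A a y) = sgn j • if a j.swap ≠ 2 ∧
      Function.update a j.swap (a j.swap + 1) = Function.update topExp i 1 then η else 0

variable {F}

/-- The numbers in `HasTop` are Taylor coefficients before division by factorials. In this
normalisation the nonzero coefficients of the field of a monomial agree up to sign: the factor from
differentiation turns the factorial of the lower exponent into that of the monomial (`fac_update`).
-/
lemma HasTop.exists_toDer_eq_tmon (hF : F.HasTop) (i : Fin 2 ⊕ Fin 2) :
    ∃ y ∈ centralizer (k := k) F.e,
      F.toDer y = hamField (tmon (Function.update topExp i 1)) := by
  obtain ⟨y, hy, η, hη, h⟩ := hF i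
  set b : Fin 2 ⊕ Fin 2 → Fin 3 := Function.update topExp i 1
  have hb : (fac b : k) ≠ 0 := fac_ne_zero b
  have key : F.toDer y = (η * (fac b)⁻¹) • hamField (tmon b) := by
    refine derivation_ext 3 2 k fun j => ext_tcoeff fun a => ?_
    rw [toDer_var, tcoeff_jet, h, Derivation.smul_apply, hamField_var, map_smul, map_zsmul,
      smul_eq_mul]
    by_cases ha : a j.swap = 2
    · rw [tcoeff_partialD_of_eq_two ha, if_neg (fun h' => h'.1 ha)]
      simp
    · rw [tcoeff_partialD, tcoeff_tmon]
      by_cases hu : Function.update a j.swap (a j.swap + 1) = b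
      · rw [if_pos ⟨ha, hu⟩, if_pos hu, ← hu, fac_update ha]
        have h1 := fac_update (k := k) ha
        rw [hu] at h1
        have h2 : ((a j.swap : ℕ) + 1 : k) ≠ 0 := fun h' => hb (by rw [h1, h', zero_mul])
        have h3 : (fac a : k) ≠ 0 := fac_ne_zero a
        simp only [zsmul_eq_mul]
        field_simp
      · rw [if_neg (fun h' => hu h'.2), if_neg hu]
        simp
  refine ⟨(η * (fac b)⁻¹)⁻¹ • y, (centralizer (k := k) F.e).smul_mem _ hy, ?_⟩
  rw [map_smul, key, inv_smul_smul₀ (mul_ne_zero hη (inv_ne_zero hb))]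

/-- The image of the centraliser is stable under bracketing with `∂ᵢ`, since `X i` lies in the
centraliser. So the four monomials next to the top one generate everything by `tmon_mem`. -/
lemma HasTop.exists_toDer_eq (hF : F.HasTop) {f : Trunc 3 2 k} (hf : tcoeff topExp f = 0) :
    ∃ y ∈ centralizer (k := k) F.e, F.toDer y = hamField f := by
  let J : Submodule k (Trunc 3 2 k) :=
    ((centralizer (k := k) F.e).toSubmodule.map F.toDer).comap hamField
  refine mem_of_tmon_mem (J := J) (fun b hb => tmon_mem ?_ (fun i => ?_) hb) hf
  · rintro f ⟨y, hy, h⟩ i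
    refine ⟨⁅F.X i, y⁆, (centralizer (k := k) F.e).lie_mem (F.X_mem_centralizer i) hy, ?_⟩
    rw [toDer_lie_X, h, lie_hamField (partialD_mem i)]
  · exact hF.exists_toDer_eq_tmon i

/-- The image of `y` need not lie in `H`. But the derived algebra is spanned by brackets of images
of `u` and `v` in the centraliser, and in the Leibniz expansion `⁅y, u⁆` and `⁅y, v⁆` are in the
centraliser too. All resulting brackets are taken within `H`, so their Hamiltonians have no top
coefficient. -/
lemma HasTop.mem_derivedNormalizer (hF : F.HasTop) {y : L}
    (hy : y ∈ normalizer (k := k) F.e) : F.toDer y ∈ derivedNormalizer k := by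
  let adH : H 3 2 k →ₗ[k] Derivation k (Trunc 3 2 k) (Trunc 3 2 k) :=
    (LieAlgebra.ad k (Derivation k (Trunc 3 2 k) (Trunc 3 2 k)) (F.toDer y) :
      Derivation k (Trunc 3 2 k) (Trunc 3 2 k) →ₗ[k] Derivation k (Trunc 3 2 k) (Trunc 3 2 k)) ∘ₗ
      (H 3 2 k).toSubmodule.subtype
  let S : Submodule k (H 3 2 k) :=
    ((LinearMap.ker (tcoeff (k := k) topExp)).map hamField).comap adH
  have hS : ∀ f : Trunc 3 2 k, tcoeff topExp f = 0 → hamH f ∈ S := fun f hf => by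
    refine hamH_mem_of_lie_mem (S := S) (fun f g hf hg => ?_) hf
    obtain ⟨u, hu, h1⟩ := hF.exists_toDer_eq hf
    obtain ⟨v, hv, h2⟩ := hF.exists_toDer_eq hg
    have hyu := lie_mem_centralizer hy hu
    have hyv := lie_mem_centralizer hy hv
    have h3 : ⁅F.toDer y, ⁅hamField f, hamField g⁆⁆ =
        ⁅F.toDer ⁅y, u⁆, F.toDer v⁆ + ⁅F.toDer u, F.toDer ⁅y, v⁆⁆ := by
      rw [← h1, ← h2, ← F.toDer_lie (centralizer_le_normalizer _ hu) (centralizer_le_normalizer _ hv),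
        ← F.toDer_lie hy (centralizer_le_normalizer _ ((centralizer (k := k) F.e).lie_mem hu hv)),
        ← F.toDer_lie (centralizer_le_normalizer _ hyu) (centralizer_le_normalizer _ hv),
        ← F.toDer_lie (centralizer_le_normalizer _ hu) (centralizer_le_normalizer _ hyv),
        ← map_add, leibniz_lie]
    refine ⟨pairing (F.toDer ⁅y, u⁆) (F.toDer v) + pairing (F.toDer u) (F.toDer ⁅y, v⁆), ?_, ?_⟩
    · rw [SetLike.mem_coe, LinearMap.mem_ker, map_add,
        tcoeff_top_pairing (F.toDer_mem_H hyu) (F.toDer_mem_H hv),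
        tcoeff_top_pairing (F.toDer_mem_H hu) (F.toDer_mem_H hyv), add_zero]
    · rw [map_add, ← lie_eq_hamField (F.toDer_mem_H hyu) (F.toDer_mem_H hv),
        ← lie_eq_hamField (F.toDer_mem_H hu) (F.toDer_mem_H hyv), ← h3]
      rfl
  intro f hf
  obtain ⟨g, hg, h⟩ := hS f hf
  exact ⟨g, hg, h⟩

/-- The map from the centraliser to the Hamiltonian algebra. -/
def centralizerHom (F : Frame k L) : centralizer (k := k) F.e →ₗ⁅k⁆ H 3 2 k where
  toFun y := ⟨F.toDer y.1, F.toDer_mem_H y.2⟩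
  map_add' y z := Subtype.ext (map_add F.toDer y.1 z.1)
  map_smul' c y := Subtype.ext (map_smul F.toDer c y.1)
  map_lie' := fun {y z} => Subtype.ext (F.toDer_lie (centralizer_le_normalizer _ y.2)
    (centralizer_le_normalizer _ z.2))

lemma centralizerHom_eq_zero_iff (y : centralizer (k := k) F.e) :
    centralizerHom F y = 0 ↔ y.1 ∈ k ∙ F.e := by
  rw [← F.toDer_eq_zero_iff (centralizer_le_normalizer _ y.2)]
  exact ⟨fun h => congrArg Subtype.val h, fun h => Subtype.ext h⟩

lemma HasTop.exists_centralizerHom_eq (hF : F.HasTop) {D : H 3 2 k}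
    (hD : D ∈ LieAlgebra.derivedSeries k (H 3 2 k) 1) : ∃ y, centralizerHom F y = D := by
  obtain ⟨f, hf, rfl⟩ := mem_derivedSeries_one.mp hD
  obtain ⟨y, hy, h⟩ := hF.exists_toDer_eq hf
  exact ⟨⟨y, hy⟩, Subtype.ext h⟩

/-- The map from the normaliser to the normaliser of the derived Hamiltonian algebra. -/
def normalizerHom (hF : F.HasTop) : normalizer (k := k) F.e →ₗ⁅k⁆ derivedNormalizer k where
  toFun y := ⟨F.toDer y.1, hF.mem_derivedNormalizer y.2⟩
  map_add' y z := Subtype.ext (map_add F.toDer y.1 z.1)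
  map_smul' c y := Subtype.ext (map_smul F.toDer c y.1)
  map_lie' := fun {y z} => Subtype.ext (F.toDer_lie y.2 z.2)

lemma toLieDerivation_normalizerHom_eq_zero_iff (hF : F.HasTop) (y : normalizer (k := k) F.e) :
    (toLieDerivation k).comp (normalizerHom hF) y = 0 ↔ y.1 ∈ k ∙ F.e := by
  rw [← F.toDer_eq_zero_iff y.2, LieHom.comp_apply]
  constructor
  · exact fun h => congrArg Subtype.val (eq_zero_of_toLieDerivation h)
  · intro h
    have : normalizerHom hF y = 0 := Subtype.ext h
    rw [this, map_zero]

end Frame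

end Hamiltonian

end


noncomputable section

namespace ExceptionalE8

/-! ### Computations with sparse vectors -/

/-- The coefficient at a code. -/
def coef (a : ℕ) (x : SVec) : ℕ := List.rec 0 (fun t _ n => bif Nat.beq t.2 a then t.1 + n else n) x

/-- The value of the functional with the given coefficients. -/
def pairCoef (u x : SVec) : ℕ := List.rec 0 (fun t _ n => t.1 * coef t.2 x + n) u

/-- The position of an index in `opVec`. -/
def opIdx : Fin 2 ⊕ Fin 2 → ℕ
  | Sum.inl i => i + 1
  | Sum.inr i => i + 3

/-- The signs modulo three. -/
def sgnNat : Fin 2 ⊕ Fin 2 → ℕ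
  | Sum.inl _ => 1
  | Sum.inr _ => 2

/-- The root vectors of degree five which centralise `e`. -/
def topVec : Fin 2 ⊕ Fin 2 → SVec
  | Sum.inl 0 => [(1, 147440364300385)]
  | Sum.inl 1 => [(2, 142972507527265)]
  | Sum.inr 0 => [(2, 142901606217696)]
  | Sum.inr 1 => [(2, 142971416479776)]

def svPow (x : SVec) (n : ℕ) (y : SVec) : SVec := Nat.rec y (fun _ z => svBracket x z) n

def svMultiPow (b : Fin 2 ⊕ Fin 2 → Fin 3) (y : SVec) : SVec :=
  svPow svX0 (b (Sum.inl 0)) (svPow svX1 (b (Sum.inl 1))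
    (svPow svX2 (b (Sum.inr 0)) (svPow svX3 (b (Sum.inr 1)) y)))

/-- The pairs of different indices, in one of the two orders. -/
def indexPairs : List ((Fin 2 ⊕ Fin 2) × (Fin 2 ⊕ Fin 2)) :=
  [(Sum.inl 1, Sum.inl 0), (Sum.inr 0, Sum.inl 0), (Sum.inr 0, Sum.inl 1), (Sum.inr 1, Sum.inl 0),
    (Sum.inr 1, Sum.inl 1), (Sum.inr 1, Sum.inr 0)]

/-- Functionals which, composed with `ad e`, express the defects of the symplectic identities. -/
def symplecticData : ℕ → ℕ → SVec
  | 2, 1 => [(1, 142901589174175), (2, 142900515432415), (2, 138503542663135)]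
  | 3, 1 => [(1, 142972490483744), (2, 142971416741921), (1, 147369463253024),
      (1, 142971433519136), (2, 142971416746016)]
  | 3, 2 => [(2, 147439273515041), (1, 147439273515104)]
  | 4, 1 => [(2, 142901606483936), (2, 138503559972896)]
  | 4, 2 => [(1, 142971433519136), (2, 142971416741921), (1, 142972490483744)]
  | 4, 3 => [(2, 147440381339745), (1, 143042334828705)]
  | _, _ => []

/-- The degree of a lattice vector, shifted by `128`, is the difference of these numbers. -/
def degPos (c : ℕ) : ℕ :=
  2 * (digit c 0 + digit c 1 + digit c 2 + digit c 4 + digit c 5 + digit c 7)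

def degNeg (c : ℕ) : ℕ := 5 * digit c 3 + 3 * digit c 6

/-- Whether a basis vector has nonnegative degree. -/
def degNonneg (c : ℕ) : Bool := Nat.blt c 8 || Nat.ble (128 + degNeg c) (degPos c)

section Checks

set_option maxRecDepth 100000

/-- Index 0 stands for `e`; its nilpotency of order three is used for the maximality of the
normaliser. -/
lemma cube_check : (codeTable.keys.all fun c => [0, 1, 2, 3, 4].all fun i =>
    (svBracket (opVec i) (svBracket (opVec i) (svBracket (opVec i) [(1, c)]))).isEmpty) = true := by
  decide +kernel

/-- The matrices in `codeTable` are the operators `R₀` and `R i` of `Frame.decomp`; this is that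
identity on each basis vector. -/
lemma decomp_check : (codeTable.keys.all fun c =>
    svEq (([0, 1, 2, 3, 4].flatMap fun i => tableApply i (svBracket (opVec i) [(1, c)])) ++
      (bif Nat.beq c 142971416741921 then svE else []) ++
      ([1, 2, 3, 4].flatMap fun i => bif Nat.beq c (opCode i) then opVec i else [])) [(1, c)]) =
      true := by
  decide +kernel

lemma top_check : ∀ i j, ∀ a b c d : Fin 3,
    coef (opCode (opIdx j)) (svMultiPow (Sum.elim ![a, b] ![c, d]) (topVec i)) % 3 =
      if (Sum.elim ![a, b] ![c, d] : Fin 2 ⊕ Fin 2 → Fin 3) j.swap ≠ 2 ∧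
        Function.update (Sum.elim ![a, b] ![c, d] : Fin 2 ⊕ Fin 2 → Fin 3) j.swap
          ((Sum.elim ![a, b] ![c, d] : Fin 2 ⊕ Fin 2 → Fin 3) j.swap + 1) =
          Function.update Hamiltonian.topExp i 1 then sgnNat j else 0 := by
  decide +kernel

/-- Each defect of the symplectic identities factors through `ad e`, with the functional listed in
`symplecticData`. Hence it vanishes on the centraliser. The factor 2 stands for -1. -/
lemma symplectic_check : codeTable.keys.all (fun c =>
    indexPairs.all fun p =>
    Nat.beq ((sgnNat p.2.swap * coef (opCode (opIdx p.2.swap))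
        (svBracket (opVec (opIdx p.1)) [(1, c)]) +
      2 * (sgnNat p.1.swap * coef (opCode (opIdx p.1.swap))
        (svBracket (opVec (opIdx p.2)) [(1, c)]))) % 3)
      (pairCoef (symplecticData (opIdx p.1) (opIdx p.2)) (svBracket svE [(1, c)]) % 3)) = true := by
  decide +kernel

/-- Index 0 is left out: the term with `R₀` vanishes on the normaliser, so its degrees are
irrelevant. -/
lemma tableRow_check : (codeTable.keys.all fun c => [1, 2, 3, 4].all fun i =>
    (tableRow i c).all fun t => isCode t.2 && degNonneg t.2) = true := by
  decide +kernel

lemma op_check : [0, 1, 2, 3, 4].all (fun i => (opVec i).all (fun t => isCode t.2) &&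
    svEq (tableApply i svE) [] && [0, 1, 2, 3, 4].all fun j =>
    (svBracket (opVec i) (opVec j)).isEmpty && (Nat.beq i 0 || Nat.beq j 0 ||
      Nat.beq (coef (opCode i) (opVec j)) (bif Nat.beq i j then 1 else 0))) = true := by
  decide +kernel

lemma opCode_check : [1, 2, 3, 4].all (fun i => isCode (opCode i) && !degNonneg (opCode i)) &&
    svE.all (fun t => degNonneg t.2) = true := by
  decide +kernel

lemma topVec_check : ∀ i, Valid (topVec i) ∧ (svBracket svE (topVec i)).isEmpty = true := by
  decide +kernel

end Checks

end ExceptionalE8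

end


noncomputable section

namespace ExceptionalE8

open Hamiltonian

/-! ### The grading -/

/-- The degree of a lattice vector. -/
def degree (v : Fin 8 → ℤ) : ℤ :=
  2 * (v 0 + v 1 + v 2 + v 4 + v 5 + v 7) - 5 * v 3 - 3 * v 6

lemma degree_add (u v : Fin 8 → ℤ) : degree (u + v) = degree u + degree v := by
  simp only [degree, Pi.add_apply]; ring

/-- The shift 128 is `32 * (12 - 5 - 3)`, the contribution of the digit offsets. -/
lemma degNonneg_iff {c : ℕ} (h : 8 ≤ c) : degNonneg c = true ↔ 0 ≤ degree (vecOf c) := by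
  have h1 : Nat.blt c 8 = false := by
    rw [Bool.eq_false_iff]; simp [Nat.blt_eq, h]
  rw [degNonneg, h1, Bool.false_or, Nat.ble_eq, degree, degPos, degNeg]
  change _ ↔ (0 : ℤ) ≤ 2 * ((digit c 0 : ℤ) - 32 + ((digit c 1 : ℤ) - 32) + ((digit c 2 : ℤ) - 32) +
    ((digit c 4 : ℤ) - 32) + ((digit c 5 : ℤ) - 32) + ((digit c 7 : ℤ) - 32)) -
    5 * ((digit c 3 : ℤ) - 32) - 3 * ((digit c 6 : ℤ) - 32)
  omega

section Nonneg

variable (k : Type*) [Field k]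

/-- The spanning set of the subalgebra of elements of nonnegative degree. -/
def nonnegGens : Set (Alg k) :=
  {x | (∃ v, form v v = 2 ∧ 0 ≤ degree v ∧ x = rootVec k v) ∨ ∃ v, x = cartan k v}

variable {k} in
lemma lie_mem_span_nonnegGens {x y : Alg k} (hx : x ∈ nonnegGens k) (hy : y ∈ nonnegGens k) :
    ⁅x, y⁆ ∈ Submodule.span k (nonnegGens k) := by
  rcases hx with ⟨u, hu, hu0, rfl⟩ | ⟨u, rfl⟩ <;> rcases hy with ⟨v, hv, hv0, rfl⟩ | ⟨v, rfl⟩ <;>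
    rw [lie_def]
  · rw [bracket_rootVec_rootVec k hu hv]
    refine zsmul_mem (add_mem ?_ ?_) _
    · by_cases h : form (u + v) (u + v) = 2
      · exact Submodule.subset_span (Or.inl ⟨_, h, by rw [degree_add]; omega, rfl⟩)
      · rw [rootVec_not k h]; exact zero_mem _
    · split_ifs
      · exact Submodule.subset_span (Or.inr ⟨_, rfl⟩)
      · exact zero_mem _
  · rw [bracket_rootVec_cartan]
    refine Submodule.neg_mem _ (zsmul_mem (S := Submodule k (Alg k)) ?_ _)
    exact Submodule.subset_span (Or.inl ⟨u, hu, hu0, rfl⟩)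
  · rw [bracket_cartan_rootVec]
    refine zsmul_mem (S := Submodule k (Alg k)) ?_ _
    exact Submodule.subset_span (Or.inl ⟨v, hv, hv0, rfl⟩)
  · rw [bracket_cartan_cartan]; exact zero_mem _

/-- The subalgebra of elements of nonnegative degree. -/
def nonneg : LieSubalgebra k (Alg k) where
  toSubmodule := Submodule.span k (nonnegGens k)
  lie_mem' := fun {x y} hx hy => by
    refine Submodule.span_induction₂ (p := fun x y _ _ => ⁅x, y⁆ ∈ Submodule.span k (nonnegGens k))
      (fun x y hx hy => lie_mem_span_nonnegGens hx hy) (fun y _ => ?_) (fun x _ => ?_)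
      (fun x y z _ _ _ h1 h2 => ?_) (fun x y z _ _ _ h1 h2 => ?_) (fun c x y _ _ h => ?_)
      (fun c x y _ _ h => ?_) hx hy
    · rw [zero_lie]; exact zero_mem _
    · rw [lie_zero]; exact zero_mem _
    · rw [add_lie]; exact add_mem h1 h2
    · rw [lie_add]; exact add_mem h1 h2
    · rw [smul_lie]; exact Submodule.smul_mem _ c h
    · rw [lie_smul]; exact Submodule.smul_mem _ c h

variable {k}

lemma codeVec_mem_nonneg {c : ℕ} (hc : isCode c = true) (hd : degNonneg c = true) :
    codeVec k c ∈ nonneg k := by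
  refine Submodule.subset_span ?_
  by_cases h : c < 8
  · exact Or.inr ⟨Pi.single ⟨c, h⟩ 1, by rw [codeVec_of_lt k h, cartan_single]⟩
  · have hc' : IsRootCode c := ⟨not_lt.mp h, hc⟩
    exact Or.inl ⟨vecOf c, hc'.form, (degNonneg_iff hc'.1).mp hd, codeVec_of_le k hc'.1⟩

lemma eval_mem_nonneg {x : SVec} (hx : x.all (fun t => isCode t.2 && degNonneg t.2) = true) :
    eval k x ∈ nonneg k := by
  rw [List.all_eq_true] at hx
  refine list_sum_mem fun y hy => ?_
  obtain ⟨t, ht, rfl⟩ := List.mem_map.mp hy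
  have := hx t ht
  rw [Bool.and_eq_true] at this
  exact (nonneg k).smul_mem _ (codeVec_mem_nonneg this.1 this.2)

end Nonneg

/-! ### The frame -/

section Frame

variable {k : Type*} [Field k]

/-- The coordinate at a code. -/
def coord (a : ℕ) : Alg k →ₗ[k] k := codeLift fun c => bif Nat.beq c a then 1 else 0

lemma coord_eval (a : ℕ) {x : SVec} (hx : Valid x) : coord a (eval k x) = (coef a x : k) := by
  rw [coord, codeLift_eval _ hx]
  clear hx
  induction x with
  | nil => simp [coef]
  | cons t x ih =>
    rw [List.map_cons, List.sum_cons, ih]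
    change _ = ((bif Nat.beq t.2 a then t.1 + coef a x else coef a x : ℕ) : k)
    cases Nat.beq t.2 a <;> simp

lemma coord_eq_zero {a : ℕ} (hd : degNonneg a = false) {y : Alg k}
    (hy : y ∈ nonneg k) : coord a y = 0 := by
  have : nonnegGens k ⊆ LinearMap.ker (coord (k := k) a) := by
    have h8 : ∀ c, c < 8 → Nat.beq c a = false := fun c hc => by
      rw [Bool.eq_false_iff]
      intro h
      have hb : Nat.blt c 8 = true := by rw [Nat.blt_eq]; exact hc
      rw [← Nat.eq_of_beq_eq_true h, degNonneg, hb, Bool.true_or] at hd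
      exact absurd hd (by decide)
    rintro _ (⟨v, hv, hv0, rfl⟩ | ⟨v, rfl⟩)
    · obtain ⟨c, hc, rfl⟩ := exists_code v hv
      rw [SetLike.mem_coe, LinearMap.mem_ker, ← codeVec_of_le k hc.1, coord,
        codeLift_codeVec _ hc.2]
      have : Nat.beq c a = false := by
        rw [Bool.eq_false_iff]
        intro h
        rw [← Nat.eq_of_beq_eq_true h, (degNonneg_iff hc.1).mpr hv0] at hd
        exact absurd hd (by decide)
      rw [this]; rfl
    · rw [SetLike.mem_coe, LinearMap.mem_ker, cartan, map_sum]
      refine Finset.sum_eq_zero fun i _ => ?_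
      have h1 : basisVec k (Sum.inl i) = codeVec k i := (codeVec_of_lt k i.2).symm
      rw [map_zsmul, h1, coord, codeLift_codeVec _ (isCode_of_lt i i.2), h8 i i.2]
      simp
  exact LinearMap.mem_ker.mp (Submodule.span_le.mpr this hy)

variable [CharP k 3]

lemma lie_eval {x y : SVec} (hx : Valid x) (hy : Valid y) :
    ⁅eval k x, eval k y⁆ = eval k (svBracket x y) := (eval_svBracket k hx hy).symm

omit [CharP k 3] in
lemma eval_of_isEmpty {x : SVec} (h : x.isEmpty = true) : eval k x = 0 := by
  rw [List.isEmpty_iff.mp h, eval_nil]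

omit [CharP k 3] in
lemma codeVec_eq_eval (c : ℕ) : codeVec k c = eval k [(1, c)] := by simp

lemma valid_opVec : ∀ i ∈ [0, 1, 2, 3, 4], Valid (opVec i) := by decide +kernel

lemma opIdx_mem (i : Fin 2 ⊕ Fin 2) : opIdx i ∈ [1, 2, 3, 4] := by revert i; decide

lemma valid_opIdx (i : Fin 2 ⊕ Fin 2) : Valid (opVec (opIdx i)) :=
  valid_opVec _ (List.mem_cons_of_mem _ (opIdx_mem i))

lemma opIdx_inj {i j : Fin 2 ⊕ Fin 2} : Nat.beq (opIdx i) (opIdx j) = decide (i = j) := by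
  revert i j; decide

lemma lie_opVec {i j : ℕ} (hi : i ∈ [0, 1, 2, 3, 4]) (hj : j ∈ [0, 1, 2, 3, 4]) :
    ⁅eval k (opVec i), eval k (opVec j)⁆ = 0 := by
  have h := op_check
  rw [List.all_eq_true] at h
  have h1 := h i hi
  simp only [Bool.and_eq_true, List.all_eq_true] at h1
  rw [lie_eval (valid_opVec i hi) (valid_opVec j hj)]
  exact eval_of_isEmpty (h1.2 j hj).1

lemma opVec_cube {i : ℕ} (hi : i ∈ [0, 1, 2, 3, 4]) (y : Alg k) :
    ⁅eval k (opVec i), ⁅eval k (opVec i), ⁅eval k (opVec i), y⁆⁆⁆ = 0 := by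
  let a : Alg k →ₗ[k] Alg k := LieAlgebra.ad k (Alg k) (eval k (opVec i))
  have : a ∘ₗ a ∘ₗ a = 0 := ext_codeVec fun c hc => by
    have h := List.all_eq_true.mp (List.all_eq_true.mp cube_check c hc) i hi
    have hv := valid_opVec i hi
    have hc' : Valid [(1, c)] := Valid.singleton (isCode_of_mem_keys c hc)
    change ⁅eval k (opVec i), ⁅eval k (opVec i), ⁅eval k (opVec i), codeVec k c⁆⁆⁆ = 0
    rw [codeVec_eq_eval, lie_eval hv hc', lie_eval hv (hv.svBracket hc'),
      lie_eval hv (hv.svBracket (hv.svBracket hc')), eval_of_isEmpty h]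
  exact LinearMap.congr_fun this y

/-- The linear map given by one of the matrices in the table. -/
def tableMap (i : ℕ) : Alg k →ₗ[k] Alg k := codeLift fun c => eval k (tableRow i c)

omit [CharP k 3] in
lemma tableMap_eval (i : ℕ) {x : SVec} (hx : Valid x) :
    tableMap i (eval k x) = eval k (tableApply i x) := by
  rw [tableMap, codeLift_eval _ hx, tableApply, eval_flatMap]
  simp only [eval_smulVec]

lemma valid_svE : Valid svE := valid_opVec 0 (by decide)

lemma tableMap_e {i : ℕ} (hi : i ∈ [0, 1, 2, 3, 4]) : tableMap i (eval k svE) = 0 := by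
  have h1 := List.all_eq_true.mp op_check i hi
  simp only [Bool.and_eq_true] at h1
  rw [tableMap_eval i valid_svE, eval_eq_of_svEq k h1.1.2, eval_nil]

omit [CharP k 3] in
lemma tableMap_mem {i : ℕ} (hi : i ∈ [1, 2, 3, 4]) (y : Alg k) : tableMap i y ∈ nonneg k := by
  have : (nonneg k).toSubmodule.mkQ ∘ₗ tableMap i = 0 := ext_codeVec fun c hc => by
    rw [LinearMap.comp_apply, LinearMap.zero_apply, Submodule.mkQ_apply,
      Submodule.Quotient.mk_eq_zero, tableMap, codeLift_codeVec _ (isCode_of_mem_keys c hc)]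
    exact eval_mem_nonneg (List.all_eq_true.mp (List.all_eq_true.mp tableRow_check c hc) i hi)
  have h := LinearMap.congr_fun this y
  rwa [LinearMap.comp_apply, LinearMap.zero_apply, Submodule.mkQ_apply,
      Submodule.Quotient.mk_eq_zero] at h

lemma sum_index {M : Type*} [AddCommMonoid M] (f : ℕ → M) :
    ∑ i : Fin 2 ⊕ Fin 2, f (opIdx i) = f 1 + f 2 + f 3 + f 4 := by
  rw [Fintype.sum_sum_type, Fin.sum_univ_two, Fin.sum_univ_two, ← add_assoc]
  rfl

lemma tableMap_decomp (y : Alg k) :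
    tableMap 0 ⁅eval k svE, y⁆ + ∑ i, tableMap (opIdx i) ⁅eval k (opVec (opIdx i)), y⁆ +
      coord 142971416741921 y • eval k svE +
      ∑ i, coord (opCode (opIdx i)) y • eval k (opVec (opIdx i)) = y := by
  rw [sum_index fun i => tableMap i ⁅eval k (opVec i), y⁆,
    sum_index fun i => coord (opCode i) y • eval k (opVec i)]
  let T : ℕ → Alg k →ₗ[k] Alg k := fun i =>
    tableMap i ∘ₗ (LieAlgebra.ad k (Alg k) (eval k (opVec i)) : Alg k →ₗ[k] Alg k)
  let U : ℕ → Alg k →ₗ[k] Alg k := fun i => (coord (opCode i)).smulRight (eval k (opVec i))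
  have : T 0 + (T 1 + T 2 + T 3 + T 4) + (coord 142971416741921).smulRight (eval k svE) +
      (U 1 + U 2 + U 3 + U 4) = LinearMap.id := ext_codeVec fun c hc => by
    have h := eval_eq_of_svEq k (List.all_eq_true.mp decomp_check c hc)
    have hc' := isCode_of_mem_keys c hc
    have hT : ∀ i ∈ [0, 1, 2, 3, 4], T i (codeVec k c) =
        eval k (tableApply i (svBracket (opVec i) [(1, c)])) := fun i hi => by
      have hv := valid_opVec i hi
      change tableMap i ⁅eval k (opVec i), codeVec k c⁆ = _
      rw [codeVec_eq_eval, lie_eval hv (Valid.singleton hc'),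
        tableMap_eval _ (hv.svBracket (Valid.singleton hc'))]
    have hU : ∀ (a : ℕ) (x : SVec), coord a (codeVec k c) • eval k x =
        eval k (bif Nat.beq c a then x else []) := fun a x => by
      rw [coord, codeLift_codeVec _ hc']
      cases Nat.beq c a <;> simp
    simp only [eval_append, eval_flatMap, List.map_cons, List.map_nil, List.sum_cons,
      List.sum_nil, add_zero] at h
    simp only [LinearMap.add_apply, LinearMap.id_apply, hT, List.mem_cons, List.not_mem_nil,
      LinearMap.smulRight_apply, hU, U, true_or, or_true]
    rw [codeVec_eq_eval, ← h]
    abel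
  have h := LinearMap.congr_fun this y
  exact h

lemma sgn_eq_cast (i : Fin 2 ⊕ Fin 2) : ((sgn i : ℤ) : k) = (sgnNat i : k) := by
  have := three_eq_zero (k := k)
  rcases i with i | i
  · simp [sgn, sgnNat]
  · simp only [sgn, sgnNat]; push_cast; linear_combination -this

omit [CharP k 3] in
lemma pairCoef_eq (u : SVec) {x : SVec} (hx : Valid x) :
    (pairCoef u x : k) = (u.map fun t => (t.1 : k) * coord t.2 (eval k x)).sum := by
  induction u with
  | nil => simp [pairCoef]
  | cons t u ih =>
    rw [List.map_cons, List.sum_cons, ← ih, coord_eval _ hx]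
    change ((t.1 * coef t.2 x + pairCoef u x : ℕ) : k) = _
    push_cast; rfl

lemma eq_of_mod_three {a b : ℕ} (h : a % 3 = b % 3) : (a : k) = b := by
  rw [← cast_mod_three k a, h, cast_mod_three k b]

lemma mem_indexPairs : ∀ i j, i = j ∨ (i, j) ∈ indexPairs ∨ (j, i) ∈ indexPairs := by
  intro i j
  rcases i with i | i <;> rcases j with j | j <;> fin_cases i <;> fin_cases j <;> simp [indexPairs]

lemma symplectic_aux {i j : Fin 2 ⊕ Fin 2} (hij : (i, j) ∈ indexPairs) {y : Alg k} (hy : ⁅eval k svE, y⁆ = 0) :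
    (sgnNat j.swap : k) * coord (opCode (opIdx j.swap)) ⁅eval k (opVec (opIdx i)), y⁆ +
      2 * ((sgnNat i.swap : k) * coord (opCode (opIdx i.swap)) ⁅eval k (opVec (opIdx j)), y⁆) =
      0 := by
  let a : SVec → Alg k →ₗ[k] Alg k := fun x => LieAlgebra.ad k (Alg k) (eval k x)
  let u := symplecticData (opIdx i) (opIdx j)
  have : (sgnNat j.swap : k) • (coord (opCode (opIdx j.swap)) ∘ₗ a (opVec (opIdx i))) +
      (2 : k) • (sgnNat i.swap : k) • (coord (opCode (opIdx i.swap)) ∘ₗ a (opVec (opIdx j))) =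
      (u.map fun t => (t.1 : k) • coord t.2).sum ∘ₗ a svE := ext_codeVec fun c hc => by
    have h := List.all_eq_true.mp (List.all_eq_true.mp symplectic_check c hc) _ hij
    have hc' : Valid [(1, c)] := Valid.singleton (isCode_of_mem_keys c hc)
    have h1 := eq_of_mod_three (k := k) (Nat.eq_of_beq_eq_true h)
    push_cast at h1
    rw [pairCoef_eq _ (valid_svE.svBracket hc'),
      ← coord_eval _ ((valid_opIdx i).svBracket hc'), ← coord_eval _ ((valid_opIdx j).svBracket hc'),
      ← lie_eval (valid_opIdx i) hc', ← lie_eval (valid_opIdx j) hc', ← lie_eval valid_svE hc',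
      ← codeVec_eq_eval] at h1
    refine h1.trans ?_
    change _ = (u.map fun t => (t.1 : k) • coord t.2).sum ⁅eval k svE, codeVec k c⁆
    generalize ⁅eval k svE, codeVec k c⁆ = z
    change (u.map _).sum = _
    induction u with
    | nil => rfl
    | cons t u ih =>
      rw [List.map_cons, List.sum_cons, ih, List.map_cons, List.sum_cons, LinearMap.add_apply,
        LinearMap.smul_apply, smul_eq_mul]
  have h := LinearMap.congr_fun this y
  change _ = (u.map fun t => (t.1 : k) • coord t.2).sum ⁅eval k svE, y⁆ at h
  rw [hy, map_zero] at h
  exact h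

variable (k) in
/-- The frame for the nilpotent element `e`. -/
def frame : Hamiltonian.Frame k (Alg k) where
  e := eval k svE
  X i := eval k (opVec (opIdx i))
  π i := coord (opCode (opIdx i))
  R₀ := tableMap 0
  R i := tableMap (opIdx i)
  ρ := coord 142971416741921
  N := nonneg k
  lie_e i := lie_opVec (List.mem_cons_of_mem _ (opIdx_mem i)) (j := 0) (by decide)
  lie_X i j := lie_opVec (List.mem_cons_of_mem _ (opIdx_mem i))
    (List.mem_cons_of_mem _ (opIdx_mem j))
  cube i y := opVec_cube (List.mem_cons_of_mem _ (opIdx_mem i)) y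
  decomp := tableMap_decomp
  R₀_e := tableMap_e (by decide)
  R_e i := tableMap_e (List.mem_cons_of_mem _ (opIdx_mem i))
  R_mem i y := tableMap_mem (opIdx_mem i) y
  e_mem := eval_mem_nonneg (by decide +kernel)
  π_of_mem i y hy := by
    have h := opCode_check
    rw [Bool.and_eq_true] at h
    have h1 := List.all_eq_true.mp h.1 _ (opIdx_mem i)
    rw [Bool.and_eq_true, Bool.not_eq_true'] at h1
    exact coord_eq_zero h1.2 hy
  π_X i j := by
    have h1 := List.all_eq_true.mp op_check _ (List.mem_cons_of_mem _ (opIdx_mem i))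
    rw [Bool.and_eq_true] at h1
    have h2 := List.all_eq_true.mp h1.2 _ (List.mem_cons_of_mem _ (opIdx_mem j))
    have hi : Nat.beq (opIdx i) 0 = false := by clear * -; revert i; decide
    have hj : Nat.beq (opIdx j) 0 = false := by clear * -; revert j; decide
    rw [Bool.and_eq_true, hi, hj, Bool.false_or, Bool.false_or] at h2
    rw [coord_eval _ (valid_opIdx j), Nat.eq_of_beq_eq_true h2.2, opIdx_inj]
    by_cases h : i = j <;> simp [h]
  symplectic y hy i j := by
    have h3 := three_eq_zero (k := k)
    have key : ∀ i j : Fin 2 ⊕ Fin 2, (i, j) ∈ indexPairs →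
      sgn j.swap • coord (opCode (opIdx j.swap)) ⁅eval k (opVec (opIdx i)), y⁆ =
        sgn i.swap • coord (opCode (opIdx i.swap)) ⁅eval k (opVec (opIdx j)), y⁆ :=
      fun i j hij => by
        have h := symplectic_aux hij hy
        rw [zsmul_eq_mul, zsmul_eq_mul, sgn_eq_cast, sgn_eq_cast]
        linear_combination h - (sgnNat i.swap : k) *
          coord (opCode (opIdx i.swap)) ⁅eval k (opVec (opIdx j)), y⁆ * h3
    rcases mem_indexPairs i j with rfl | h | h
    · rfl
    · exact key i j h
    · exact (key j i h).symm

lemma valid_svPow {x : SVec} (hx : Valid x) (n : ℕ) {y : SVec} (hy : Valid y) :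
    Valid (svPow x n y) := by
  induction n with
  | zero => exact hy
  | succ n ih => exact hx.svBracket ih

lemma eval_svPow (i : Fin 2 ⊕ Fin 2) (n : ℕ) {y : SVec} (hy : Valid y) :
    eval k (svPow (opVec (opIdx i)) n y) = ((frame k).A i ^ n) (eval k y) := by
  induction n with
  | zero => rfl
  | succ n ih =>
    rw [pow_succ', Module.End.mul_apply, ← ih]
    exact eval_svBracket k (valid_opIdx i) (valid_svPow (valid_opIdx i) n hy)

lemma valid_svMultiPow (b : Fin 2 ⊕ Fin 2 → Fin 3) {y : SVec} (hy : Valid y) :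
    Valid (svMultiPow b y) :=
  valid_svPow (valid_opIdx (Sum.inl 0)) _ (valid_svPow (valid_opIdx (Sum.inl 1)) _
    (valid_svPow (valid_opIdx (Sum.inr 0)) _ (valid_svPow (valid_opIdx (Sum.inr 1)) _ hy)))

lemma eval_svMultiPow (b : Fin 2 ⊕ Fin 2 → Fin 3) {y : SVec} (hy : Valid y) :
    eval k (svMultiPow b y) = multiPow (frame k).A b (eval k y) := by
  have h3 := valid_svPow (valid_opIdx (Sum.inr 1)) (b (Sum.inr 1)) hy
  have h2 := valid_svPow (valid_opIdx (Sum.inr 0)) (b (Sum.inr 0)) h3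
  have h1 := valid_svPow (valid_opIdx (Sum.inl 1)) (b (Sum.inl 1)) h2
  rw [multiPow, Module.End.mul_apply, Module.End.mul_apply, Module.End.mul_apply,
    ← eval_svPow _ _ hy, ← eval_svPow _ _ h3, ← eval_svPow _ _ h2, ← eval_svPow _ _ h1]
  rfl

variable (k) in
lemma hasTop_frame : (frame k).HasTop := fun i => by
  have hv := topVec_check i
  -- The signs in `topVec` are chosen so that the common factor is 1.
  refine ⟨eval k (topVec i), ?_, 1, one_ne_zero, fun a j => ?_⟩
  · change ⁅eval k (topVec i), eval k svE⁆ = 0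
    rw [← lie_skew, lie_eval valid_svE hv.1, eval_of_isEmpty hv.2, neg_zero]
  · have ha : a = Sum.elim ![a (Sum.inl 0), a (Sum.inl 1)] ![a (Sum.inr 0), a (Sum.inr 1)] := by
      funext l
      rcases l with l | l <;> fin_cases l <;> rfl
    rw [ha]
    have h := top_check i j (a (Sum.inl 0)) (a (Sum.inl 1)) (a (Sum.inr 0)) (a (Sum.inr 1))
    rw [← eval_svMultiPow _ hv.1]
    change coord _ _ = _
    rw [coord_eval _ (valid_svMultiPow _ hv.1), ← cast_mod_three, h, zsmul_eq_mul, sgn_eq_cast]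
    split_ifs <;> simp

end Frame

end ExceptionalE8

end


/-! ### Subalgebras above the normaliser, in terms of a frame -/

noncomputable section

namespace Hamiltonian

open LieLine

namespace Frame

set_option maxRecDepth 4000

variable {k L : Type*} [Field k] [CharP k 3] [LieRing L] [LieAlgebra k L] {F : Frame k L}

-- The `X i` commute, so the Taylor series of the image reduces to its constant term, which is given
-- by `π_X`.
variable (F) in
lemma toDer_X (i : Fin 2 ⊕ Fin 2) : F.toDer (F.X i) = partialD 3 2 k i := by
  refine derivation_ext 3 2 k fun j => ?_
  rw [← sub_eq_zero]
  refine eq_zero_of_partialD_closed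
    (Q := fun f => f = F.toDer (F.X i) (var 3 2 k j) - partialD 3 2 k i (var 3 2 k j) ∨ f = 0)
    ?_ ?_ (Or.inl rfl)
  · rintro f l (rfl | rfl)
    · right
      rw [map_sub, partialD_toDer_var, F.lie_X, map_zero, Derivation.coe_zero, Pi.zero_apply,
        partialD_var, zero_sub, neg_eq_zero]
      split_ifs <;> simp
    · right; rw [map_zero]
  · rintro f (rfl | rfl)
    · rw [map_sub, tcoeff_zero_toDer, F.π_X, partialD_var]
      by_cases h : j = i
      · rw [if_pos h, if_pos h.symm, tcoeff_zero_one, sub_self]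
      · rw [if_neg h, if_neg (Ne.symm h), map_zero, sub_self]
    · exact map_zero _

lemma toDer_sgn_smul_X (i : Fin 2 ⊕ Fin 2) :
    F.toDer (sgn i.swap • F.X i.swap) = hamField (var 3 2 k i) := by
  refine derivation_ext 3 2 k fun j => ?_
  rw [hamField_var_eq, toDer_var, map_zsmul, ← toDer_var, toDer_X, Derivation.smul_apply]

variable (F) in
omit [CharP k 3] in
lemma e_mem_normalizer : F.e ∈ normalizer (k := k) F.e :=
  mem_normalizer.mpr ⟨0, by rw [lie_self, zero_smul]⟩

lemma toDer_sub_eq_zero {y z : L} (h : F.toDer y = F.toDer z) : F.toDer (y - z) = 0 := by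
  refine derivation_ext 3 2 k fun j => ?_
  rw [toDer_var, map_sub, ← toDer_var, ← toDer_var, h, sub_self, Derivation.coe_zero,
    Pi.zero_apply]

/-- The centraliser of `e` acts irreducibly on the span of the `X i` modulo `e`. -/
lemma HasTop.X_mem (hF : F.HasTop) {V : Submodule k L} (he : F.e ∈ V)
    (hV : ∀ u ∈ centralizer (k := k) F.e, ∀ v ∈ V, ⁅u, v⁆ ∈ V) {c : Fin 2 ⊕ Fin 2 → k}
    (hc : ∑ i, c i • F.X i ∈ V) {l : Fin 2 ⊕ Fin 2} (hl : c l ≠ 0) (i : Fin 2 ⊕ Fin 2) :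
    F.X i ∈ V := by
  -- Let `q` be a preimage of the field of `x_l x_j`. The bracket of `∑ c i • X i` with `q` has as
  -- image the field of `c_l x_j + c_j x_l`, the directional derivative. The left-hand combination
  -- has the same image, so the two differ by a multiple of `e`, which is in `V`.
  have step : ∀ j, c l • sgn j.swap • F.X j.swap + c j • sgn l.swap • F.X l.swap ∈ V := fun j => by
    obtain ⟨q, hq, h⟩ := hF.exists_toDer_eq (tcoeff_top_var_mul_var (k := k) l j)
    have hs : ∑ i, c i • F.X i ∈ centralizer (k := k) F.e :=
      sum_mem fun i _ => (centralizer (k := k) F.e).smul_mem _ (F.X_mem_centralizer i)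
    set w := c l • sgn j.swap • F.X j.swap + c j • sgn l.swap • F.X l.swap with hw
    have hwc : w ∈ centralizer (k := k) F.e := add_mem
      ((centralizer (k := k) F.e).smul_mem _ (zsmul_mem (F.X_mem_centralizer _) _))
      ((centralizer (k := k) F.e).smul_mem _ (zsmul_mem (F.X_mem_centralizer _) _))
    set u := ∑ i, c i • ⁅F.X i, q⁆ with hu
    have h1 : ⁅q, ∑ i, c i • F.X i⁆ = -u := by
      rw [hu, lie_sum, ← Finset.sum_neg_distrib]
      refine Finset.sum_congr rfl fun i _ => ?_
      rw [lie_smul, ← lie_skew, smul_neg]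
    have huc : u ∈ centralizer (k := k) F.e := sum_mem fun i _ => (centralizer (k := k) F.e).smul_mem _
      ((centralizer (k := k) F.e).lie_mem (F.X_mem_centralizer i) hq)
    have h2 : ∑ i, c i • partialD 3 2 k i (var 3 2 k l * var 3 2 k j) =
        c l • var 3 2 k j + c j • var 3 2 k l := by
      have h3 : ∀ i, c i • partialD 3 2 k i (var 3 2 k l * var 3 2 k j) =
          (if i = l then c l • var 3 2 k j else 0) +
            if i = j then c j • var 3 2 k l else 0 := fun i => by
        rw [Derivation.leibniz, partialD_var, partialD_var, smul_eq_mul, smul_eq_mul]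
        by_cases h4 : i = l
        · subst h4
          by_cases h5 : i = j
          · subst h5; simp
          · simp [h5]
        · by_cases h5 : i = j
          · subst h5; simp [h4]
          · simp [h4, h5]
      rw [Finset.sum_congr rfl fun i _ => h3 i, Finset.sum_add_distrib]
      simp
    have h3 : F.toDer u = F.toDer w := by
      have h4 : ∀ i, F.toDer (c i • ⁅F.X i, q⁆) =
          hamField (c i • partialD 3 2 k i (var 3 2 k l * var 3 2 k j)) := fun i => by
        rw [map_smul, toDer_lie_X, h, lie_hamField (partialD_mem i), map_smul]
      rw [hu, map_sum, Finset.sum_congr rfl fun i _ => h4 i, ← map_sum, h2, map_add, map_smul hamField (c l),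
        map_smul hamField (c j), ← toDer_sgn_smul_X (F := F),
        ← toDer_sgn_smul_X (F := F), hw, map_add, map_smul F.toDer (c l),
        map_smul F.toDer (c j)]
    have hwu : w - u ∈ centralizer (k := k) F.e :=
      (centralizer (k := k) F.e).toSubmodule.sub_mem hwc huc
    have h5 : w - u ∈ k ∙ F.e :=
      F.mem_line_of_toDer_eq_zero (centralizer_le_normalizer _ hwu)
        (toDer_sub_eq_zero h3.symm)
    have h6 : w - u ∈ V := (Submodule.span_singleton_le_iff_mem _ _).mpr he h5
    have h7 := hV q hq _ hc
    rw [h1] at h7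
    have h8 : u ∈ V := by simpa using V.neg_mem h7
    exact (V.sub_mem_iff_left h8).mp h6
  have sgn_mem : ∀ j : Fin 2 ⊕ Fin 2, sgn j.swap • F.X j.swap ∈ V → F.X j.swap ∈ V := fun j h => by
    have := zsmul_mem h (sgn j.swap)
    rwa [sgn_smul_sgn_smul] at this
  -- The case `j = l` of `step` gives twice a nonzero multiple; once this vector is available,
  -- `step` yields every other `X i`.
  have h0 : F.X l.swap ∈ V := by
    refine sgn_mem l ?_
    have h1 := step l
    rw [← two_smul k, smul_smul] at h1
    exact (V.smul_mem_iff (mul_ne_zero two_ne_zero' hl)).mp h1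
  have h2 := sgn_mem i.swap ((V.smul_mem_iff hl).mp ((V.add_mem_iff_left
    (V.smul_mem _ (zsmul_mem h0 _))).mp (step i.swap)))
  rwa [Sum.swap_swap] at h2

/-- A subalgebra properly containing the normaliser contains preimages of the `X i` under `ad e`. -/
lemma HasTop.exists_lie_eq (hF : F.HasTop) (he : ∀ y : L, ⁅F.e, ⁅F.e, ⁅F.e, y⁆⁆⁆ = 0) {t : L}
    (ht : ⁅t, F.e⁆ = F.e) {M : LieSubalgebra k L} (hM : normalizer (k := k) F.e < M)
    (i : Fin 2 ⊕ Fin 2) : ∃ y ∈ M, ⁅F.e, y⁆ = F.X i := by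
  have heM : F.e ∈ M := hM.le F.e_mem_normalizer
  have hcM : ∀ u ∈ centralizer (k := k) F.e, u ∈ M := fun u hu =>
    hM.le (centralizer_le_normalizer _ hu)
  have hmem : ∀ {y : L}, ⁅F.e, y⁆ ∈ k ∙ F.e → y ∈ normalizer (k := k) F.e := fun {y} h => by
    obtain ⟨c, hc⟩ := Submodule.mem_span_singleton.mp h
    exact mem_normalizer.mpr ⟨-c, by rw [← lie_skew, ← hc, neg_smul]⟩
  -- The part of `[e, M]` inside the normaliser. It is stable under the `ad (X i)`, so by
  -- `subset_line` it is either contained in the line or has an element outside the line that they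
  -- all map into the line.
  let Z : Set L := {z | z ∈ normalizer (k := k) F.e ∧ ∃ y ∈ M, ⁅F.e, y⁆ = z}
  have hZ : ∀ z ∈ Z, ∀ i, ⁅F.X i, z⁆ ∈ Z := by
    rintro _ ⟨hz, y, hy, rfl⟩ i
    refine ⟨F.lie_X_mem hz i, ⁅F.X i, y⁆, M.lie_mem (hcM _ (F.X_mem_centralizer i)) hy, ?_⟩
    rw [leibniz_lie (F.X i), F.lie_e, zero_lie, zero_add]
  obtain ⟨z, hz, hze⟩ : ∃ z ∈ Z, z ∉ k ∙ F.e := by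
    obtain ⟨y, hy, hyN⟩ := SetLike.exists_of_lt hM
    -- Since `(ad e)³ = 0`, one of `⁅e, y⁆` and `⁅e, ⁅e, y⁆⁆` lies in the normaliser but not in the
    -- line.
    by_cases h : ⁅F.e, y⁆ ∈ normalizer (k := k) F.e
    · exact ⟨_, ⟨h, y, hy, rfl⟩, fun h' => hyN (hmem h')⟩
    · refine ⟨⁅F.e, ⁅F.e, y⁆⁆, ⟨hmem ?_, _, M.lie_mem heM hy, rfl⟩, fun h' => h (hmem h')⟩
      rw [he]; exact zero_mem _
  obtain ⟨z, hz, hzX, hze⟩ : ∃ z ∈ Z, (∀ i, ⁅F.X i, z⁆ ∈ k ∙ F.e) ∧ z ∉ k ∙ F.e := by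
    by_contra! hcon
    exact hze (F.subset_line hZ hcon hz)
  -- All of `[e, M]`: it is a module for the centraliser and, thanks to `t`, contains `e`, as
  -- `X_mem` requires.
  let V : Submodule k L := M.toSubmodule.map (LieAlgebra.ad k L F.e : L →ₗ[k] L)
  have heV : F.e ∈ V := by
    refine ⟨-t, M.toSubmodule.neg_mem (hM.le (mem_normalizer.mpr ⟨1, by rw [ht, one_smul]⟩)), ?_⟩
    change ⁅F.e, -t⁆ = F.e
    rw [lie_neg, lie_skew, ht]
  have hV : ∀ u ∈ centralizer (k := k) F.e, ∀ v ∈ V, ⁅u, v⁆ ∈ V := by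
    rintro u hu _ ⟨y, hy, rfl⟩
    refine ⟨⁅u, y⁆, M.lie_mem (hcM u hu) hy, ?_⟩
    change ⁅F.e, ⁅u, y⁆⁆ = ⁅u, ⁅F.e, y⁆⁆
    rw [leibniz_lie u, mem_centralizer.mp hu, zero_lie, zero_add]
  have hzV : z ∈ V := by
    obtain ⟨-, y, hy, h⟩ := hz
    exact ⟨y, hy, h⟩
  have hdec := F.eq_of_lie_X_mem hz.1 hzX
  obtain ⟨l, hl⟩ : ∃ l, F.π l z ≠ 0 := by
    by_contra! hcon
    simp only [hcon, zero_smul, Finset.sum_const_zero, add_zero] at hdec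
    exact hze (Submodule.mem_span_singleton.mpr ⟨_, hdec.symm⟩)
  have hs : ∑ i, F.π i z • F.X i ∈ V := by
    rw [hdec] at hzV
    exact (V.add_mem_iff_right (V.smul_mem _ heV)).mp hzV
  obtain ⟨y, hy, h⟩ := hF.X_mem heV hV hs hl i
  exact ⟨y, hy, h⟩

end Frame

end Hamiltonian

end


noncomputable section

namespace ExceptionalE8

/-! ### Subalgebras containing root vectors -/

section Generation

variable {k : Type*} [CommRing k] {M : LieSubalgebra k (Alg k)}

/-- E₈ is simply laced, so the structure constant is a sign and can be removed. -/
lemma rootVec_add_mem {u v : Fin 8 → ℤ} (hu : form u u = 2) (hv : form v v = 2)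
    (huv : form u v = -1) (mu : rootVec k u ∈ M) (mv : rootVec k v ∈ M) :
    rootVec k (u + v) ∈ M := by
  have h := M.lie_mem mu mv
  rw [lie_def, bracket_root k hu hv huv] at h
  rcases sign_cases u v with s | s
  · rwa [s, one_smul] at h
  · rw [s, neg_smul, one_smul] at h
    have h2 := M.toSubmodule.neg_mem h
    rwa [neg_neg] at h2

/-- All root vectors are reached by `root_induction`, and the coroots are brackets of opposite
simple root vectors. -/
lemma eq_top_of_simple_mem (hs : ∀ i, rootVec k (Pi.single i 1) ∈ M)
    (hn : ∀ i, rootVec k (-Pi.single i 1) ∈ M) : M = ⊤ := by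
  have hroot : ∀ a, form a a = 2 → rootVec k a ∈ M := by
    refine root_induction hs hn (fun i a ha h m => ?_) (fun i a ha h m => ?_)
    · exact rootVec_add_mem ha (form_single_self i) (by rw [form_comm, h]) m (hs i)
    · refine rootVec_add_mem ha ?_ ?_ m (hn i)
      · rw [form_neg_left, form_neg_right, neg_neg, form_single_self]
      · rw [form_neg_right, form_comm, h]
  have h : M.toSubmodule.mkQ = 0 := ext_basisVec k fun s => by
    rw [LinearMap.zero_apply, Submodule.mkQ_apply, Submodule.Quotient.mk_eq_zero]
    rcases s with i | a
    · rw [← cartan_single, ← bracket_opp' k (form_single_self i)]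
      exact M.lie_mem (hn i) (hs i)
    · rw [basisVec_inr]
      exact hroot a.1 a.2
  refine eq_top_iff.mpr fun y _ => ?_
  have h1 := LinearMap.congr_fun h y
  rwa [LinearMap.zero_apply, Submodule.mkQ_apply, Submodule.Quotient.mk_eq_zero] at h1

lemma codeVec_add_mem {a c : ℕ} (ha : IsRootCode a) (hc : IsRootCode c)
    (hw : IsRootCode (a + c - zeroCode)) (ma : codeVec k a ∈ M) (mc : codeVec k c ∈ M) :
    codeVec k (a + c - zeroCode) ∈ M := by
  have h := (codeOf_eq_of_root ha hc hw).mp rfl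
  have hf := form_add_self ha.form hc.form
  rw [← h, hw.form] at hf
  rw [codeVec_of_le k hw.1, h]
  rw [codeVec_of_le k ha.1] at ma
  rw [codeVec_of_le k hc.1] at mc
  exact rootVec_add_mem ha.form hc.form (by omega) ma mc

lemma isRootCode_of_ble {c : ℕ} (h : Nat.ble 8 c = true) (hc : isCode c = true) : IsRootCode c :=
  ⟨Nat.le_of_ble_eq_true h, hc⟩

/-- Add the sum of two roots to a list of codes of roots, if both are in the list. -/
def closeStep (l : List ℕ) (s : ℕ × ℕ) : List ℕ :=
  bif l.contains s.1 && l.contains s.2 && Nat.ble 8 (s.1 + s.2 - zeroCode) &&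
    isCode (s.1 + s.2 - zeroCode) then (s.1 + s.2 - zeroCode) :: l else l

lemma closeStep_mem {l : List ℕ} (hl : ∀ c ∈ l, IsRootCode c ∧ codeVec k c ∈ M) (s : ℕ × ℕ) :
    ∀ c ∈ closeStep l s, IsRootCode c ∧ codeVec k c ∈ M := by
  obtain ⟨a, b⟩ := s
  simp only [closeStep, Bool.cond_eq_ite]
  generalize hw' : a + b - zeroCode = w
  split_ifs with h
  · rw [Bool.and_eq_true, Bool.and_eq_true, Bool.and_eq_true, List.contains_iff_mem,
      List.contains_iff_mem] at h
    obtain ⟨⟨⟨h1, h2⟩, h3⟩, h4⟩ := h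
    have hw : IsRootCode w := isRootCode_of_ble h3 h4
    have m : codeVec k w ∈ M := by
      have hw2 := hw
      rw [← hw'] at hw2 ⊢
      exact codeVec_add_mem (hl a h1).1 (hl b h2).1 hw2 (hl a h1).2 (hl b h2).2
    intro c hc
    rcases List.mem_cons.mp hc with h | hc
    · rw [h]; exact ⟨hw, m⟩
    · exact hl c hc
  · exact hl

lemma foldl_closeStep_mem (t : List (ℕ × ℕ)) {l : List ℕ}
    (hl : ∀ c ∈ l, IsRootCode c ∧ codeVec k c ∈ M) :
    ∀ c ∈ t.foldl closeStep l, IsRootCode c ∧ codeVec k c ∈ M := by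
  induction t generalizing l with
  | nil => exact hl
  | cons s t ih => exact ih (closeStep_mem hl s)

/-- Codes of roots whose root vectors centralise `e`. -/
def centralizerCodes : List ℕ :=
  [147510191868130, 142971399436256, 142971416479776, 142902697265184, 142971416741984,
   142971416746017, 147511282649314, 142972524570721, 147439273248800, 147440381606050,
   147509083777121, 138433732405151, 147510174558369, 147369463253024, 142900498392991,
   142901589174239, 138362831357790]

/-- Preimages of `X₀`, `X₁` and `X₂` under `ad e`. -/
def preimage : Fin 3 → SVec
  | 0 => [(2, 143041227266145), (1, 147439273777248), (1, 143041244043360)]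
  | 1 => [(2, 142971417004128), (2, 142971417008160), (1, 142971433781280)]
  | 2 => [(1, 138502469187551), (2, 138503542925279), (2, 142900515694559)]

/-- Codes of roots obtained from `preimage` and `centralizerCodes`. -/
def extraCodes : List ℕ := [138432624576350, 142901606479839, 138502469183455]

/-- Pairs of roots by whose successive addition one reaches the simple roots and their negatives. -/
def rootSums : List (ℕ × ℕ) :=
  [(142971399436256, 138502469183455), (138502451877791, 147440381606050), (138433732405151,
   138502469183455), (142901606479839, 147509083777121), (133964784846686, 147439273515040),
   (138432641619806, 147510191868130), (147440381606050, 138432624576350), (142901589440480,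
   138502469183455), (147511282649314, 138502469183455), (143042335090849, 147439273515040),
   (138432641882015, 147510191863969), (147439273248800, 138502469183455), (142972524570721,
   142970325690335), (147511282649314, 138432624576350), (147509083777121, 138502469183455),
   (147510191868130, 138502469183455), (142901606479839, 147510174558369), (143041244309665,
   147440364296288), (138432641619806, 147510191864033), (142901606479839, 142971416746017),
   (143042335090849, 142901606483936), (138502451877791, 147439273515040), (142972524832865,
   142970308650911), (143042335090849, 147439273248800), (138432641882015, 147510191597729),
   (143041244309665, 147439273515040), (138432641882015, 147509101082785), (142972490483744,
   142970326222880), (143041244309665, 142901606483936), (142971434051681, 142970325690335),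
   (143042335090849, 138433732405151), (138504650754080, 143040136218656)]

-- The pairs in `rootSums` are a derivation script: each sum is added once both summands are
-- present, until all simple roots and their negatives have appeared.
set_option maxRecDepth 100000 in
lemma simple_mem_rootSums : ∀ i : Fin 8,
    zeroCode + 64 ^ (i : ℕ) ∈ rootSums.foldl closeStep (extraCodes ++ centralizerCodes) ∧
    zeroCode - 64 ^ (i : ℕ) ∈ rootSums.foldl closeStep (extraCodes ++ centralizerCodes) := by
  decide +kernel

set_option maxRecDepth 100000 in
lemma centralizerCodes_check : centralizerCodes.all (fun c => isCode c && Nat.ble 8 c &&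
    (svBracket [(1, c)] svE).isEmpty) = true := by
  decide +kernel

set_option maxRecDepth 100000 in
lemma extraCodes_check : ∀ c ∈ extraCodes, IsRootCode c := by
  unfold IsRootCode
  decide +kernel

-- The last three brackets combine the preimages with centralising root vectors; up to a nonzero
-- scalar each is a single root vector. They give the `extraCodes` with which `rootSums` starts.
set_option maxRecDepth 100000 in
lemma preimage_check : (∀ i, Valid (preimage i)) ∧
    svEq (svBracket svE (preimage 0)) svX0 = true ∧
    svEq (svBracket svE (preimage 1)) svX1 = true ∧
    svEq (svBracket svE (preimage 2)) svX2 = true ∧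
    svEq (svBracket (preimage 2) [(1, 142900498392991)]) [(1, 138432624576350)] = true ∧
    svEq (svBracket (preimage 1) (svBracket (preimage 1) [(1, 142901589174239)]))
      [(2, 142901606479839)] = true ∧
    svEq (svBracket (preimage 0) (svBracket (preimage 0) [(1, 138362831357790)]))
      [(1, 138502469183455)] = true := by
  decide +kernel

set_option maxRecDepth 100000 in
/-- An element of the Cartan subalgebra acts on `e` as the identity. -/
lemma cartan_check : Valid [(2, 1), (2, 2), (2, 5), (2, 7)] ∧
    svEq (svBracket [(2, 1), (2, 2), (2, 5), (2, 7)] svE) svE = true := by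
  decide +kernel

end Generation

/-! ### Maximality of the normaliser -/

section Maximality

open LieLine

variable {k : Type*} [Field k] [CharP k 3]

lemma eq_top_of_preimage_mem {M : LieSubalgebra k (Alg k)}
    (hM : centralizer (k := k) (eval k svE) ≤ M) (h : ∀ i, eval k (preimage i) ∈ M) : M = ⊤ := by
  obtain ⟨hv, -, -, -, h2, h1, h0⟩ := preimage_check
  have hcent : ∀ c ∈ centralizerCodes, IsRootCode c ∧ codeVec k c ∈ M := fun c hc => by
    have h := List.all_eq_true.mp centralizerCodes_check c hc
    simp only [Bool.and_eq_true] at h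
    refine ⟨isRootCode_of_ble h.1.2 h.1.1, hM (mem_centralizer.mpr ?_)⟩
    rw [codeVec_eq_eval, lie_eval (Valid.singleton h.1.1) valid_svE, eval_of_isEmpty h.2]
  have hext : ∀ c ∈ extraCodes, codeVec k c ∈ M := by
    have hval : ∀ c ∈ centralizerCodes, Valid [(1, c)] := fun c hc =>
      Valid.singleton (hcent c hc).1.2
    have m2 := M.lie_mem (h 2) (hcent 142900498392991 (by decide)).2
    rw [codeVec_eq_eval, lie_eval (hv 2) (hval _ (by decide)), eval_eq_of_svEq k h2,
      ← codeVec_eq_eval] at m2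
    have m1 := M.lie_mem (h 1) (M.lie_mem (h 1) (hcent 142901589174239 (by decide)).2)
    rw [codeVec_eq_eval, lie_eval (hv 1) (hval _ (by decide)),
      lie_eval (hv 1) ((hv 1).svBracket (hval _ (by decide))), eval_eq_of_svEq k h1] at m1
    have m0 := M.lie_mem (h 0) (M.lie_mem (h 0) (hcent 138362831357790 (by decide)).2)
    rw [codeVec_eq_eval, lie_eval (hv 0) (hval _ (by decide)),
      lie_eval (hv 0) ((hv 0).svBracket (hval _ (by decide))), eval_eq_of_svEq k h0,
      ← codeVec_eq_eval] at m0
    have m1' : codeVec k 142901606479839 ∈ M := by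
      rw [eval_cons, eval_nil, add_zero] at m1
      refine (M.toSubmodule.smul_mem_iff ?_).mp m1
      exact_mod_cast Hamiltonian.two_ne_zero'
    intro c hc
    simp only [extraCodes, List.mem_cons, List.not_mem_nil, or_false] at hc
    rcases hc with rfl | rfl | rfl
    exacts [m2, m1', m0]
  have hall := foldl_closeStep_mem (M := M) rootSums (l := extraCodes ++ centralizerCodes)
    fun c hc => (List.mem_append.mp hc).elim (fun hc => ⟨extraCodes_check c hc, hext c hc⟩) (hcent c)
  refine eq_top_of_simple_mem (fun i => ?_) fun i => ?_
  · have := hall _ (simple_mem_rootSums i).1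
    rw [← (simple_isCode i).2.2.1, ← codeVec_of_le k this.1.1]
    exact this.2
  · have := hall _ (simple_mem_rootSums i).2
    rw [← (simple_isCode i).2.2.2.1, ← codeVec_of_le k this.1.1]
    exact this.2

lemma lie_e_preimage (i : Fin 3) : ∃ j : Fin 2 ⊕ Fin 2,
    ⁅eval k svE, eval k (preimage i)⁆ = (frame k).X j := by
  obtain ⟨hv, h0, h1, h2, -⟩ := preimage_check
  rw [lie_eval valid_svE (hv i)]
  fin_cases i
  · exact ⟨Sum.inl 0, eval_eq_of_svEq k h0⟩
  · exact ⟨Sum.inl 1, eval_eq_of_svEq k h1⟩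
  · exact ⟨Sum.inr 0, eval_eq_of_svEq k h2⟩

/-- By `exists_lie_eq` a larger subalgebra contains some `y` with `⁅e, y⁆ = X j`. It differs from
the explicit preimage by an element of the centraliser, so the explicit preimages lie in the
subalgebra, and `eq_top_of_preimage_mem` applies. The normaliser is proper because no `X j` lies in
the line. -/
lemma isCoatom_normalizer : IsCoatom (normalizer (k := k) (eval k svE)) := by
  refine ⟨fun htop => ?_, fun M hM => ?_⟩
  · obtain ⟨j, hj⟩ := lie_e_preimage (k := k) 0
    have hmem : eval k (preimage 0) ∈ normalizer (k := k) (eval k svE) := htop ▸ LieSubalgebra.mem_top _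
    obtain ⟨c, hc⟩ := mem_normalizer.mp hmem
    have h1 : (frame k).X j = -(c • (frame k).e) := by rw [← hj, ← lie_skew, hc]; rfl
    have h2 := congrArg ((frame k).π j) h1
    rw [(frame k).π_X, if_pos rfl, map_neg, map_smul, (frame k).π_of_mem j _ (frame k).e_mem,
      smul_zero, neg_zero] at h2
    exact one_ne_zero h2
  · have hc : centralizer (k := k) (eval k svE) ≤ M := (centralizer_le_normalizer _).trans hM.le
    refine eq_top_of_preimage_mem hc fun i => ?_
    obtain ⟨j, hj⟩ := lie_e_preimage (k := k) i
    obtain ⟨y, hy, h⟩ := (hasTop_frame (k := k)).exists_lie_eq (opVec_cube (i := 0) (by decide))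
      -- Minus the sum of the coroots of one node in each component of 2A₂ + 2A₁: it takes the value
      -- -2 = 1 on that node and 1 on the other node of the component, if there is one.
      (t := eval k [(2, 1), (2, 2), (2, 5), (2, 7)])
      ((lie_eval cartan_check.1 valid_svE).trans (eval_eq_of_svEq k cartan_check.2)) hM j
    have h2 : eval k (preimage i) - y ∈ M := hc (mem_centralizer.mpr (by
      have h' : ⁅eval k svE, y⁆ = (frame k).X j := h
      rw [← lie_skew, lie_sub, hj, h', sub_self, neg_zero]))
    have h3 := M.add_mem h2 hy
    rwa [sub_add_cancel] at h3

end Maximality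

end ExceptionalE8

end


noncomputable section

/-! ### Transport along automorphisms, and passage to the quotients -/

namespace LieLine

section Transport

variable {k L L' : Type*} [CommRing k] [LieRing L] [LieAlgebra k L] [LieRing L'] [LieAlgebra k L']

lemma symm_mem_centralizer (σ : L ≃ₗ⁅k⁆ L) {e y : L} (hy : y ∈ centralizer (k := k) (σ e)) :
    σ.symm y ∈ centralizer (k := k) e := by
  have h : ⁅σ.symm y, σ.symm (σ e)⁆ = 0 := by
    rw [← LieEquiv.map_lie, mem_centralizer.mp hy, map_zero]
  rwa [LieEquiv.symm_apply_apply] at h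

lemma symm_mem_normalizer (σ : L ≃ₗ⁅k⁆ L) {e y : L} (hy : y ∈ normalizer (k := k) (σ e)) :
    σ.symm y ∈ normalizer (k := k) e := by
  obtain ⟨c, hc⟩ := mem_normalizer.mp hy
  have h : ⁅σ.symm y, σ.symm (σ e)⁆ = c • σ.symm (σ e) := by
    rw [← LieEquiv.map_lie, hc, map_smul]
  rw [LieEquiv.symm_apply_apply] at h
  exact mem_normalizer.mpr ⟨c, h⟩

lemma map_mem_normalizer (σ : L ≃ₗ⁅k⁆ L) {e y : L} (hy : y ∈ normalizer (k := k) e) :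
    σ y ∈ normalizer (k := k) (σ e) := by
  obtain ⟨c, hc⟩ := mem_normalizer.mp hy
  exact mem_normalizer.mpr ⟨c, by rw [← LieEquiv.map_lie, hc, map_smul]⟩

lemma map_mem_centralizer (σ : L ≃ₗ⁅k⁆ L) {e y : L} (hy : y ∈ centralizer (k := k) e) :
    σ y ∈ centralizer (k := k) (σ e) := by
  rw [mem_centralizer, ← LieEquiv.map_lie, mem_centralizer.mp hy, map_zero]

lemma symm_mem_line_iff (σ : L ≃ₗ⁅k⁆ L) {e y : L} : σ.symm y ∈ k ∙ e ↔ y ∈ k ∙ σ e := by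
  rw [Submodule.mem_span_singleton, Submodule.mem_span_singleton]
  refine exists_congr fun c => ?_
  rw [← map_smul]
  exact ⟨fun h => by rw [h, LieEquiv.apply_symm_apply], fun h => by
    rw [← h, LieEquiv.symm_apply_apply]⟩

/-- The map of centralisers induced by an automorphism. -/
def centralizerMap (σ : L ≃ₗ⁅k⁆ L) (e : L) :
    centralizer (k := k) (σ e) →ₗ⁅k⁆ centralizer (k := k) e where
  toFun y := ⟨σ.symm y.1, symm_mem_centralizer σ y.2⟩
  map_add' y z := Subtype.ext (map_add σ.symm y.1 z.1)
  map_smul' c y := Subtype.ext (map_smul σ.symm c y.1)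
  map_lie' := fun {y z} => Subtype.ext (LieEquiv.map_lie σ.symm y.1 z.1)

/-- The map of normalisers induced by an automorphism. -/
def normalizerMap (σ : L ≃ₗ⁅k⁆ L) (e : L) :
    normalizer (k := k) (σ e) →ₗ⁅k⁆ normalizer (k := k) e where
  toFun y := ⟨σ.symm y.1, symm_mem_normalizer σ y.2⟩
  map_add' y z := Subtype.ext (map_add σ.symm y.1 z.1)
  map_smul' c y := Subtype.ext (map_smul σ.symm c y.1)
  map_lie' := fun {y z} => Subtype.ext (LieEquiv.map_lie σ.symm y.1 z.1)

lemma isCoatom_normalizer_map (σ : L ≃ₗ⁅k⁆ L) {e : L} (h : IsCoatom (normalizer (k := k) e)) :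
    IsCoatom (normalizer (k := k) (σ e)) := by
  refine ⟨fun htop => h.1 (eq_top_iff.mpr fun y _ => ?_), fun M hM => eq_top_iff.mpr fun y _ => ?_⟩
  · have := symm_mem_normalizer σ (e := e) (y := σ y) (htop ▸ LieSubalgebra.mem_top _)
    rwa [LieEquiv.symm_apply_apply] at this
  · have hlt : normalizer (k := k) e < M.comap (σ : L →ₗ⁅k⁆ L) := by
      refine SetLike.lt_iff_le_and_exists.mpr
        ⟨fun z hz => hM.le (map_mem_normalizer σ hz), ?_⟩
      obtain ⟨z, hz, hzn⟩ := SetLike.exists_of_lt hM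
      refine ⟨σ.symm z, ?_, fun h' => hzn ?_⟩
      · change σ (σ.symm z) ∈ M
        rwa [LieEquiv.apply_symm_apply]
      · have := map_mem_normalizer σ h'
        rwa [LieEquiv.apply_symm_apply] at this
    have h1 : σ.symm y ∈ M.comap (σ : L →ₗ⁅k⁆ L) := (h.2 _ hlt) ▸ LieSubalgebra.mem_top _
    have h2 : σ (σ.symm y) ∈ M := h1
    rwa [LieEquiv.apply_symm_apply] at h2

/-- A Lie algebra homomorphism with kernel the line spanned by an element descends to an injective
homomorphism from the quotient. -/
lemma exists_quotient_hom {e : L} {K : LieSubalgebra k L} (hK : K ≤ normalizer e)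
    (φ : K →ₗ⁅k⁆ L') (hφ : ∀ y, φ y = 0 ↔ y.1 ∈ k ∙ e) :
    ∃ ψ : (K ⧸ lineIdeal e K hK) →ₗ⁅k⁆ L', Function.Injective ψ ∧
      ∀ y, ψ (LieSubmodule.Quotient.mk y) = φ y := by
  let f : (K ⧸ lineIdeal e K hK) →ₗ[k] L' :=
    (lineIdeal e K hK).toSubmodule.liftQ (φ : K →ₗ[k] L') fun y hy => (hφ y).mpr hy
  have hf : ∀ y, f (LieSubmodule.Quotient.mk y) = φ y := fun y => rfl
  have hinj : Function.Injective f := by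
    refine (injective_iff_map_eq_zero f).mpr fun z => ?_
    obtain ⟨y, rfl⟩ := LieSubmodule.Quotient.surjective_mk' (lineIdeal e K hK) z
    intro h
    exact (LieSubmodule.Quotient.mk_eq_zero _).mpr ((hφ y).mp h)
  refine ⟨{ f with
    map_lie' := fun {z w} => ?_ }, hinj, hf⟩
  obtain ⟨y, rfl⟩ := LieSubmodule.Quotient.surjective_mk' (lineIdeal e K hK) z
  obtain ⟨x, rfl⟩ := LieSubmodule.Quotient.surjective_mk' (lineIdeal e K hK) w
  exact LieHom.map_lie φ y x

end Transport

end LieLine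

namespace ExceptionalE8

open LieLine Hamiltonian

section Automorphisms

variable {k : Type*} [Field k] [CharP k 3]

-- Adding `a` twice to a root gives neither a root nor zero, unless the root is `-a`. So only the
-- root vector of `-a` survives, and it is sent to a multiple of that of `a`.
omit [CharP k 3] in
lemma lie_lie_rootVec_mem (a : Root) (y : Alg k) :
    ⁅rootVec k a.1, ⁅rootVec k a.1, y⁆⁆ ∈ k ∙ rootVec k a.1 := by
  set V := k ∙ rootVec k a.1 with hV
  have key : V.mkQ ∘ₗ bracketMap k (rootVec k a.1) ∘ₗ bracketMap k (rootVec k a.1) = 0 := by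
    refine ext_basisVec k fun s => ?_
    rw [LinearMap.comp_apply, LinearMap.zero_apply, Submodule.mkQ_apply,
      Submodule.Quotient.mk_eq_zero, LinearMap.comp_apply]
    rcases s with i | c
    · rw [← cartan_single, bracket_rootVec_cartan, map_neg, map_zsmul, bracket_self, smul_zero,
        neg_zero]
      exact zero_mem _
    · rw [basisVec_inr]
      obtain ⟨h1, h2⟩ := form_bounds a.2 c.2
      rcases le_or_gt 0 (form a.1 c.1) with h | h
      · rw [bracket_zero k a.2 c.2 h, map_zero]
        exact zero_mem _
      · have h3 := form_add_self a.2 c.2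
        have : form a.1 c.1 = -1 ∨ form a.1 c.1 = -2 := by omega
        rcases this with h | h
        · rw [bracket_root k a.2 c.2 h, map_zsmul, bracket_zero k a.2 (by omega)
            (by rw [form_add_right, a.2, h]; norm_num), smul_zero]
          exact zero_mem _
        · rw [add_eq_zero_of_form a.2 c.2 h, bracket_opp k a.2, map_neg, bracket_rootVec_cartan,
            neg_neg]
          exact V.toAddSubgroup.zsmul_mem (Submodule.mem_span_singleton_self _) _
  have h := LinearMap.congr_fun key y
  rwa [LinearMap.comp_apply, LinearMap.zero_apply, Submodule.mkQ_apply,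
    Submodule.Quotient.mk_eq_zero] at h

lemma rootElement_apply (a : Root) (t : k) (y : Alg k) : rootElement k a t y =
    y + t • ⁅rootVec k a.1, y⁆ + (t ^ 2 / 2) • ⁅rootVec k a.1, ⁅rootVec k a.1, y⁆⁆ := rfl

/-- Vanishing of the cube alone does not make the exponential of a derivation multiplicative in
characteristic three. Here, with x the root vector, `⁅x, ⁅x, y⁆⁆ = c • x` and `⁅x, ⁅x, z⁆⁆ = d • x`;
so the terms of third order in `t` cancel as multiples of `c * d • x`, and that of fourth order
contains `⁅x, x⁆`. -/
lemma rootElement_lie (a : Root) (t : k) (y z : Alg k) :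
    rootElement k a t ⁅y, z⁆ = ⁅rootElement k a t y, rootElement k a t z⁆ := by
  have h2 : (2 : k) ≠ 0 := two_ne_zero'
  obtain ⟨c, hc⟩ := Submodule.mem_span_singleton.mp (lie_lie_rootVec_mem a y)
  obtain ⟨d, hd⟩ := Submodule.mem_span_singleton.mp (lie_lie_rootVec_mem a z)
  simp only [rootElement_apply]
  generalize rootVec k a.1 = x at *
  have e1 : ⁅x, ⁅y, z⁆⁆ = ⁅⁅x, y⁆, z⁆ + ⁅y, ⁅x, z⁆⁆ := leibniz_lie x y z
  have e2 : ⁅x, ⁅x, ⁅y, z⁆⁆⁆ = c • ⁅x, z⁆ + (2 : k) • ⁅⁅x, y⁆, ⁅x, z⁆⁆ + d • ⁅y, x⁆ := by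
    rw [e1, lie_add, leibniz_lie x ⁅x, y⁆ z, leibniz_lie x y ⁅x, z⁆, ← hc, ← hd, smul_lie, lie_smul,
      two_smul]
    abel
  have e3 : ⁅⁅x, y⁆, x⁆ = -(c • x) := by rw [hc, lie_skew]
  have e4 : ⁅x, ⁅x, z⁆⁆ = d • x := hd.symm
  rw [e2, e1, ← hc, ← hd]
  simp only [add_lie, lie_add, smul_lie, lie_smul, lie_self, e3, e4, smul_neg, smul_zero, add_zero]
  match_scalars
  all_goals field_simp
  all_goals ring

lemma lie_of_mem_chevalleyGroup {g : Alg k ≃ₗ[k] Alg k} (hg : g ∈ chevalleyGroup k) :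
    ∀ y z, g ⁅y, z⁆ = ⁅g y, g z⁆ := by
  refine Subgroup.closure_induction (p := fun (g : Alg k ≃ₗ[k] Alg k) _ =>
    ∀ y z, g ⁅y, z⁆ = ⁅g y, g z⁆) ?_ ?_ ?_ ?_ hg
  · rintro _ ⟨a, t, rfl⟩
    exact rootElement_lie a t
  · exact fun y z => rfl
  · intro g h _ _ hg hh y z
    rw [LinearEquiv.mul_apply, LinearEquiv.mul_apply, LinearEquiv.mul_apply, hh, hg]
  · intro g _ hg y z
    change g.symm ⁅y, z⁆ = ⁅g.symm y, g.symm z⁆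
    rw [LinearEquiv.symm_apply_eq, hg, LinearEquiv.apply_symm_apply, LinearEquiv.apply_symm_apply]

omit [CharP k 3] in
lemma eval_svE : eval k svE = standardRep k := by
  have h : ∀ i : Fin 8, codeVec k (zeroCode + 64 ^ (i : ℕ)) = rootVec k (Pi.single i 1) := fun i => by
    rw [codeVec_of_le k (le_trans (by norm_num [zeroCode]) (Nat.le_add_right _ _)),
      (simple_isCode i).2.2.1]
  have h0 := h 0; have h1 := h 1; have h2 := h 2; have h4 := h 4; have h5 := h 5; have h7 := h 7
  norm_num [zeroCode] at h0 h1 h2 h4 h5 h7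
  rw [standardRep, Finset.sum_insert (by decide), Finset.sum_insert (by decide),
    Finset.sum_insert (by decide), Finset.sum_insert (by decide), Finset.sum_insert (by decide),
    Finset.sum_singleton]
  simp only [svE, eval_cons, eval_nil, Nat.cast_one, one_smul, add_zero, h0, h1, h2, h4, h5, h7]

/-- Elements of the orbit are images of the representative under automorphisms. -/
lemma exists_lieEquiv {e : Alg k} (he : e ∈ orbitA2A2A1A1 k) :
    ∃ σ : Alg k ≃ₗ⁅k⁆ Alg k, e = σ (frame k).e := by
  obtain ⟨g, hg, rfl⟩ := he
  refine ⟨{ g with map_lie' := fun {y z} => lie_of_mem_chevalleyGroup hg y z }, ?_⟩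
  rw [← eval_svE]; rfl

end Automorphisms

end ExceptionalE8

end

theorem mainTheorem9 (k : Type*) [Field k] [IsAlgClosed k] [CharP k 3]
    (e : ExceptionalE8.Alg k) (he : e ∈ ExceptionalE8.orbitA2A2A1A1 k) :
    -- the second derived subalgebra of `L = 𝔤_e / k e` is isomorphic to `H(4; 1)^{(1)}`
    Nonempty (LieAlgebra.derivedSeries k (LieLine.CentralizerQuotient k e) 2 ≃ₗ⁅k⁆
      Hamiltonian.HDerived 3 2 k) ∧
    -- `𝔫_e / k e` embeds into `Der H(4; 1)^{(1)}`
    (∃ φ : LieLine.NormalizerQuotient k e →ₗ⁅k⁆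
        LieDerivation k (Hamiltonian.HDerived 3 2 k) (Hamiltonian.HDerived 3 2 k),
      Function.Injective φ) ∧
    -- `H(4; 1)^{(1)} ⊆ 𝔤_e / k e ⊆ H(4; 1)`
    (∃ ψ : LieLine.CentralizerQuotient k e →ₗ⁅k⁆ Hamiltonian.H 3 2 k,
      Function.Injective ψ ∧
        ∀ y ∈ LieAlgebra.derivedSeries k (Hamiltonian.H 3 2 k) 1, ∃ z, ψ z = y) ∧
    -- `𝔫_e` is a maximal subalgebra of `𝔤`
    IsCoatom (LieLine.normalizer (k := k) e) := by
  -- The group acts by Lie algebra automorphisms, so everything established for the representative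
  -- is transported along σ.
  obtain ⟨σ, rfl⟩ := ExceptionalE8.exists_lieEquiv he
  have hF := ExceptionalE8.hasTop_frame (k := k)
  obtain ⟨ψ, hψ, hψ'⟩ := LieLine.exists_quotient_hom
    (LieLine.centralizer_le_normalizer (σ (ExceptionalE8.frame k).e))
    ((ExceptionalE8.frame k).centralizerHom.comp (LieLine.centralizerMap σ _)) fun y =>
      ((ExceptionalE8.frame k).centralizerHom_eq_zero_iff _).trans (LieLine.symm_mem_line_iff σ)
  obtain ⟨φ, hφ, -⟩ := LieLine.exists_quotient_hom (e := σ (ExceptionalE8.frame k).e) le_rfl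
    (((Hamiltonian.toLieDerivation k).comp (Hamiltonian.Frame.normalizerHom hF)).comp
      (LieLine.normalizerMap σ _)) fun y =>
      (Hamiltonian.Frame.toLieDerivation_normalizerHom_eq_zero_iff hF _).trans
        (LieLine.symm_mem_line_iff σ)
  have hsurj : ∀ y ∈ LieAlgebra.derivedSeries k (Hamiltonian.H 3 2 k) 1, ∃ z, ψ z = y := by
    intro D hD
    obtain ⟨y, hy⟩ := hF.exists_centralizerHom_eq hD
    refine ⟨LieSubmodule.Quotient.mk ⟨σ y.1, LieLine.map_mem_centralizer σ y.2⟩, ?_⟩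
    rw [hψ', ← hy, LieHom.comp_apply]
    exact congrArg _ (Subtype.ext (LieEquiv.symm_apply_apply σ y.1))
  exact ⟨Hamiltonian.nonempty_derivedSeries_equiv hψ hsurj, ⟨φ, hφ⟩, ⟨ψ, hψ, hsurj⟩,
    LieLine.isCoatom_normalizer_map σ ExceptionalE8.isCoatom_normalizer⟩
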